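/- **Notation.** Let $m,n\ge 1$ and $p,q,t\in\mathbb C^*$. For $|p|,|q|<1$ put $(x;p)_\infty=\prod_{l\ge0}(1-xp^l)$, $(x;p,q)_\infty=\prod_{l\ge0}(p^lx;q)_\infty$, $\Gamma(x;p,q)=(pq/x;p,q)_\infty/(x;p,q)_\infty$, and $\theta(x;p)=(x;p)_\infty(p/x;p)_\infty$ for $|p|<1$. For functions of this kind, $f(cx^\pm)=f(cx)f(cx^{-1})$ and $f(cx^\pm y^\pm)=f(cxy^\pm)f(cx^{-1}y^\pm)$. For $a=(a_0,\dots,a_7)\in(\mathbb C^*)^8$ and a chosen square root $r=(a_0\cdots a_7)^{1/2}$, the van Diejen operator in $x=(x_1,\dots,x_m)$ is $$\mathcal D_x(a|q,t)=A^0(x;a|q,t)+\sum_{i=1}^m\sum_{\varepsilon=\pm1}A_i^{\varepsilon}(x;a|q,t)\,T_{q,x_i}^{\varepsilon},\qquad A_i^\varepsilon=\frac{\prod_{s=0}^7\theta(a_sx_i^\varepsilon;p)}{\theta(x_i^{2\varepsilon};p)\,\theta(qx_i^{2\varepsilon};p)}\prod_{j\ne i}\frac{\theta(tx_i^\varepsilon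 x_j^\pm;p)}{\theta(x_i^\varepsilon x_j^\pm;p)},$$ $$A^0=\frac12\sum_{k=0}^3L_k\frac{\prod_{s=0}^7\theta(c_kq^{-1/2}a_s;p)}{\theta(t;p)\,\theta(q^{-1}t;p)}\prod_{j=1}^m\frac{\theta(c_kq^{-1/2}tx_j^\pm;p)}{\theta(c_kq^{-1/2}x_j^\pm;p)},$$ where $T_{q,x_i}$ replaces $x_i$ by $qx_i$, $c_0=-c_1=1$, $c_2=-c_3^{-1}=p^{1/2}$, $L_0=L_1=1$, $L_2=p^2L_3^{-1}=p^{-1}q^{-2}t^m r$ (the choice of $p^{1/2}$ and $q^{1/2}$ is immaterial). A point of $(\mathbb C^*)^m$ is *generic* for this operator if none of the $x$-dependent denominators above vanishes there. For $K\subseteq\{0,\dots,7\}$ with $|K|$ even, $a_{K(pt)}$ is obtained from $a$ by replacing $a_s$ with $pt/a_s$ for $s\in K$, and the square root chosen for it is $r\,(pt)^{|K|/2}\prod_{s\in K}a_s^{-1}$. Put $$w_n(y;a|t,q)=\prod_{k=1}^n\frac{\prod_{s=0}^7\Gamma(a_sy_k^\pm;p,t)}{\Gamma(y_k^{\pm2};p,t)}\prod_{k<l}\frac{\Gamma(qy_k^\pm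 y_l^\pm;p,t)}{\Gamma(y_k^\pm y_l^\pm;p,t)},\qquad \Phi^\vee(x,y)=\prod_{i=1}^m\prod_{k=1}^nx_i^{-1}\theta(x_iy_k^\pm;p),$$ $$U_K(y;a|t)=\prod_{k=1}^n\prod_{s\in K}\frac1{\Gamma(a_sy_k^\pm;p,t)},\qquad V(y|t,q)=\prod_{k<l}\frac1{\Gamma(qy_k^\pm y_l^\pm;p,t)},$$ $\mathbb T^n=\{|y_1|=\dots=|y_n|=1\}$, $d\omega_n(y)=(2\pi i)^{-n}\frac{dy_1\cdots dy_n}{y_1\cdots y_n}$, and $\mathbb A^n_\rho=\{y:\rho\le|y_k|\le\rho^{-1}\text{ for all }k\}$. **Theorem.** Let $K\subseteq\{0,\dots,7\}$ have even cardinality, and let $p,q,t\in\mathbb C^*$ and $a\in(\mathbb C^*)^8$ satisfy $$|p|<|t|<1,\qquad |p|<|q^{n-1}t^{m-1}|\ \text{ if }K=\emptyset,\qquad |a_s|<1\ (s\notin K),\qquad \theta(q;p)\ne0,\quad \theta(q^{-1}t;p)\neq0,$$ and the balancing condition $a_0\cdots a_7\,q^{2n}t^{2m}=p^2q^2t^2$,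 where the square root of $a_0\cdots a_7$ is the one with $(a_0\cdots a_7)^{1/2}q^nt^m=pqt$. Let $\varphi$ be holomorphic on an open set $\Omega\subseteq\mathbb C^n$ that contains $\mathbb A^n_{|t|}$, and suppose that $\varphi$ is an eigenfunction of $\mathcal D_y(a_{K(pt)}|t,pq^{-1}t)$ with eigenvalue $\Lambda\in\mathbb C$, that is, $\mathcal D_y(a_{K(pt)}|t,pq^{-1}t)\varphi(y)=\Lambda\varphi(y)$ at all generic $y\in\Omega$ for which all the points $T_{t,y_k}^{\pm1}y$ lie in $\Omega$. Then the integral $$\tilde\psi_K^\vee(x;a|q,t)=\int_{\mathbb T^n}d\omega_n(y)\,w_n(y;a|t,q)\,\Phi^\vee(x,y)\,U_K(y;a|t)\,V(y|t,q)\,\varphi(y)$$ converges absolutely for every $x\in(\mathbb C^*)^m$, is a holomorphic function of $x\in(\mathbb C^*)^m$, and is an eigenfunction of $\mathcal D_x(a|q,t)$: at all generic $x\in(\mathbb C^*)^m$, $$\mathcal D_x(a|q,t)\,\tilde\psi_K^\vee(x;a|q,t)=-\frac{q^{-n}t^m\theta(q;p)}{\theta(t;p)}\,\Lambda\,\tilde\psi_K^\vee(x;a|q,t).$$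 -/

import Mathlib

namespace VanDiejen

noncomputable section

/-- The infinite product `(x; p)_∞ = ∏_{l ≥ 0} (1 - x p^l)`, used for `|p| < 1`. -/
def qPoch (x p : ℂ) : ℂ := ∏' l : ℕ, (1 - x * p ^ l)

/-- The infinite product `(x; p, q)_∞ = ∏_{l ≥ 0} (p^l x; q)_∞`, used for `|p|, |q| < 1`. -/
def qPoch₂ (x p q : ℂ) : ℂ := ∏' l : ℕ, qPoch (p ^ l * x) q

/-- The multiplicative theta function `θ(x; p) = (x; p)_∞ (p / x; p)_∞`. -/
def theta (x p : ℂ) : ℂ := qPoch x p * qPoch (p / x) p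

/-- The elliptic Gamma function `Γ(x; p, q) = (p q / x; p, q)_∞ / (x; p, q)_∞`. At its poles the
value is `0` by convention; as a consequence `1 / Γ(x; p, q)` has its correct value `0` there. -/
def ellGamma (x p q : ℂ) : ℂ := qPoch₂ (p * q / x) p q / qPoch₂ x p q

/-- The convention `f(c x^±) = f(c x) f(c x⁻¹)`. -/
def pm (f : ℂ → ℂ) (c x : ℂ) : ℂ := f (c * x) * f (c * x⁻¹)

/-- The convention `f(c x^± y^±) = f(c x y^±) f(c x⁻¹ y^±)`. -/
def pmpm (f : ℂ → ℂ) (c x y : ℂ) : ℂ := pm f (c * x) y * pm f (c * x⁻¹) y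

/-- The shift coefficient `A_i^ε(x; a | q, t)`, with nome `p` and `ε = 1` or `ε = -1`. -/
def shiftCoeff {m : ℕ} (p q t : ℂ) (a : Fin 8 → ℂ) (ε : ℤ) (i : Fin m) (x : Fin m → ℂ) : ℂ :=
  (∏ s, theta (a s * x i ^ ε) p) / (theta ((x i ^ ε) ^ 2) p * theta (q * (x i ^ ε) ^ 2) p) *
    ∏ j ∈ Finset.univ.erase i,
      pm (fun z => theta z p) (t * x i ^ ε) (x j) / pm (fun z => theta z p) (x i ^ ε) (x j)

/-- The constants `c_0 = 1`, `c_1 = -1`, `c_2 = p^{1/2}`, `c_3 = -p^{-1/2}`. -/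
def halfPeriod (p : ℂ) : Fin 4 → ℂ :=
  ![1, -1, p ^ (1 / 2 : ℂ), -(p ^ (1 / 2 : ℂ))⁻¹]

/-- The constants `L_0 = L_1 = 1`, `L_2 = p⁻¹ q⁻² t^m r`, `L_3 = p² / L_2`, where `r` stands for
the square root `(a_0 ⋯ a_7)^{1/2}`. -/
def zeroConst (m : ℕ) (p q t r : ℂ) : Fin 4 → ℂ :=
  ![1, 1, p⁻¹ * (q ^ 2)⁻¹ * t ^ m * r, p ^ 2 / (p⁻¹ * (q ^ 2)⁻¹ * t ^ m * r)]

/-- The zeroth order coefficient `A^0(x; a | q, t)`, with nome `p`. It contains the square root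
`(a_0 ⋯ a_7)^{1/2}`, a choice of which is the argument `r`. It does not depend on the choice of
`p^{1/2}` and `q^{1/2}`: replacing one of these by its negative permutes the four summands. -/
def zeroCoeff {m : ℕ} (p q t : ℂ) (a : Fin 8 → ℂ) (r : ℂ) (x : Fin m → ℂ) : ℂ :=
  (1 / 2) * ∑ k : Fin 4, zeroConst m p q t r k *
    ((∏ s, theta (halfPeriod p k * (q ^ (1 / 2 : ℂ))⁻¹ * a s) p) /
      (theta t p * theta (q⁻¹ * t) p)) *
    ∏ j, pm (fun z => theta z p) (halfPeriod p k * (q ^ (1 / 2 : ℂ))⁻¹ * t) (x j) /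
      pm (fun z => theta z p) (halfPeriod p k * (q ^ (1 / 2 : ℂ))⁻¹) (x j)

/-- The `q`-shift `T_{q, x_i}^ε` on points: `x_i` is replaced by `q^ε x_i`. -/
def shift {m : ℕ} (q : ℂ) (ε : ℤ) (i : Fin m) (x : Fin m → ℂ) : Fin m → ℂ :=
  Function.update x i (q ^ ε * x i)

/-- The van Diejen operator `D_x(a | q, t)` with nome `p`, where `r` is the chosen square root of
`a_0 ⋯ a_7`. -/
def vanDiejen {m : ℕ} (p q t : ℂ) (a : Fin 8 → ℂ) (r : ℂ) (f : (Fin m → ℂ) → ℂ)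
    (x : Fin m → ℂ) : ℂ :=
  zeroCoeff p q t a r x * f x +
    ∑ i, ∑ ε ∈ ({1, -1} : Finset ℤ), shiftCoeff p q t a ε i x * f (shift q ε i x)

/-- The points of `(ℂ^*)^m` at which no denominator of a coefficient of `D_x(a | q, t)`, that is
`θ(x_i^{±2}; p)`, `θ(q x_i^{±2}; p)`, `θ(x_i^± x_j^±; p)` or `θ(c_r q^{-1/2} x_i^±; p)`,
vanishes. -/
def Generic {m : ℕ} (p q : ℂ) (x : Fin m → ℂ) : Prop :=
  (∀ i, x i ≠ 0) ∧
  (∀ i, ∀ k : ℤ, x i ^ 2 ≠ p ^ k ∧ q * x i ^ 2 ≠ p ^ k ∧ x i ^ 2 ≠ q * p ^ k) ∧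
  (∀ i j, i ≠ j → ∀ k : ℤ, x i * x j ≠ p ^ k ∧ x i ≠ p ^ k * x j)

/-- The weight function `w_n(y; a | q, t)`, with nome `p`. -/
def weight {n : ℕ} (p q t : ℂ) (a : Fin 8 → ℂ) (y : Fin n → ℂ) : ℂ :=
  (∏ k, (∏ s, pm (fun z => ellGamma z p q) (a s) (y k)) /
      pm (fun z => ellGamma z p q) 1 (y k ^ 2)) *
    ∏ k, ∏ l ∈ Finset.Ioi k,
      pmpm (fun z => ellGamma z p q) t (y k) (y l) / pmpm (fun z => ellGamma z p q) 1 (y k) (y l)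

/-- The gauge function `U_K(y; a | q)`, with nome `p`. -/
def gaugeU {n : ℕ} (p q : ℂ) (a : Fin 8 → ℂ) (K : Finset (Fin 8)) (y : Fin n → ℂ) : ℂ :=
  ∏ k, ∏ s ∈ K, 1 / pm (fun z => ellGamma z p q) (a s) (y k)

/-- The gauge function `V(y | q, t)`, with nome `p`. -/
def gaugeV {n : ℕ} (p q t : ℂ) (y : Fin n → ℂ) : ℂ :=
  ∏ k, ∏ l ∈ Finset.Ioi k, 1 / pmpm (fun z => ellGamma z p q) t (y k) (y l)

/-- The kernel function of dual-Cauchy type `Φ^∨(x, y)`, with nome `p`. -/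
def dualKernel {m n : ℕ} (p : ℂ) (x : Fin m → ℂ) (y : Fin n → ℂ) : ℂ :=
  ∏ i, ∏ k, (x i)⁻¹ * pm (fun z => theta z p) (x i) (y k)

/-- The parameters `a_{K(c)}`: `a_s` is replaced by `c / a_s` for `s ∈ K`. -/
def reflect (c : ℂ) (K : Finset (Fin 8)) (a : Fin 8 → ℂ) (s : Fin 8) : ℂ :=
  if s ∈ K then c / a s else a s

/-- The square root of the product of the parameters `a_{K(c)}`, `|K|` even, that belongs to the
square root `r` of `a_0 ⋯ a_7`. -/
def reflectRoot (c : ℂ) (K : Finset (Fin 8)) (a : Fin 8 → ℂ) (r : ℂ) : ℂ :=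
  r * c ^ (K.card / 2) / ∏ s ∈ K, a s

/-- The closed annulus `{ y | ρ ≤ |y_k| ≤ ρ⁻¹ for all k }`. -/
def annulus (n : ℕ) (ρ : ℝ) : Set (Fin n → ℂ) := {y | ∀ k, ρ ≤ ‖y k‖ ∧ ‖y k‖ ≤ ρ⁻¹}

/-- The density, with respect to `dy_1 ⋯ dy_n`, of `f(y) dω_n(y)` with
`dω_n(y) = (2πi)^{-n} dy_1 ⋯ dy_n / (y_1 ⋯ y_n)`. -/
def omegaDensity {n : ℕ} (f : (Fin n → ℂ) → ℂ) (y : Fin n → ℂ) : ℂ :=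
  ((2 * (Real.pi : ℂ) * Complex.I) ^ n)⁻¹ * (∏ k, y k)⁻¹ * f y

/-- The integral of `f(y) dω_n(y)` over the torus `|y_1| = ⋯ = |y_n| = 1`. -/
def omegaIntegral {n : ℕ} (f : (Fin n → ℂ) → ℂ) : ℂ :=
  torusIntegral (omegaDensity f) 0 (fun _ => 1)

/-- The integrand `w_n(y; a | t, q) Φ^∨(x, y) U_K(y; a | t) V(y | t, q) φ(y)`; the roles of the
shift parameter and the coupling parameter are interchanged in the `y`-variables. -/
def dualIntegrand {m n : ℕ} (p q t : ℂ) (a : Fin 8 → ℂ) (K : Finset (Fin 8))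
    (φ : (Fin n → ℂ) → ℂ) (x : Fin m → ℂ) (y : Fin n → ℂ) : ℂ :=
  weight p t q a y * dualKernel p x y * gaugeU p t a K y * gaugeV p t q y * φ y

/-- The dual-Cauchy transform with the gauge functions `U_K` and `V`. -/
def dualTransform {m n : ℕ} (p q t : ℂ) (a : Fin 8 → ℂ) (K : Finset (Fin 8))
    (φ : (Fin n → ℂ) → ℂ) (x : Fin m → ℂ) : ℂ :=
  omegaIntegral (dualIntegrand p q t a K φ x)

end

end VanDiejen

namespace VanDiejen

open Filter Topology MeasureTheory

/-! The proof combines a kernel identity with a transposition of the operator in y.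

Kernel identity (`kernel_identity`): under the balancing condition, q^n θ(t;p) D_x(a|q,t) Φ + t^m
θ(q;p) D_y(a|t,q) Φ = 0 for Φ = Φ^∨(x,y). At pole-generic points, after division by Φ, the left side
is up to a constant the sum of the residues, with respect to dz/z, of f(z) = ∏_s θ(a_s z) ∏_i θ(t z
x_i^±)/θ(z x_i^±) ∏_k θ(q z y_k^±)/θ(z y_k^±) / (θ(q z²) θ(t z²)). This f is symmetric under
exchange of (x,t) and (y,q), and the balancing condition makes f(pz) = f(z). Modulo p^ℤ its poles
are the x_i^±, which give the shift terms of D_x; the y_k^±, which give those of D_y; four points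
with q z² ∈ p^ℤ, which give the zeroth order term of D_x; and four with t z² ∈ p^ℤ, for D_y. The
prescribed square root makes the constants L_2 and L_3 fit. The residues of f add up to zero by
`sum_residues_eq_zero`.

Transposition (`torusAngleIntegral_adjoint`): off a null set of the torus, w_n U_K V equals
`gaugedWeight`, which does not involve q and is holomorphic near the torus. Its product with a shift
coefficient of D_y(a|t,q) extends holomorphically to the annulus crossed when y_k is moved by a
factor t^{±1}. After the move, θ(p/z;p) = θ(z;p) turns a_s/(tw) into (pt/a_s)w and q/(tw) into
(pt/q)w, so the coefficient has become the opposite one of D_y(a_{K(pt)}|t,pt/q), and the shift has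
passed from Φ to φ (`contour_shift`). The zeroth order coefficients of both operators coincide
(`zeroCoeff_reflect`).

Hence, with W the gauged weight, D_x ∫WφΦ = ∫Wφ D_xΦ is a constant times ∫Wφ D_yΦ = ∫WΦ Dφ = Λ∫WφΦ,
where D is the reflected operator. Convergence and holomorphy follow because the integrand agrees
almost everywhere with one that is continuous on the torus and holomorphic in x. -/

/-! ### Infinite products, the theta function and the elliptic Gamma function -/

theorem summable_norm_mul_pow {p : ℂ} (hp : ‖p‖ < 1) (x : ℂ) :
    Summable fun l : ℕ => ‖-(x * p ^ l)‖ := by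
  simpa [norm_mul, norm_pow] using
    (summable_geometric_of_lt_one (norm_nonneg p) hp).mul_left ‖x‖

theorem multipliable_qPoch {p : ℂ} (hp : ‖p‖ < 1) (x : ℂ) :
    Multipliable fun l : ℕ => (1 - x * p ^ l) := by
  simpa [sub_eq_add_neg] using multipliable_one_add_of_summable (summable_norm_mul_pow hp x)

theorem qPoch_ne_zero {p : ℂ} (hp : ‖p‖ < 1) {x : ℂ} (hx : ∀ l : ℕ, x * p ^ l ≠ 1) :
    qPoch x p ≠ 0 := by
  have := tprod_one_add_ne_zero_of_summable (f := fun l : ℕ => -(x * p ^ l))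
    (fun l => by rw [← sub_eq_add_neg, sub_ne_zero]; exact (hx l).symm)
    (summable_norm_mul_pow hp x)
  simpa [qPoch, sub_eq_add_neg] using this

theorem qPoch_eq_zero_iff {p : ℂ} (hp : ‖p‖ < 1) {x : ℂ} :
    qPoch x p = 0 ↔ ∃ l : ℕ, x * p ^ l = 1 := by
  refine ⟨fun h => ?_, fun ⟨l, hl⟩ => tprod_of_exists_eq_zero ⟨l, by simp [hl]⟩⟩
  by_contra! hne
  exact qPoch_ne_zero hp hne h

theorem qPoch_ne_zero_of_norm_lt {p : ℂ} (hp : ‖p‖ < 1) {x : ℂ} (hx : ‖x‖ < 1) :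
    qPoch x p ≠ 0 := by
  refine qPoch_ne_zero hp fun l h => ?_
  have h1 : ‖x‖ * ‖p‖ ^ l = 1 := by simpa using congrArg norm h
  have : ‖p‖ ^ l ≤ 1 := pow_le_one₀ (norm_nonneg _) hp.le
  nlinarith [norm_nonneg x]

theorem qPoch_eq_mul {p : ℂ} (hp : ‖p‖ < 1) (x : ℂ) :
    qPoch x p = (1 - x) * qPoch (p * x) p := by
  have h := multipliable_qPoch hp (p * x)
  have e : ∀ l : ℕ, x * p ^ (l + 1) = p * x * p ^ l := fun l => by ring
  rw [qPoch, tprod_eq_zero_mul' (by simpa only [e] using h)]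
  simp only [e, pow_zero, mul_one, qPoch]

/-- A bound by a summable sequence on every disc gives locally uniform convergence of the partial
products, and locally uniform limits of entire functions are entire. -/
theorem differentiable_tprod_one_add {f : ℕ → ℂ → ℂ} (u : ℝ → ℕ → ℝ)
    (hu : ∀ R, Summable (u R)) (hf : ∀ l, Differentiable ℂ (f l))
    (hb : ∀ R l x, ‖x‖ ≤ R → ‖f l x‖ ≤ u R l) :
    Differentiable ℂ fun x => ∏' l, (1 + f l x) := by
  have H : HasProdLocallyUniformlyOn (fun l x => 1 + f l x) (fun x => ∏' l, (1 + f l x))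
      Set.univ := by
    apply hasProdLocallyUniformlyOn_of_forall_compact isOpen_univ
    intro K _ hK
    obtain ⟨R, hR⟩ := hK.isBounded.exists_norm_le
    exact (hu R).hasProdUniformlyOn_nat_one_add hK (.of_forall fun l x hx => hb R l x (hR x hx))
      fun l => (hf l).continuous.continuousOn
  rw [← differentiableOn_univ]
  refine H.differentiableOn (.of_forall fun s => ?_) isOpen_univ
  simpa [Finset.prod_fn] using DifferentiableOn.finsetProd
    (fun l _ => ((differentiable_const _).add (hf l)).differentiableOn)

theorem differentiable_qPoch {p : ℂ} (hp : ‖p‖ < 1) : Differentiable ℂ fun x => qPoch x p := by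
  have := differentiable_tprod_one_add (f := fun l x => -(x * p ^ l)) (fun R l => R * ‖p‖ ^ l)
    (fun R => (summable_geometric_of_lt_one (norm_nonneg p) hp).mul_left R) (fun l => by fun_prop)
    (fun R l x hx => by
      rw [norm_neg, norm_mul, norm_pow]
      gcongr)
  simpa [qPoch, sub_eq_add_neg] using this

/-- For finite products |∏(1 + f_l) − 1| ≤ exp(∑|f_l|) − 1; the sum is bounded by a geometric series
and the bound survives the limit. -/
theorem norm_qPoch_sub_one_le {q : ℂ} (hq : ‖q‖ < 1) (x : ℂ) :
    ‖qPoch x q - 1‖ ≤ Real.exp (‖x‖ / (1 - ‖q‖)) - 1 := by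
  have h1 := (multipliable_qPoch hq x).hasProd
  have h2 : Tendsto (fun s : Finset ℕ => ‖∏ l ∈ s, (1 - x * q ^ l) - 1‖) atTop
      (𝓝 ‖qPoch x q - 1‖) := (h1.sub_const 1).norm
  refine le_of_tendsto h2 (.of_forall fun s => ?_)
  have := s.norm_prod_one_add_sub_one_le (fun l => -(x * q ^ l))
  simp only [← sub_eq_add_neg] at this
  refine this.trans ?_
  gcongr
  refine ((summable_norm_mul_pow hq x).sum_le_tsum _ fun _ _ => norm_nonneg _).trans (le_of_eq ?_)
  simp only [norm_neg, norm_mul, norm_pow]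
  rw [tsum_mul_left, tsum_geometric_of_lt_one (norm_nonneg q) hq, div_eq_mul_inv]

/-- A bound linear in ‖x‖ makes (p^l x; q)_∞ − 1 decay geometrically in l, which gives convergence
of the double product. -/
theorem norm_qPoch_sub_one_le_of_le {q : ℂ} (hq : ‖q‖ < 1) {R : ℝ} {x : ℂ} (hx : ‖x‖ ≤ R) :
    ‖qPoch x q - 1‖ ≤ ‖x‖ * ((1 - ‖q‖)⁻¹ * Real.exp (R / (1 - ‖q‖))) := by
  have h0 : 0 < 1 - ‖q‖ := by linarith
  refine (norm_qPoch_sub_one_le hq x).trans ?_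
  -- This is e^u − 1 ≤ u e^u, obtained from 1 − u ≤ e^{−u}.
  have h1 : Real.exp (‖x‖ / (1 - ‖q‖)) - 1 ≤
      ‖x‖ / (1 - ‖q‖) * Real.exp (‖x‖ / (1 - ‖q‖)) := by
    have := Real.add_one_le_exp (-(‖x‖ / (1 - ‖q‖)))
    rw [Real.exp_neg] at this
    have hpos := Real.exp_pos (‖x‖ / (1 - ‖q‖))
    have h3 : (Real.exp (‖x‖ / (1 - ‖q‖)))⁻¹ * Real.exp (‖x‖ / (1 - ‖q‖)) = 1 :=
      inv_mul_cancel₀ hpos.ne'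
    nlinarith
  refine h1.trans ?_
  rw [← mul_assoc, ← div_eq_mul_inv]
  gcongr

theorem norm_qPoch_pow_mul_sub_one_le {p q : ℂ} (hp : ‖p‖ < 1) (hq : ‖q‖ < 1) (R : ℝ) (l : ℕ)
    (x : ℂ) (hx : ‖x‖ ≤ R) :
    ‖qPoch (p ^ l * x) q - 1‖ ≤
      ‖p‖ ^ l * (R * ((1 - ‖q‖)⁻¹ * Real.exp (R / (1 - ‖q‖)))) := by
  have h0 : 0 < 1 - ‖q‖ := by linarith
  have h1 : ‖p ^ l * x‖ ≤ R := by
    rw [norm_mul, norm_pow]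
    have : ‖p‖ ^ l ≤ 1 := pow_le_one₀ (norm_nonneg _) hp.le
    nlinarith [norm_nonneg x]
  refine (norm_qPoch_sub_one_le_of_le hq h1).trans ?_
  rw [norm_mul, norm_pow, mul_assoc]
  gcongr

theorem summable_norm_qPoch_sub_one {p q : ℂ} (hp : ‖p‖ < 1) (hq : ‖q‖ < 1) (x : ℂ) :
    Summable fun l : ℕ => ‖qPoch (p ^ l * x) q - 1‖ :=
  ((summable_geometric_of_lt_one (norm_nonneg p) hp).mul_right _).of_nonneg_of_le
    (fun _ => norm_nonneg _) fun l => norm_qPoch_pow_mul_sub_one_le hp hq ‖x‖ l x le_rfl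

theorem multipliable_qPoch₂ {p q : ℂ} (hp : ‖p‖ < 1) (hq : ‖q‖ < 1) (x : ℂ) :
    Multipliable fun l : ℕ => qPoch (p ^ l * x) q := by
  simpa using multipliable_one_add_of_summable (summable_norm_qPoch_sub_one hp hq x)

theorem qPoch₂_ne_zero {p q : ℂ} (hp : ‖p‖ < 1) (hq : ‖q‖ < 1) {x : ℂ}
    (hx : ∀ l j : ℕ, p ^ l * x * q ^ j ≠ 1) : qPoch₂ x p q ≠ 0 := by
  have := tprod_one_add_ne_zero_of_summable (f := fun l : ℕ => qPoch (p ^ l * x) q - 1)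
    (fun l => by simpa using qPoch_ne_zero hq (hx l)) (summable_norm_qPoch_sub_one hp hq x)
  simpa [qPoch₂] using this

theorem qPoch₂_ne_zero_of_norm_lt {p q : ℂ} (hp : ‖p‖ < 1) (hq : ‖q‖ < 1) {x : ℂ}
    (hx : ‖x‖ < 1) : qPoch₂ x p q ≠ 0 := by
  refine qPoch₂_ne_zero hp hq fun l j h => ?_
  have h1 : ‖p‖ ^ l * ‖x‖ * ‖q‖ ^ j = 1 := by simpa using congrArg norm h
  have h2 : ‖p‖ ^ l ≤ 1 := pow_le_one₀ (norm_nonneg _) hp.le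
  have h3 : ‖q‖ ^ j ≤ 1 := pow_le_one₀ (norm_nonneg _) hq.le
  have h4 : ‖p‖ ^ l * ‖x‖ < 1 := by
    nlinarith [norm_nonneg x]
  nlinarith [mul_nonneg (pow_nonneg (norm_nonneg p) l) (norm_nonneg x)]

theorem differentiable_qPoch₂ {p q : ℂ} (hp : ‖p‖ < 1) (hq : ‖q‖ < 1) :
    Differentiable ℂ fun x => qPoch₂ x p q := by
  have := differentiable_tprod_one_add (f := fun l x => qPoch (p ^ l * x) q - 1)
    (fun R l => ‖p‖ ^ l * (R * ((1 - ‖q‖)⁻¹ * Real.exp (R / (1 - ‖q‖)))))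
    (fun R => (summable_geometric_of_lt_one (norm_nonneg p) hp).mul_right _)
    (fun l => ((differentiable_qPoch hq).comp (differentiable_id.const_mul (p ^ l))).sub_const 1)
    (fun R l x hx => norm_qPoch_pow_mul_sub_one_le hp hq R l x hx)
  simpa [qPoch₂] using this

theorem qPoch₂_eq_mul_left {p q : ℂ} (hp : ‖p‖ < 1) (hq : ‖q‖ < 1) (x : ℂ) :
    qPoch₂ x p q = qPoch x q * qPoch₂ (p * x) p q := by
  have h := multipliable_qPoch₂ hp hq (p * x)
  rw [qPoch₂, tprod_eq_zero_mul' (by simpa [pow_succ, mul_assoc] using h)]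
  simp [qPoch₂, pow_succ, mul_assoc]

theorem qPoch₂_eq_mul_right {p q : ℂ} (hp : ‖p‖ < 1) (hq : ‖q‖ < 1) (x : ℂ) :
    qPoch₂ x p q = qPoch x p * qPoch₂ (q * x) p q := by
  have h := (multipliable_qPoch hp x).tprod_mul (multipliable_qPoch₂ hp hq (q * x))
  rw [qPoch₂, qPoch, qPoch₂, ← h]
  refine tprod_congr fun l => ?_
  rw [qPoch_eq_mul hq]
  ring_nf

theorem theta_div (p z : ℂ) (hp : p ≠ 0) : theta (p / z) p = theta z p := by
  rw [theta, theta, div_div_cancel₀ hp, mul_comm]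

theorem theta_inv {p : ℂ} (hp : ‖p‖ < 1) {z : ℂ} (hz : z ≠ 0) :
    theta z⁻¹ p = -z⁻¹ * theta z p := by
  rw [theta, theta, qPoch_eq_mul hp z, qPoch_eq_mul hp z⁻¹, div_inv_eq_mul, div_eq_mul_inv]
  field_simp
  ring

theorem theta_mul_left {p : ℂ} (hp : ‖p‖ < 1) (hp0 : p ≠ 0) {z : ℂ} (hz : z ≠ 0) :
    theta (p * z) p = -z⁻¹ * theta z p := by
  rw [← theta_inv hp hz, ← theta_div p z⁻¹ hp0, div_inv_eq_mul]

theorem theta_eq_zero_iff {p : ℂ} (hp : ‖p‖ < 1) (hp0 : p ≠ 0) {z : ℂ} (hz : z ≠ 0) :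
    theta z p = 0 ↔ ∃ k : ℤ, z = p ^ k := by
  rw [theta, mul_eq_zero, qPoch_eq_zero_iff hp, qPoch_eq_zero_iff hp]
  constructor
  · rintro (⟨l, hl⟩ | ⟨l, hl⟩)
    · exact ⟨-l, by rw [zpow_neg, zpow_natCast]; exact eq_inv_of_mul_eq_one_left hl⟩
    · refine ⟨l + 1, ?_⟩
      rw [zpow_add_one₀ hp0, zpow_natCast]
      field_simp at hl
      rw [← hl, mul_comm]
  · rintro ⟨k, rfl⟩
    obtain ⟨l, rfl | rfl⟩ := k.eq_nat_or_neg
    · rcases l with _ | l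
      · exact Or.inl ⟨0, by simp⟩
      · refine Or.inr ⟨l, ?_⟩
        rw [zpow_natCast, pow_succ]
        field_simp
    · refine Or.inl ⟨l, ?_⟩
      rw [zpow_neg, zpow_natCast]
      exact inv_mul_cancel₀ (pow_ne_zero _ hp0)

theorem theta_ne_zero_of_norm {p : ℂ} (hp : ‖p‖ < 1) {z : ℂ} (h1 : ‖z‖ < 1) (h2 : ‖p‖ < ‖z‖) :
    theta z p ≠ 0 := by
  refine mul_ne_zero (qPoch_ne_zero_of_norm_lt hp h1) (qPoch_ne_zero_of_norm_lt hp ?_)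
  rw [norm_div]
  exact (div_lt_one (by linarith [norm_nonneg p])).2 h2

theorem differentiableAt_theta {p : ℂ} (hp : ‖p‖ < 1) {z : ℂ} (hz : z ≠ 0) :
    DifferentiableAt ℂ (fun z => theta z p) z :=
  ((differentiable_qPoch hp) z).mul
    (((differentiable_qPoch hp) (p / z)).comp z ((differentiableAt_const p).div differentiableAt_id hz))

theorem differentiableOn_theta {p : ℂ} (hp : ‖p‖ < 1) :
    DifferentiableOn ℂ (fun z => theta z p) {0}ᶜ :=
  fun _ hz => (differentiableAt_theta hp hz).differentiableWithinAt

/-- Since θ(z;p) = (1 − z)(pz;p)_∞(p/z;p)_∞, only the derivative of 1 − z contributes at z = 1. -/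
theorem deriv_theta_one {p : ℂ} (hp : ‖p‖ < 1) :
    deriv (fun z => theta z p) 1 = -qPoch p p ^ 2 := by
  have h : (fun z => theta z p) = fun z => (1 - z) * (qPoch (p * z) p * qPoch (p / z) p) := by
    funext z
    rw [theta, qPoch_eq_mul hp z, mul_assoc]
  have hd : DifferentiableAt ℂ (fun z => qPoch (p * z) p * qPoch (p / z) p) 1 :=
    (((differentiable_qPoch hp) (p * 1)).comp (1 : ℂ) (by fun_prop)).mul
      (((differentiable_qPoch hp) (p / 1)).comp (1 : ℂ) (by fun_prop (disch := norm_num)))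
  have h1 : HasDerivAt (fun z : ℂ => 1 - z) (-1) 1 := by
    simpa using (hasDerivAt_id (1 : ℂ)).const_sub 1
  rw [h]
  refine (h1.mul hd.hasDerivAt).deriv.trans ?_
  simp
  ring

theorem deriv_theta_one_ne_zero {p : ℂ} (hp : ‖p‖ < 1) : deriv (fun z => theta z p) 1 ≠ 0 := by
  rw [deriv_theta_one hp]
  exact neg_ne_zero.2 (pow_ne_zero _ (qPoch_ne_zero_of_norm_lt hp hp))

/-- The bound on ‖z‖ keeps (z;p)_∞ away from zero; at its zeros the value 0 assigned to Γ at poles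
could violate the functional equation. -/
theorem ellGamma_mul {p t : ℂ} (hp : ‖p‖ < 1) (ht : ‖t‖ < 1) (ht0 : t ≠ 0) {z : ℂ}
    (hz : ‖z‖ < 1) : ellGamma (t * z) p t = theta z p * ellGamma z p t := by
  have h1 : p * t / (t * z) = p / z := by
    rw [mul_comm p t, mul_div_mul_left _ _ ht0]
  rw [ellGamma, ellGamma, theta, h1, qPoch₂_eq_mul_right hp ht (p / z),
    qPoch₂_eq_mul_right hp ht z, show t * (p / z) = p * t / z by ring]
  have := qPoch_ne_zero_of_norm_lt hp hz
  field_simp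


/-! ### Holomorphic quotients, circle integrals and residues of elliptic functions -/

/-- The zeros of D are simple and Q vanishes at them, so the singularities of Q / D are removable:
near such a zero the quotient is that of the two difference quotients `dslope`, and its value there
is Q' / D'. -/
theorem exists_differentiableOn_quotient {U : Set ℂ} (hU : IsOpen U) {Q D : ℂ → ℂ}
    (hQ : DifferentiableOn ℂ Q U) (hD : DifferentiableOn ℂ D U)
    (h0 : ∀ z ∈ U, D z = 0 → Q z = 0 ∧ deriv D z ≠ 0) :
    ∃ h : ℂ → ℂ, DifferentiableOn ℂ h U ∧ ∀ z ∈ U, Q z = h z * D z := by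
  classical
  refine ⟨fun z => if D z = 0 then deriv Q z / deriv D z else Q z / D z, fun z hz => ?_,
    fun z hz => ?_⟩
  · have hUz := hU.mem_nhds hz
    have hQz := hQ.differentiableAt hUz
    have hDz := hD.differentiableAt hUz
    refine DifferentiableAt.differentiableWithinAt ?_
    by_cases hDz0 : D z = 0
    · obtain ⟨hQ0, hd⟩ := h0 z hz hDz0
      have hq : DifferentiableAt ℂ (dslope Q z) z :=
        ((Complex.differentiableOn_dslope hUz).2 hQ).differentiableAt hUz
      have hd' : DifferentiableAt ℂ (dslope D z) z :=
        ((Complex.differentiableOn_dslope hUz).2 hD).differentiableAt hUz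
      have hne : dslope D z z ≠ 0 := by rwa [dslope_same]
      refine (hq.div hd' hne).congr_of_eventuallyEq ?_
      filter_upwards [hd'.continuousAt.eventually_ne hne] with w hw
      by_cases hwz : w = z
      · subst hwz
        simp [hDz0]
      · have e1 : D w = (w - z) * dslope D z w := by
          have := sub_smul_dslope D z w
          rw [hDz0, sub_zero, smul_eq_mul] at this
          exact this.symm
        have e2 : Q w = (w - z) * dslope Q z w := by
          have := sub_smul_dslope Q z w
          rw [hQ0, sub_zero, smul_eq_mul] at this
          exact this.symm
        have hwz' := sub_ne_zero.2 hwz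
        rw [if_neg (by rw [e1]; exact mul_ne_zero hwz' hw), Pi.div_apply, e1, e2,
          mul_div_mul_left _ _ hwz']
    · refine (hQz.div hDz hDz0).congr_of_eventuallyEq ?_
      filter_upwards [hDz.continuousAt.eventually_ne hDz0] with w hw
      rw [if_neg hw, Pi.div_apply]
  · by_cases hDz0 : D z = 0
    · simp [hDz0, (h0 z hz hDz0).1]
    · simp [hDz0]

/-- Cancels D from an identity between continuous functions: simple zeros are isolated, so g
vanishes around them and, by continuity, at them. -/
theorem eq_zero_of_mul_eq_zero_of_simple_zeros {U : Set ℂ} (hU : IsOpen U) {g D : ℂ → ℂ}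
    (hg : ContinuousOn g U) (hD : DifferentiableOn ℂ D U)
    (h0 : ∀ z ∈ U, D z = 0 → deriv D z ≠ 0) (h : ∀ z ∈ U, g z * D z = 0) {z : ℂ} (hz : z ∈ U) :
    g z = 0 := by
  by_cases hDz : D z = 0
  · have hUz := hU.mem_nhds hz
    have h1 : ∀ᶠ w in 𝓝[≠] z, D w ≠ 0 :=
      (hD.differentiableAt hUz).hasDerivAt.eventually_ne (h0 z hz hDz)
    have h2 : ∀ᶠ w in 𝓝[≠] z, g w = 0 := by
      filter_upwards [h1, nhdsWithin_le_nhds hUz] with w hw hwU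
      exact (mul_eq_zero.1 (h w hwU)).resolve_right hw
    have h3 : Tendsto g (𝓝[≠] z) (𝓝 (g z)) :=
      (hg.continuousAt hUz).tendsto.mono_left nhdsWithin_le_nhds
    exact tendsto_nhds_unique (h3.congr' h2) tendsto_const_nhds
  · exact (mul_eq_zero.1 (h z hz)).resolve_right hDz

/-- Cauchy's theorem on the annulus for g(z) dz / z, which is i g dθ on every circle about 0. -/
theorem integral_circleMap_eq_of_differentiableOn_annulus {r R : ℝ} (hr : 0 < r) (hrR : r ≤ R)
    {g : ℂ → ℂ} (hg : DifferentiableOn ℂ g {z | r ≤ ‖z‖ ∧ ‖z‖ ≤ R}) :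
    ∫ θ in (0)..2 * Real.pi, g (circleMap 0 R θ) = ∫ θ in (0)..2 * Real.pi, g (circleMap 0 r θ) := by
  have key := Complex.circleIntegral_sub_center_inv_smul_eq_of_differentiable_on_annulus_off_countable
    (c := 0) hr hrR (f := g) (s := ∅) Set.countable_empty
    (hg.continuousOn.mono fun z hz => by
      simpa [and_comm] using hz)
    (fun z hz => by
      refine hg.differentiableAt ?_
      refine Filter.mem_of_superset ((Metric.isOpen_ball.sdiff Metric.isClosed_closedBall).mem_nhds
        hz.1) fun w hw => ?_
      simp only [Set.mem_sdiff, Metric.mem_ball, dist_zero_right, Metric.mem_closedBall,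
        not_le] at hw
      exact ⟨hw.2.le, hw.1.le⟩)
  have e : ∀ ρ : ℝ, 0 < ρ → (∮ z in C(0, ρ), (z - 0)⁻¹ • g z) =
      Complex.I * ∫ θ in (0)..2 * Real.pi, g (circleMap 0 ρ θ) := by
    intro ρ hρ
    rw [circleIntegral, ← intervalIntegral.integral_const_mul]
    refine intervalIntegral.integral_congr fun θ _ => ?_
    have : circleMap 0 ρ θ ≠ 0 := circleMap_ne_center hρ.ne'
    simp only [deriv_circleMap, sub_zero, smul_eq_mul]
    field_simp
  rw [e R (hr.trans_le hrR), e r hr] at key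
  exact mul_left_cancel₀ Complex.I_ne_zero key

/-- Moving the circle of integration for `g(z) dz / z` by a factor `c`. -/
theorem integral_mul_circleMap_eq {c : ℂ} (hc : c ≠ 0) {g : ℂ → ℂ}
    (hg : DifferentiableOn ℂ g {z | min 1 ‖c‖ ≤ ‖z‖ ∧ ‖z‖ ≤ max 1 ‖c‖}) :
    ∫ θ in (0)..2 * Real.pi, g (c * circleMap 0 1 θ) =
      ∫ θ in (0)..2 * Real.pi, g (circleMap 0 1 θ) := by
  have hc' : 0 < ‖c‖ := norm_pos_iff.2 hc
  have h1 : ∫ θ in (0)..2 * Real.pi, g (circleMap 0 ‖c‖ θ) =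
      ∫ θ in (0)..2 * Real.pi, g (circleMap 0 1 θ) := by
    rcases le_total 1 ‖c‖ with h | h
    · rw [min_eq_left h, max_eq_right h] at hg
      exact integral_circleMap_eq_of_differentiableOn_annulus one_pos h hg
    · rw [min_eq_right h, max_eq_left h] at hg
      exact (integral_circleMap_eq_of_differentiableOn_annulus hc' h hg).symm
  -- Multiplication by c rescales the circle and rotates it by arg c; the rotation does not matter
  -- by periodicity.
  have h2 : ∀ θ : ℝ, c * circleMap 0 1 θ = circleMap 0 ‖c‖ (θ + Complex.arg c) := by
    intro θ
    conv_lhs => rw [← Complex.norm_mul_exp_arg_mul_I c]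
    simp only [circleMap, zero_add, Complex.ofReal_one, one_mul, Complex.ofReal_add, add_mul,
      Complex.exp_add]
    ring
  have hper : Function.Periodic (fun θ => g (circleMap 0 ‖c‖ θ)) (2 * Real.pi) :=
    fun θ => by simp only [periodic_circleMap 0 ‖c‖ θ]
  simp only [h2]
  rw [intervalIntegral.integral_comp_add_right (fun θ => g (circleMap 0 ‖c‖ θ)), ← h1, zero_add,
    add_comm (2 * Real.pi)]
  simpa using hper.intervalIntegral_add_eq (Complex.arg c) 0

/-- The mean of h over the unit circle equals that over its image under z ↦ pz by Cauchy's theorem,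
while the functional equation makes the two differ by c. -/
theorem eq_zero_of_quasiperiodic {p : ℂ} (hp0 : p ≠ 0) {h : ℂ → ℂ} (c : ℂ)
    (hh : DifferentiableOn ℂ h {0}ᶜ) (hper : ∀ z, z ≠ 0 → h (p * z) = h z + c) : c = 0 := by
  have h1 := integral_mul_circleMap_eq hp0 (g := h) (hh.mono fun z hz => by
    have : 0 < min 1 ‖p‖ := lt_min one_pos (norm_pos_iff.2 hp0)
    exact norm_pos_iff.1 (this.trans_le hz.1))
  have hne : ∀ θ, circleMap 0 1 θ ≠ 0 := fun θ => circleMap_ne_center one_ne_zero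
  have hcont : Continuous fun θ => h (circleMap 0 1 θ) :=
    hh.continuousOn.comp_continuous (continuous_circleMap 0 1) hne
  simp only [hper _ (hne _)] at h1
  rw [intervalIntegral.integral_add (hcont.intervalIntegrable _ _) (by simp)] at h1
  simpa [Real.pi_ne_zero] using h1

/-- Carries the local behaviour at one zero of a quasi-periodic function to the whole orbit p^ℤ z.
-/
theorem zpow_mul_induction {p : ℂ} (hp0 : p ≠ 0) {R : ℂ → Prop}
    (hR : ∀ z, z ≠ 0 → (R z ↔ R (p * z))) {z : ℂ} (hz : z ≠ 0) (h : R z) (k : ℤ) :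
    R (p ^ k * z) := by
  induction k with
  | zero => simpa using h
  | succ k ih =>
    rw [zpow_add_one₀ hp0, mul_comm _ p, mul_assoc]
    exact (hR _ (mul_ne_zero (zpow_ne_zero _ hp0) hz)).1 ih
  | pred k ih =>
    refine (hR _ (mul_ne_zero (zpow_ne_zero _ hp0) hz)).2 ?_
    rw [← mul_assoc, ← zpow_one_add₀ hp0]
    convert ih using 3
    ring

/-- In the derivative of the functional equation at a zero of D, the term with the derivative of C
z^N drops out. -/
theorem hasDerivAt_mul_of_quasiperiodic {p : ℂ} (hp0 : p ≠ 0) {D : ℂ → ℂ} {C : ℂ} {N : ℤ}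
    (hD : DifferentiableOn ℂ D {0}ᶜ) (hDp : ∀ z, z ≠ 0 → D (p * z) = C * z ^ N * D z)
    {z : ℂ} (hz : z ≠ 0) (h0 : D z = 0) : p * deriv D (p * z) = C * z ^ N * deriv D z := by
  have hmem : ∀ w : ℂ, w ≠ 0 → DifferentiableAt ℂ D w := fun w hw =>
    hD.differentiableAt (isOpen_compl_singleton.mem_nhds hw)
  have h1 : HasDerivAt (fun w => D (p * w)) (deriv D (p * z) * p) z := by
    have := (hmem _ (mul_ne_zero hp0 hz)).hasDerivAt
    exact this.comp z (by simpa using (hasDerivAt_id z).const_mul p)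
  have h2 : HasDerivAt (fun w => (C * w ^ N) * D w) (C * (N * z ^ (N - 1)) * D z +
      C * z ^ N * deriv D z) z :=
    ((hasDerivAt_zpow N z (Or.inl hz)).const_mul C).mul (hmem z hz).hasDerivAt
  have h3 : (fun w => D (p * w)) =ᶠ[𝓝 z] fun w => (C * w ^ N) * D w := by
    filter_upwards [isOpen_compl_singleton.mem_nhds hz] with w hw using hDp w hw
  have := h1.unique (h2.congr_of_eventuallyEq h3)
  rw [h0, mul_zero, zero_add] at this
  rw [← this, mul_comm]

/-- All zeros lie in the orbit of the simple zero 1, and simplicity is transported along the orbit.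
-/
theorem deriv_theta_ne_zero {p : ℂ} (hp : ‖p‖ < 1) (hp0 : p ≠ 0) {z : ℂ} (hz : z ≠ 0)
    (h0 : theta z p = 0) : deriv (fun z => theta z p) z ≠ 0 := by
  obtain ⟨k, rfl⟩ := (theta_eq_zero_iff hp hp0 hz).1 h0
  have hq : ∀ z, z ≠ 0 → theta (p * z) p = (-1) * z ^ (-1 : ℤ) * theta z p := fun z hz => by
    rw [theta_mul_left hp hp0 hz, zpow_neg_one, neg_one_mul]
  have := zpow_mul_induction hp0 (z := 1)
    (R := fun z => theta z p = 0 ∧ deriv (fun z => theta z p) z ≠ 0) (fun z hz => ?_) one_ne_zero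
    ⟨(theta_eq_zero_iff hp hp0 one_ne_zero).2 ⟨0, by simp⟩, deriv_theta_one_ne_zero hp⟩ k
  · simpa using this.2
  · rw [hq z hz, mul_eq_zero_iff_left (by simp [hz])]
    refine and_congr_right fun h => ?_
    have := hasDerivAt_mul_of_quasiperiodic hp0 (differentiableOn_theta hp) hq hz h
    refine not_congr ⟨fun h' => ?_, fun h' => ?_⟩
    · simpa [h', hp0] using this
    · simpa [h', hz] using this.symm

/-- The residues of an elliptic function `P / D` with simple poles add up to zero. -/
theorem sum_residues_eq_zero {p : ℂ} (hp : ‖p‖ < 1) (hp0 : p ≠ 0) {D P : ℂ → ℂ} {C : ℂ} {N : ℤ}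
    (hC : C ≠ 0) (hD : DifferentiableOn ℂ D {0}ᶜ) (hP : DifferentiableOn ℂ P {0}ᶜ)
    (hDp : ∀ z, z ≠ 0 → D (p * z) = C * z ^ N * D z)
    (hPp : ∀ z, z ≠ 0 → P (p * z) = C * z ^ N * P z)
    {ι : Type*} [Fintype ι] (u d : ι → ℂ) (hu : ∀ i, u i ≠ 0) (hDu : ∀ i, D (u i) = 0)
    (hd : ∀ i, HasDerivAt D (d i) (u i)) (hd0 : ∀ i, d i ≠ 0)
    (hzero : ∀ z, z ≠ 0 → D z = 0 → ∃ i, ∃ k : ℤ, z = p ^ k * u i)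
    (hdist : ∀ i j, i ≠ j → ∀ k : ℤ, u j ≠ p ^ k * u i) :
    ∑ i, P (u i) / (u i * d i) = 0 := by
  classical
  set ρ : ι → ℂ := fun i => P (u i) / (u i * d i) with hρ
  have hopen : IsOpen ({0}ᶜ : Set ℂ) := isOpen_compl_singleton
  -- the situation at the zeros of the denominator
  have hzeros : ∀ i, ∀ k : ℤ, D (p ^ k * u i) = 0 ∧ deriv D (p ^ k * u i) ≠ 0 ∧
      P (p ^ k * u i) = ρ i * ((p ^ k * u i) * deriv D (p ^ k * u i)) := by
    intro i k
    refine zpow_mul_induction hp0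
      (R := fun z => D z = 0 ∧ deriv D z ≠ 0 ∧ P z = ρ i * (z * deriv D z)) (fun z hz => ?_)
      (hu i) ⟨hDu i, ?_, ?_⟩ k
    · have hm : C * z ^ N ≠ 0 := mul_ne_zero hC (zpow_ne_zero _ hz)
      rw [hDp z hz, hPp z hz, mul_eq_zero_iff_left hm]
      refine and_congr_right fun h => ?_
      have e := hasDerivAt_mul_of_quasiperiodic hp0 hD hDp hz h
      refine and_congr (not_congr ⟨fun h' => ?_, fun h' => ?_⟩) ?_
      · simpa [h', hp0] using e
      · rw [h', mul_zero] at e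
        exact (mul_eq_zero.1 e.symm).resolve_left hm
      · rw [show ρ i * (p * z * deriv D (p * z)) = C * z ^ N * (ρ i * (z * deriv D z)) by
          linear_combination (ρ i * z) * e]
        exact (mul_right_inj' hm).symm
    · rw [(hd i).deriv]; exact hd0 i
    · rw [(hd i).deriv, hρ]
      exact (div_mul_cancel₀ _ (mul_ne_zero (hu i) (hd0 i))).symm
  have hD0 : ∀ z ∈ ({0}ᶜ : Set ℂ), D z = 0 → deriv D z ≠ 0 := by
    intro z hz h
    obtain ⟨i, k, rfl⟩ := hzero z hz h
    exact (hzeros i k).2.1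
  have hthd : ∀ i, ∀ z, z ≠ 0 → HasDerivAt (fun z => theta (z / u i) p)
      (deriv (fun z => theta z p) (z / u i) / u i) z := by
    intro i z hz
    have h1 := (differentiableAt_theta hp (div_ne_zero hz (hu i))).hasDerivAt
    have h2 : HasDerivAt (fun z => z / u i) (1 / u i) z := (hasDerivAt_id z).div_const _
    rw [div_eq_mul_one_div]
    exact h1.comp z h2
  have hthdiff : ∀ i, DifferentiableOn ℂ (fun z => theta (z / u i) p) {0}ᶜ := fun i z hz =>
    (hthd i z hz).differentiableAt.differentiableWithinAt
  have hthzero : ∀ i, ∀ z, z ≠ 0 → theta (z / u i) p = 0 → ∃ k : ℤ, z = p ^ k * u i := by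
    intro i z hz h
    obtain ⟨k, hk⟩ := (theta_eq_zero_iff hp hp0 (div_ne_zero hz (hu i))).1 h
    exact ⟨k, by rw [← hk, div_mul_cancel₀ _ (hu i)]⟩
  -- the denominator with one factor removed
  have hg : ∀ i, ∃ g : ℂ → ℂ, DifferentiableOn ℂ g {0}ᶜ ∧
      ∀ z ∈ ({0}ᶜ : Set ℂ), D z = g z * theta (z / u i) p := fun i =>
    exists_differentiableOn_quotient hopen hD (hthdiff i) fun z hz h => by
      obtain ⟨k, hk⟩ := hthzero i z hz h
      refine ⟨hk ▸ (hzeros i k).1, ?_⟩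
      rw [(hthd i z hz).deriv]
      exact div_ne_zero (deriv_theta_ne_zero hp hp0 (div_ne_zero hz (hu i)) h) (hu i)
  choose g hgd hgD using hg
  -- L / θ is the logarithmic derivative w θ'(w) / θ(w). On ℂ^* its only poles are simple ones at
  -- p^ℤ, with residue 1 for dw / w, and it decreases by 1 under w ↦ pw.
  set L : ℂ → ℂ := fun w => w * deriv (fun z => theta z p) w with hL
  have hLd : DifferentiableOn ℂ L {0}ᶜ :=
    differentiableOn_id.mul ((differentiableOn_theta hp).deriv hopen)
  have hLp : ∀ w, w ≠ 0 → L (p * w) = -w⁻¹ * L w + w⁻¹ * theta w p := by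
    intro w hw
    have h1 : HasDerivAt (fun w => theta (p * w) p) (deriv (fun z => theta z p) (p * w) * p) w := by
      have := (differentiableAt_theta hp (mul_ne_zero hp0 hw)).hasDerivAt
      exact this.comp w (by simpa using (hasDerivAt_id w).const_mul p)
    have h2 : HasDerivAt (fun w => -w⁻¹ * theta w p) (- -(w ^ 2)⁻¹ * theta w p +
        -w⁻¹ * deriv (fun z => theta z p) w) w :=
      (hasDerivAt_inv hw).neg.mul (differentiableAt_theta hp hw).hasDerivAt
    have h3 : (fun w => theta (p * w) p) =ᶠ[𝓝 w] fun w => -w⁻¹ * theta w p := by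
      filter_upwards [hopen.mem_nhds hw] with v hv using theta_mul_left hp hp0 hv
    have e := h1.unique (h2.congr_of_eventuallyEq h3)
    simp only [hL]
    field_simp at e ⊢
    linear_combination e
  -- As g_i = D / θ(z / u_i), Q / D is P / D minus ∑ ρ_i (L / θ)(z / u_i). All poles cancel, so Q /
  -- D is holomorphic on ℂ^*. Under z ↦ pz it increases by ∑ ρ_i, which must therefore vanish by
  -- `eq_zero_of_quasiperiodic`.
  set Q : ℂ → ℂ := fun z => P z - ∑ i, ρ i * (L (z / u i) * g i z) with hQ
  have hQd : DifferentiableOn ℂ Q {0}ᶜ := by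
    refine hP.sub (DifferentiableOn.fun_sum fun i _ => DifferentiableOn.const_mul
      (DifferentiableOn.mul (hLd.comp (differentiableOn_id.div_const _) fun z hz => ?_) (hgd i)) _)
    exact div_ne_zero hz (hu i)
  have hQ0 : ∀ z ∈ ({0}ᶜ : Set ℂ), D z = 0 → Q z = 0 ∧ deriv D z ≠ 0 := by
    intro z hz h
    refine ⟨?_, hD0 z hz h⟩
    obtain ⟨j, k, hk⟩ := hzero z hz h
    have hgi : ∀ i, i ≠ j → g i z = 0 := by
      intro i hij
      have := hgD i z hz
      rw [h] at this
      refine (mul_eq_zero.1 this.symm).resolve_right fun h' => ?_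
      obtain ⟨l, hl⟩ := hthzero i z hz h'
      refine hdist i j hij (-k + l) ?_
      rw [zpow_add₀ hp0, mul_assoc, ← hl, hk, zpow_neg, inv_mul_cancel_left₀ (zpow_ne_zero _ hp0)]
    have hthj : theta (z / u j) p = 0 :=
      (theta_eq_zero_iff hp hp0 (div_ne_zero hz (hu j))).2
        ⟨k, by rw [hk, mul_div_cancel_right₀ _ (hu j)]⟩
    have hder : deriv D z = g j z * (deriv (fun z => theta z p) (z / u j) / u j) := by
      have h1 := ((hgd j).differentiableAt (hopen.mem_nhds hz)).hasDerivAt.mul (hthd j z hz)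
      have h2 : D =ᶠ[𝓝 z] fun z => g j z * theta (z / u j) p := by
        filter_upwards [hopen.mem_nhds hz] with w hw using hgD j w hw
      rw [(h1.congr_of_eventuallyEq h2).deriv, hthj]
      simp
    have hPz : P z = ρ j * (z * deriv D z) := hk ▸ (hzeros j k).2.2
    rw [hQ]
    simp only
    rw [Finset.sum_eq_single j (fun i _ hij => by rw [hgi i hij]; ring) (by simp), hPz, hder, hL]
    ring
  obtain ⟨h, hhd, hhQ⟩ := exists_differentiableOn_quotient hopen hQd hD hQ0
  refine eq_zero_of_quasiperiodic hp0 (∑ i, ρ i) hhd fun z hz => ?_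
  have hpmap : Set.MapsTo (fun z => p * z) ({0}ᶜ : Set ℂ) {0}ᶜ := fun z hz => mul_ne_zero hp0 hz
  have hgp : ∀ i, ∀ z ∈ ({0}ᶜ : Set ℂ), g i (p * z) = C * z ^ N * (-(z / u i)) * g i z := by
    intro i z hz
    refine sub_eq_zero.1 (eq_zero_of_mul_eq_zero_of_simple_zeros hopen
      (g := fun z => g i (p * z) - C * z ^ N * (-(z / u i)) * g i z)
      (D := fun z => theta (z / u i) p) ?_ (hthdiff i) (fun w hw h => ?_) (fun w hw => ?_) hz)
    · refine ((hgd i).continuousOn.comp (by fun_prop) hpmap).sub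
        (ContinuousOn.mul (ContinuousOn.mul (continuousOn_const.mul ?_) (by fun_prop))
          (hgd i).continuousOn)
      exact fun w hw => (continuousAt_zpow₀ w N (Or.inl hw)).continuousWithinAt
    · rw [(hthd i w hw).deriv]
      exact div_ne_zero (deriv_theta_ne_zero hp hp0 (div_ne_zero hw (hu i)) h) (hu i)
    · have e1 := hgD i (p * w) (hpmap hw)
      have hw' : w / u i ≠ 0 := div_ne_zero hw (hu i)
      rw [hDp w hw, hgD i w hw, mul_div_assoc, theta_mul_left hp hp0 hw'] at e1
      have : (w / u i) * (w / u i)⁻¹ = 1 := mul_inv_cancel₀ hw'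
      linear_combination (w / u i) * e1 - (g i (p * w) * theta (w / u i) p) * this
  have hQp : ∀ z ∈ ({0}ᶜ : Set ℂ), Q (p * z) = C * z ^ N * (Q z + (∑ i, ρ i) * D z) := by
    intro z hz
    simp only [hQ]
    rw [hPp z hz, Finset.sum_mul, mul_add, mul_sub, Finset.mul_sum, Finset.mul_sum, sub_add,
      ← Finset.sum_sub_distrib]
    congr 1
    refine Finset.sum_congr rfl fun i _ => ?_
    have hw' : z / u i ≠ 0 := div_ne_zero hz (hu i)
    rw [mul_div_assoc, hLp _ hw', hgp i z hz, hgD i z hz]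
    have : (z / u i) * (z / u i)⁻¹ = 1 := mul_inv_cancel₀ hw'
    linear_combination (ρ i * C * z ^ N * g i z) * (L (z / u i) - theta (z / u i) p) * this
  refine sub_eq_zero.1 (eq_zero_of_mul_eq_zero_of_simple_zeros hopen
    (g := fun z => h (p * z) - (h z + ∑ i, ρ i)) (D := D)
    ((hhd.continuousOn.comp (by fun_prop) hpmap).sub (hhd.continuousOn.add continuousOn_const))
    hD hD0 (fun w hw => ?_) hz)
  have e1 := hhQ (p * w) (hpmap hw)
  rw [hQp w hw, hDp w hw, hhQ w hw] at e1
  have hm : C * w ^ N ≠ 0 := mul_ne_zero hC (zpow_ne_zero _ hw)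
  refine mul_left_cancel₀ hm ?_
  linear_combination -e1


/-! ### The half periods -/

theorem cpow_half_sq (z : ℂ) : (z ^ (1 / 2 : ℂ)) ^ 2 = z := by
  rw [one_div]
  exact_mod_cast Complex.cpow_nat_inv_pow z two_ne_zero

theorem cpow_half_ne_zero {z : ℂ} (hz : z ≠ 0) : z ^ (1 / 2 : ℂ) ≠ 0 := fun h => hz <| by
  rw [← cpow_half_sq z, h]; norm_num

theorem halfPeriod_ne_zero {p : ℂ} (hp0 : p ≠ 0) (k : Fin 4) : halfPeriod p k ≠ 0 := by
  have := cpow_half_ne_zero hp0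
  fin_cases k <;> simp [halfPeriod, hp0]

theorem exists_halfPeriod_of_sq_eq_zpow {p : ℂ} (hp0 : p ≠ 0) {w : ℂ} {k : ℤ}
    (h : w ^ 2 = p ^ k) : ∃ i, ∃ l : ℤ, w = p ^ l * halfPeriod p i := by
  have hs0 := cpow_half_ne_zero hp0
  have hs := cpow_half_sq p
  obtain ⟨l, rfl | rfl⟩ := k.even_or_odd'
  · rw [mul_comm, zpow_mul, show (p ^ l) ^ (2 : ℤ) = (p ^ l) ^ 2 from rfl, sq_eq_sq_iff_eq_or_eq_neg] at h
    rcases h with h | h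
    · exact ⟨0, l, by simp [halfPeriod, h]⟩
    · exact ⟨1, l, by simp [halfPeriod, h]⟩
  · have e : p ^ (2 * l + 1) = (p ^ l * p ^ (1 / 2 : ℂ)) ^ 2 := by
      rw [zpow_add_one₀ hp0, mul_comm 2 l, zpow_mul, mul_pow, hs]
      rfl
    rw [e, sq_eq_sq_iff_eq_or_eq_neg] at h
    rcases h with h | h
    · exact ⟨2, l, by simp [halfPeriod, h]⟩
    · refine ⟨3, l + 1, ?_⟩
      have e1 : p * (p ^ (1 / 2 : ℂ))⁻¹ = p ^ (1 / 2 : ℂ) := by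
        rw [eq_comm, eq_mul_inv_iff_mul_eq₀ hs0, ← sq, hs]
      rw [h, zpow_add_one₀ hp0]
      simp only [halfPeriod, Matrix.cons_val]
      linear_combination p ^ l * e1

theorem halfPeriod_sq {p : ℂ} (i : Fin 4) :
    halfPeriod p i ^ 2 = p ^ ((![0, 0, 1, -1] : Fin 4 → ℤ) i) := by
  fin_cases i <;> simp [halfPeriod]

/-- The norms of the squares determine k. Parity excludes all pairs but {c_0, c_1} and {c_2, c_3},
and within these the points differ by a sign modulo p^ℤ. -/
theorem halfPeriod_ne_zpow_mul {p : ℂ} (hp : ‖p‖ < 1) (hp0 : p ≠ 0) {i j : Fin 4} (hij : i ≠ j)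
    (k : ℤ) : halfPeriod p j ≠ p ^ k * halfPeriod p i := by
  intro h
  have hs0 := cpow_half_ne_zero hp0
  have hs := cpow_half_sq p
  have h2 : p ^ ((![0, 0, 1, -1] : Fin 4 → ℤ) j) =
      p ^ (k * 2 + (![0, 0, 1, -1] : Fin 4 → ℤ) i) := by
    rw [zpow_add₀ hp0, zpow_mul, ← halfPeriod_sq, ← halfPeriod_sq, h, mul_pow]
    rfl
  have hinj := zpow_right_injective₀ (norm_pos_iff.2 hp0) hp.ne
    (by simpa only [norm_zpow] using congrArg norm h2)
  clear h2
  fin_cases i <;> fin_cases j <;> simp at hij hinj <;> try omega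
  · have hk : k = 0 := by omega
    subst hk
    norm_num [halfPeriod, Complex.ext_iff] at h
  · have hk : k = 0 := by omega
    subst hk
    norm_num [halfPeriod, Complex.ext_iff] at h
  · have hk : k = -1 := by omega
    subst hk
    simp only [halfPeriod, Fin.reduceFinMk, Matrix.cons_val, zpow_neg_one] at h
    generalize p ^ (1 / 2 : ℂ) = s at *
    subst hs
    field_simp at h
    norm_num [Complex.ext_iff] at h
  · have hk : k = 1 := by omega
    subst hk
    simp only [halfPeriod, Fin.reduceFinMk, Matrix.cons_val, zpow_one] at h
    generalize p ^ (1 / 2 : ℂ) = s at *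
    subst hs
    field_simp at h
    norm_num [Complex.ext_iff] at h


/-! ### The elliptic function of the kernel identity and its residues -/

theorem pm_inv (f : ℂ → ℂ) (c x : ℂ) : pm f c x⁻¹ = pm f c x := by
  rw [pm, pm, inv_inv, mul_comm]

/-- The denominator of the elliptic function whose residues make up the kernel identity. -/
noncomputable def poleDenom {V : Type*} [Fintype V] (p q t : ℂ) (v : V → ℂ) (z : ℂ) : ℂ :=
  theta (q * z ^ 2) p * theta (t * z ^ 2) p * ∏ w, pm (fun z => theta z p) z (v w)

/-- The numerator of the elliptic function whose residues make up the kernel identity. -/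
noncomputable def poleNumer {V : Type*} [Fintype V] (p : ℂ) (a : Fin 8 → ℂ) (τ v : V → ℂ) (z : ℂ) :
    ℂ :=
  (∏ s, theta (a s * z) p) * ∏ w, pm (fun z => theta z p) (τ w * z) (v w)

/-- The conditions under which all the poles of the elliptic function are simple. -/
structure PoleGeneric {V : Type*} (p q t : ℂ) (v : V → ℂ) : Prop where
  ne_zero : ∀ w, v w ≠ 0
  sq : ∀ w, ∀ k : ℤ, v w ^ 2 ≠ p ^ k
  left : ∀ w, ∀ k : ℤ, q * v w ^ 2 ≠ p ^ k
  left' : ∀ w, ∀ k : ℤ, v w ^ 2 ≠ q * p ^ k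
  right : ∀ w, ∀ k : ℤ, t * v w ^ 2 ≠ p ^ k
  right' : ∀ w, ∀ k : ℤ, v w ^ 2 ≠ t * p ^ k
  mul : ∀ w w', w ≠ w' → ∀ k : ℤ, v w * v w' ≠ p ^ k
  ratio : ∀ w w', w ≠ w' → ∀ k : ℤ, v w ≠ p ^ k * v w'

theorem PoleGeneric.symm {V : Type*} {p q t : ℂ} {v : V → ℂ} (h : PoleGeneric p q t v) :
    PoleGeneric p t q v :=
  ⟨h.ne_zero, h.sq, h.right, h.right', h.left, h.left', h.mul, h.ratio⟩

theorem PoleGeneric.inv {V : Type*} {p q t : ℂ} {v : V → ℂ} (h : PoleGeneric p q t v)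
    (hp0 : p ≠ 0) : PoleGeneric p q t (fun w => (v w)⁻¹) := by
  have hpk : ∀ k : ℤ, p ^ k ≠ 0 := fun k => zpow_ne_zero k hp0
  have hv := h.ne_zero
  refine ⟨fun w => inv_ne_zero (hv w), fun w k e => h.sq w (-k) ?_, fun w k e => h.left' w (-k) ?_,
    fun w k e => h.left w (-k) ?_, fun w k e => h.right' w (-k) ?_, fun w k e => h.right w (-k) ?_,
    fun w w' hw k e => h.mul w w' hw (-k) ?_, fun w w' hw k e => h.ratio w w' hw (-k) ?_⟩ <;>
  · have h1 := hpk k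
    have h2 := hv w
    try have h3 := hv w'
    rw [zpow_neg]
    field_simp at e ⊢
    exact e.symm

theorem poleDenom_inv {V : Type*} [Fintype V] (p q t : ℂ) (v : V → ℂ) :
    poleDenom p q t (fun w => (v w)⁻¹) = poleDenom p q t v := by
  funext z
  simp only [poleDenom, pm_inv]

theorem poleDenom_symm {V : Type*} [Fintype V] (p q t : ℂ) (v : V → ℂ) : poleDenom p t q v = poleDenom p q t v := by
  funext z
  simp only [poleDenom]
  ring

theorem differentiableAt_theta_comp {p : ℂ} (hp : ‖p‖ < 1) {f : ℂ → ℂ} {z : ℂ}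
    (hf : DifferentiableAt ℂ f z) (h0 : f z ≠ 0) : DifferentiableAt ℂ (fun z => theta (f z) p) z :=
  (differentiableAt_theta hp h0).comp z hf

theorem differentiableAt_theta_const_mul_sq {p : ℂ} (hp : ‖p‖ < 1) {c z : ℂ} (hc : c ≠ 0)
    (hz : z ≠ 0) : DifferentiableAt ℂ (fun z => theta (c * z ^ 2) p) z :=
  differentiableAt_theta_comp hp (f := fun z => c * z ^ 2) (by fun_prop)
    (mul_ne_zero hc (pow_ne_zero 2 hz))

theorem differentiableAt_theta_mul_const {p : ℂ} (hp : ‖p‖ < 1) {c z : ℂ} (hc : c ≠ 0)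
    (hz : z ≠ 0) : DifferentiableAt ℂ (fun z => theta (z * c) p) z :=
  differentiableAt_theta_comp hp (f := fun z => z * c) (by fun_prop) (mul_ne_zero hz hc)

theorem differentiableAt_pm_theta {p : ℂ} (hp : ‖p‖ < 1) {f : ℂ → ℂ} {z x : ℂ}
    (hf : DifferentiableAt ℂ f z) (h0 : f z ≠ 0) (hx : x ≠ 0) :
    DifferentiableAt ℂ (fun z => pm (fun z => theta z p) (f z) x) z :=
  (differentiableAt_theta_comp hp (hf.mul_const x) (mul_ne_zero h0 hx)).mul
    (differentiableAt_theta_comp hp (hf.mul_const x⁻¹) (mul_ne_zero h0 (inv_ne_zero hx)))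

theorem differentiableAt_prod_pm_theta {V : Type*} {p : ℂ} (hp : ‖p‖ < 1) (S : Finset V) {τ v : V → ℂ}
    (hτ : ∀ w, τ w ≠ 0) (hv : ∀ w, v w ≠ 0) {z : ℂ} (hz : z ≠ 0) :
    DifferentiableAt ℂ (fun z => ∏ w ∈ S, pm (fun z => theta z p) (τ w * z) (v w)) z :=
  DifferentiableAt.fun_finsetProd fun w _ =>
    differentiableAt_pm_theta hp (by fun_prop) (mul_ne_zero (hτ w) hz) (hv w)

theorem differentiableOn_poleDenom {V : Type*} [Fintype V] {p q t : ℂ} (hp : ‖p‖ < 1) (hq0 : q ≠ 0) (ht0 : t ≠ 0)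
    {v : V → ℂ} (hv : ∀ w, v w ≠ 0) : DifferentiableOn ℂ (poleDenom p q t v) {0}ᶜ := by
  intro z hz
  refine DifferentiableAt.differentiableWithinAt ?_
  refine ((differentiableAt_theta_const_mul_sq hp hq0 hz).mul
    (differentiableAt_theta_const_mul_sq hp ht0 hz)).mul ?_
  simpa using differentiableAt_prod_pm_theta hp Finset.univ (τ := fun _ => 1)
    (fun _ => one_ne_zero) hv hz

theorem differentiableOn_poleNumer {V : Type*} [Fintype V] {p : ℂ} (hp : ‖p‖ < 1) {a : Fin 8 → ℂ} (ha : ∀ s, a s ≠ 0)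
    {τ v : V → ℂ} (hτ : ∀ w, τ w ≠ 0) (hv : ∀ w, v w ≠ 0) :
    DifferentiableOn ℂ (poleNumer p a τ v) {0}ᶜ := by
  intro z hz
  refine DifferentiableAt.differentiableWithinAt ?_
  exact (DifferentiableAt.fun_finsetProd fun s _ =>
    differentiableAt_theta_comp hp (by fun_prop) (mul_ne_zero (ha s) hz)).mul
    (differentiableAt_prod_pm_theta hp Finset.univ hτ hv hz)

theorem theta_mul_sq {p : ℂ} (hp : ‖p‖ < 1) (hp0 : p ≠ 0) {q z : ℂ} (hq : q ≠ 0) (hz : z ≠ 0) :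
    theta (q * (p * z) ^ 2) p = (p * q ^ 2 * z ^ 4)⁻¹ * theta (q * z ^ 2) p := by
  have h1 : q * z ^ 2 ≠ 0 := mul_ne_zero hq (pow_ne_zero 2 hz)
  rw [show q * (p * z) ^ 2 = p * (p * (q * z ^ 2)) by ring,
    theta_mul_left hp hp0 (mul_ne_zero hp0 h1), theta_mul_left hp hp0 h1]
  field_simp

theorem pm_theta_mul {p : ℂ} (hp : ‖p‖ < 1) (hp0 : p ≠ 0) {z x : ℂ} (hz : z ≠ 0) (hx : x ≠ 0) :
    pm (fun z => theta z p) (p * z) x = (z ^ 2)⁻¹ * pm (fun z => theta z p) z x := by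
  simp only [pm, mul_assoc p]
  rw [theta_mul_left hp hp0 (mul_ne_zero hz hx),
    theta_mul_left hp hp0 (mul_ne_zero hz (inv_ne_zero hx))]
  field_simp

theorem poleDenom_mul {V : Type*} [Fintype V] {p q t : ℂ} (hp : ‖p‖ < 1) (hp0 : p ≠ 0) (hq0 : q ≠ 0) (ht0 : t ≠ 0)
    {v : V → ℂ} (hv : ∀ w, v w ≠ 0) {z : ℂ} (hz : z ≠ 0) :
    poleDenom p q t v (p * z) = (p ^ 2 * q ^ 2 * t ^ 2)⁻¹ *
      z ^ (-(8 + 2 * Fintype.card V : ℤ)) * poleDenom p q t v z := by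
  have e : z ^ (-(8 + 2 * Fintype.card V : ℤ)) = (z ^ 8 * (z ^ 2) ^ Fintype.card V)⁻¹ := by
    rw [zpow_neg, ← pow_mul, ← pow_add, ← zpow_natCast]
    push_cast
    rfl
  simp only [poleDenom]
  rw [Finset.prod_congr rfl fun w _ => pm_theta_mul hp hp0 hz (hv w), Finset.prod_mul_distrib,
    theta_mul_sq hp hp0 hq0 hz, theta_mul_sq hp hp0 ht0 hz, e]
  simp only [Finset.prod_const, Finset.card_univ, inv_pow]
  field_simp

/-- The power of z is the one in `poleDenom_mul`, and the constants of the two multipliers agree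
when (∏ a_s) ∏ τ_w² = p² q² t². This is how the balancing condition makes the quotient elliptic. -/
theorem poleNumer_mul {V : Type*} [Fintype V] {p : ℂ} (hp : ‖p‖ < 1) (hp0 : p ≠ 0) {a : Fin 8 → ℂ} (ha : ∀ s, a s ≠ 0)
    {τ v : V → ℂ} (hτ : ∀ w, τ w ≠ 0) (hv : ∀ w, v w ≠ 0) {z : ℂ} (hz : z ≠ 0) :
    poleNumer p a τ v (p * z) = ((∏ s, a s) * ∏ w, τ w ^ 2)⁻¹ *
      z ^ (-(8 + 2 * Fintype.card V : ℤ)) * poleNumer p a τ v z := by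
  have e : z ^ (-(8 + 2 * Fintype.card V : ℤ)) = (z ^ 8 * (z ^ 2) ^ Fintype.card V)⁻¹ := by
    rw [zpow_neg, ← pow_mul, ← pow_add, ← zpow_natCast]
    push_cast
    rfl
  have h1 : ∀ s, theta (a s * (p * z)) p = (-1) * (a s)⁻¹ * z⁻¹ * theta (a s * z) p := fun s => by
    rw [mul_left_comm, theta_mul_left hp hp0 (mul_ne_zero (ha s) hz), mul_inv]
    ring
  have h2 : ∀ w, pm (fun z => theta z p) (τ w * (p * z)) (v w) =
      (τ w ^ 2)⁻¹ * (z ^ 2)⁻¹ * pm (fun z => theta z p) (τ w * z) (v w) := fun w => by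
    rw [mul_left_comm, pm_theta_mul hp hp0 (mul_ne_zero (hτ w) hz) (hv w), mul_pow, mul_inv]
  simp only [poleNumer]
  rw [Finset.prod_congr rfl fun s _ => h1 s, Finset.prod_congr rfl fun w _ => h2 w, e]
  simp only [Finset.prod_mul_distrib, Finset.prod_const, Finset.card_univ, Finset.prod_inv_distrib,
    Fintype.card_fin, inv_pow, mul_inv]
  ring

theorem theta_ne_zero {p : ℂ} (hp : ‖p‖ < 1) (hp0 : p ≠ 0) {z : ℂ} (hz : z ≠ 0)
    (h : ∀ k : ℤ, z ≠ p ^ k) : theta z p ≠ 0 := fun h0 => by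
  obtain ⟨k, hk⟩ := (theta_eq_zero_iff hp hp0 hz).1 h0
  exact h k hk

theorem hasDerivAt_of_eventuallyEq_mul {D f g : ℂ → ℂ} {u f' : ℂ} (hf : HasDerivAt f f' u)
    (hf0 : f u = 0) (hg : DifferentiableAt ℂ g u) (h : ∀ z, D z = f z * g z) :
    HasDerivAt D (f' * g u) u := by
  have := hf.mul hg.hasDerivAt
  rw [hf0, zero_mul, add_zero] at this
  exact this.congr_of_eventuallyEq (.of_forall h)

theorem hasDerivAt_poleDenom {V : Type*} [Fintype V] [DecidableEq V] {p q t : ℂ} (hp : ‖p‖ < 1) (hp0 : p ≠ 0) (hq0 : q ≠ 0) (ht0 : t ≠ 0)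
    {v : V → ℂ} (hv : ∀ w, v w ≠ 0) (w : V) :
    HasDerivAt (poleDenom p q t v) (deriv (fun z => theta z p) 1 * (v w)⁻¹ *
      (theta (v w ^ 2) p * (theta (q * v w ^ 2) p * theta (t * v w ^ 2) p) *
        ∏ w' ∈ Finset.univ.erase w, pm (fun z => theta z p) (v w) (v w'))) (v w) := by
  have hw := hv w
  have h1 : HasDerivAt (fun z => theta (z * (v w)⁻¹) p)
      (deriv (fun z => theta z p) 1 * (v w)⁻¹) (v w) := by
    have h2 := (differentiableAt_theta hp (one_ne_zero)).hasDerivAt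
    rw [← mul_inv_cancel₀ hw] at h2
    have := h2.comp (v w) ((hasDerivAt_id (v w)).mul_const (v w)⁻¹)
    rw [one_mul, mul_inv_cancel₀ hw] at this
    exact this
  have hth : theta 1 p = 0 := (theta_eq_zero_iff hp hp0 one_ne_zero).2 ⟨0, by simp⟩
  have := hasDerivAt_of_eventuallyEq_mul (D := poleDenom p q t v) h1
    (g := fun z => theta (z * v w) p * (theta (q * z ^ 2) p * theta (t * z ^ 2) p) *
      ∏ w' ∈ Finset.univ.erase w, pm (fun z => theta z p) z (v w'))
    (by rw [mul_inv_cancel₀ hw, hth]) ?_ fun z => ?_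
  · rwa [← sq] at this
  · refine ((differentiableAt_theta_mul_const hp hw hw).mul
      ((differentiableAt_theta_const_mul_sq hp hq0 hw).mul
      (differentiableAt_theta_const_mul_sq hp ht0 hw))).mul ?_
    simpa using differentiableAt_prod_pm_theta hp (Finset.univ.erase w) (τ := fun _ => 1)
      (fun _ => one_ne_zero) hv hw
  · rw [poleDenom, ← Finset.mul_prod_erase _ _ (Finset.mem_univ w), pm]
    ring

/-- The factors by which the derivatives of `θ(z²; p)` at the half periods differ. -/
noncomputable def periodSign (p : ℂ) : Fin 4 → ℂ := ![1, 1, -1, -p⁻¹]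

theorem periodSign_ne_zero {p : ℂ} (hp0 : p ≠ 0) (k : Fin 4) : periodSign p k ≠ 0 := by
  fin_cases k <;> simp [periodSign, hp0]

/-- The points c_k² are 1, 1, p and 1/p, all in the orbit of the zero 1, so the functional equation
relates the derivatives. -/
theorem halfPeriod_sq_mul_deriv_theta {p : ℂ} (hp : ‖p‖ < 1) (hp0 : p ≠ 0) (k : Fin 4) :
    halfPeriod p k ^ 2 * deriv (fun z => theta z p) (halfPeriod p k ^ 2) =
      periodSign p k * deriv (fun z => theta z p) 1 := by
  have hq : ∀ z, z ≠ 0 → theta (p * z) p = (-1) * z ^ (-1 : ℤ) * theta z p := fun z hz => by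
    rw [theta_mul_left hp hp0 hz, zpow_neg_one, neg_one_mul]
  have hth : theta 1 p = 0 := (theta_eq_zero_iff hp hp0 one_ne_zero).2 ⟨0, by simp⟩
  have hth' : theta p⁻¹ p = 0 :=
    (theta_eq_zero_iff hp hp0 (inv_ne_zero hp0)).2 ⟨-1, by simp⟩
  have h1 := hasDerivAt_mul_of_quasiperiodic hp0 (differentiableOn_theta hp) hq one_ne_zero hth
  have h2 := hasDerivAt_mul_of_quasiperiodic hp0 (differentiableOn_theta hp) hq
    (inv_ne_zero hp0) hth'
  rw [mul_one] at h1
  rw [mul_inv_cancel₀ hp0] at h2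
  rw [halfPeriod_sq]
  fin_cases k
  · simp [periodSign]
  · simp [periodSign]
  · simpa [periodSign] using h1
  · simp only [periodSign, Fin.reduceFinMk, Matrix.cons_val, zpow_neg_one, inv_inv] at h2 ⊢
    field_simp
    field_simp at h2
    linear_combination h2

theorem hasDerivAt_poleDenom_period {V : Type*} [Fintype V] {p q t : ℂ} (hp : ‖p‖ < 1) (hp0 : p ≠ 0) (hq0 : q ≠ 0)
    (ht0 : t ≠ 0) {v : V → ℂ} (hv : ∀ w, v w ≠ 0) (k : Fin 4) {z : ℂ} (hz : z ≠ 0)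
    (hzk : q * z ^ 2 = halfPeriod p k ^ 2) :
    HasDerivAt (poleDenom p q t v) (2 * periodSign p k * deriv (fun z => theta z p) 1 * z⁻¹ *
      (theta (t * z ^ 2) p * ∏ w, pm (fun z => theta z p) z (v w))) z := by
  have hqz : q * z ^ 2 ≠ 0 := mul_ne_zero hq0 (pow_ne_zero 2 hz)
  have h1 : HasDerivAt (fun z => theta (q * z ^ 2) p)
      (2 * periodSign p k * deriv (fun z => theta z p) 1 * z⁻¹) z := by
    have h2 := (differentiableAt_theta hp hqz).hasDerivAt
    have := h2.comp z (((hasDerivAt_id z).pow 2).const_mul q)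
    refine this.congr_deriv ?_
    rw [show 2 * periodSign p k * deriv (fun z => theta z p) 1 * z⁻¹ =
      2 * (periodSign p k * deriv (fun z => theta z p) 1) * z⁻¹ by ring,
      ← halfPeriod_sq_mul_deriv_theta hp hp0, ← hzk]
    simp
    field_simp
  have hth : theta (q * z ^ 2) p = 0 := by
    refine (theta_eq_zero_iff hp hp0 hqz).2 ⟨_, hzk.trans (halfPeriod_sq k)⟩
  refine hasDerivAt_of_eventuallyEq_mul h1 hth (g := fun z => theta (t * z ^ 2) p *
    ∏ w, pm (fun z => theta z p) z (v w)) ?_ fun z => ?_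
  · refine (differentiableAt_theta_const_mul_sq hp ht0 hz).mul ?_
    simpa using differentiableAt_prod_pm_theta hp Finset.univ (τ := fun _ => 1)
      (fun _ => one_ne_zero) hv hz
  · rw [poleDenom, mul_assoc]


/-- The residue term at a pole `z = v_w^±`. -/
noncomputable def poleTerm {V : Type*} [Fintype V] [DecidableEq V] (p q t : ℂ) (a : Fin 8 → ℂ)
    (τ v : V → ℂ) (w : V) (z : ℂ) : ℂ :=
  (∏ s, theta (a s * z) p) * (theta (τ w) p * theta (τ w * z ^ 2) p) /
      (theta (z ^ 2) p * (theta (q * z ^ 2) p * theta (t * z ^ 2) p)) *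
    ∏ w' ∈ Finset.univ.erase w,
      pm (fun z => theta z p) (τ w' * z) (v w') / pm (fun z => theta z p) z (v w')

/-- The residue term at a pole with `q z² ∈ p^ℤ`. -/
noncomputable def periodTerm {V : Type*} [Fintype V] (p t : ℂ) (a : Fin 8 → ℂ)
    (τ v : V → ℂ) (k : Fin 4) (z : ℂ) : ℂ :=
  (∏ s, theta (a s * z) p) / (2 * periodSign p k * theta (t * z ^ 2) p) *
    ∏ w, pm (fun z => theta z p) (τ w * z) (v w) / pm (fun z => theta z p) z (v w)

theorem pm_theta_ne_zero {p : ℂ} (hp : ‖p‖ < 1) (hp0 : p ≠ 0) {z x : ℂ} (hz : z ≠ 0) (hx : x ≠ 0)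
    (h1 : ∀ k : ℤ, z * x ≠ p ^ k) (h2 : ∀ k : ℤ, z ≠ p ^ k * x) :
    pm (fun z => theta z p) z x ≠ 0 :=
  mul_ne_zero (theta_ne_zero hp hp0 (mul_ne_zero hz hx) h1)
    (theta_ne_zero hp hp0 (mul_ne_zero hz (inv_ne_zero hx)) fun k h => h2 k
      (by rw [← h, inv_mul_cancel_right₀ hx]))

/-- At z = v_w the w-th factor of the numerator is θ(τ_w z²) θ(τ_w). The constant c will be θ'(1),
common to all residues. -/
theorem poleNumer_div {V : Type*} [Fintype V] [DecidableEq V] (p q t : ℂ) (a : Fin 8 → ℂ)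
    {τ v : V → ℂ} (w : V) (hw : v w ≠ 0) (c : ℂ) :
    poleNumer p a τ v (v w) / (v w * (c * (v w)⁻¹ *
      (theta (v w ^ 2) p * (theta (q * v w ^ 2) p * theta (t * v w ^ 2) p) *
        ∏ w' ∈ Finset.univ.erase w, pm (fun z => theta z p) (v w) (v w')))) =
    c⁻¹ * poleTerm p q t a τ v w (v w) := by
  rw [poleNumer, ← Finset.mul_prod_erase _ _ (Finset.mem_univ w), poleTerm, Finset.prod_div_distrib,
    pm, mul_assoc (τ w), mul_assoc (τ w), mul_inv_cancel₀ hw, mul_one, ← sq]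
  generalize ∏ s, theta (a s * v w) p = A
  generalize ∏ w' ∈ Finset.univ.erase w, pm (fun z => theta z p) (τ w' * v w) (v w') = B
  field_simp

/-- `sum_residues_eq_zero` applied to `poleNumer` over `poleDenom`. Modulo p^ℤ the poles are the v_w
and their inverses, the four points c_k q^{−1/2} and the four points c_k t^{−1/2}; genericity and
q/t ∉ p^ℤ make them simple and distinct. -/
theorem sum_poleTerm_eq_zero {V : Type*} [Fintype V] [DecidableEq V] {p q t : ℂ} (hp : ‖p‖ < 1)
    (hp0 : p ≠ 0) (hq0 : q ≠ 0) (ht0 : t ≠ 0) (hqt : ∀ k : ℤ, t ≠ q * p ^ k) {a : Fin 8 → ℂ}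
    (ha : ∀ s, a s ≠ 0) {τ v : V → ℂ} (hτ : ∀ w, τ w ≠ 0)
    (hbal : (∏ s, a s) * ∏ w, τ w ^ 2 = p ^ 2 * q ^ 2 * t ^ 2) (hv : PoleGeneric p q t v) :
    ∑ w, (poleTerm p q t a τ v w (v w) + poleTerm p q t a τ v w (v w)⁻¹) +
      (∑ k, periodTerm p t a τ v k (halfPeriod p k * (q ^ (1 / 2 : ℂ))⁻¹) +
        ∑ k, periodTerm p q a τ v k (halfPeriod p k * (t ^ (1 / 2 : ℂ))⁻¹)) = 0 := by
  have hv0 := hv.ne_zero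
  have hvi := hv.inv hp0
  have hpk : ∀ k : ℤ, p ^ k ≠ 0 := fun k => zpow_ne_zero k hp0
  set c : ℂ := deriv (fun z => theta z p) 1 with hc
  have hc0 : c ≠ 0 := deriv_theta_one_ne_zero hp
  have hth0 : ∀ z : ℂ, z ≠ 0 → (∃ k : ℤ, z = p ^ k) → theta z p = 0 := fun z hz h =>
    (theta_eq_zero_iff hp hp0 hz).2 h
  -- the points `c_k q^{-1/2}`
  have hper : ∀ q : ℂ, q ≠ 0 → ∀ k, halfPeriod p k * (q ^ (1 / 2 : ℂ))⁻¹ ≠ 0 ∧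
      q * (halfPeriod p k * (q ^ (1 / 2 : ℂ))⁻¹) ^ 2 = halfPeriod p k ^ 2 := fun q hq k => by
    refine ⟨mul_ne_zero (halfPeriod_ne_zero hp0 k) (inv_ne_zero (cpow_half_ne_zero hq)), ?_⟩
    rw [mul_pow, inv_pow, cpow_half_sq]
    field_simp
  have hpersq : ∀ q : ℂ, q ≠ 0 → ∀ k, ∃ l : ℤ,
      q * (halfPeriod p k * (q ^ (1 / 2 : ℂ))⁻¹) ^ 2 = p ^ l := fun q hq k =>
    ⟨_, (hper q hq k).2.trans (halfPeriod_sq k)⟩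
  have hperex : ∀ q : ℂ, q ≠ 0 → ∀ z : ℂ, z ≠ 0 → theta (q * z ^ 2) p = 0 →
      ∃ k, ∃ l : ℤ, z = p ^ l * (halfPeriod p k * (q ^ (1 / 2 : ℂ))⁻¹) := by
    intro q hq z hz h
    obtain ⟨k, hk⟩ := (theta_eq_zero_iff hp hp0 (mul_ne_zero hq (pow_ne_zero 2 hz))).1 h
    obtain ⟨i, l, hl⟩ := exists_halfPeriod_of_sq_eq_zpow hp0 (w := z * q ^ (1 / 2 : ℂ)) (k := k)
      (by rw [mul_pow, cpow_half_sq, mul_comm, hk])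
    exact ⟨i, l, by rw [← mul_assoc, ← hl, mul_inv_cancel_right₀ (cpow_half_ne_zero hq)]⟩
  -- a pole `v_w` differs from the points `c_k q^{-1/2}`
  have hcross : ∀ q t : ℂ, q ≠ 0 → ∀ v : V → ℂ, PoleGeneric p q t v → ∀ w k, ∀ l : ℤ,
      v w ≠ p ^ l * (halfPeriod p k * (q ^ (1 / 2 : ℂ))⁻¹) ∧
      halfPeriod p k * (q ^ (1 / 2 : ℂ))⁻¹ ≠ p ^ l * v w := by
    intro q t hq v hv w k l
    obtain ⟨j, hj⟩ := hpersq q hq k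
    refine ⟨fun h => hv.left w (l * 2 + j) ?_, fun h => hv.left w (-(l * 2) + j) ?_⟩
    · rw [h, mul_pow, zpow_add₀ hp0, zpow_mul, ← hj]
      simp only [zpow_ofNat]
      ring
    · rw [h] at hj
      rw [zpow_add₀ hp0, ← hj, zpow_neg, zpow_mul]
      simp only [zpow_ofNat]
      have := hpk l
      field_simp
  have hthsq : ∀ q t : ℂ, q ≠ 0 → t ≠ 0 → (∀ k : ℤ, t ≠ q * p ^ k) → ∀ k,
      theta (t * (halfPeriod p k * (q ^ (1 / 2 : ℂ))⁻¹) ^ 2) p ≠ 0 := by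
    intro q t hq ht hqt k
    refine theta_ne_zero hp hp0 (mul_ne_zero ht (pow_ne_zero 2 (hper q hq k).1)) fun l h => ?_
    obtain ⟨j, hj⟩ := hpersq q hq k
    refine hqt (l - j) ?_
    rw [zpow_sub₀ hp0, ← hj, ← h]
    have := (hper q hq k).1
    generalize halfPeriod p k * (q ^ (1 / 2 : ℂ))⁻¹ = z at *
    field_simp
  have hqt' : ∀ k : ℤ, q ≠ t * p ^ k := fun k h => hqt (-k) (by
    rw [h, zpow_neg, mul_inv_cancel_right₀ (hpk k)])
  -- the derivatives at the poles
  set d₁ : (V → ℂ) → V → ℂ := fun v w => c * (v w)⁻¹ *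
    (theta (v w ^ 2) p * (theta (q * v w ^ 2) p * theta (t * v w ^ 2) p) *
      ∏ w' ∈ Finset.univ.erase w, pm (fun z => theta z p) (v w) (v w')) with hd₁
  set d₂ : ℂ → ℂ → Fin 4 → ℂ := fun q t k => 2 * periodSign p k * c *
    (halfPeriod p k * (q ^ (1 / 2 : ℂ))⁻¹)⁻¹ *
    (theta (t * (halfPeriod p k * (q ^ (1 / 2 : ℂ))⁻¹) ^ 2) p *
      ∏ w, pm (fun z => theta z p) (halfPeriod p k * (q ^ (1 / 2 : ℂ))⁻¹) (v w)) with hd₂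
  have hd₁0 : ∀ v : V → ℂ, PoleGeneric p q t v → ∀ w, d₁ v w ≠ 0 := by
    intro v hv w
    have hw := hv.ne_zero w
    have h2 := pow_ne_zero 2 hw
    refine mul_ne_zero (mul_ne_zero hc0 (inv_ne_zero hw)) (mul_ne_zero (mul_ne_zero
      (theta_ne_zero hp hp0 h2 (hv.sq w)) (mul_ne_zero
      (theta_ne_zero hp hp0 (mul_ne_zero hq0 h2) (hv.left w))
      (theta_ne_zero hp hp0 (mul_ne_zero ht0 h2) (hv.right w)))) (Finset.prod_ne_zero_iff.2 ?_))
    intro w' hw'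
    have hne := (Finset.ne_of_mem_erase hw').symm
    exact pm_theta_ne_zero hp hp0 hw (hv.ne_zero w') (hv.mul w w' hne) (hv.ratio w w' hne)
  have hpm : ∀ q t : ℂ, q ≠ 0 → PoleGeneric p q t v → ∀ k w,
      pm (fun z => theta z p) (halfPeriod p k * (q ^ (1 / 2 : ℂ))⁻¹) (v w) ≠ 0 := by
    intro q t hq hv k w
    refine pm_theta_ne_zero hp hp0 (hper q hq k).1 (hv0 w) (fun l h => ?_)
      fun l => (hcross q t hq v hv w k l).2
    refine (hcross q t hq _ (hv.inv hp0) w k l).2 ?_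
    rw [← h, mul_inv_cancel_right₀ (hv0 w)]
  have hd₂0 : ∀ q t : ℂ, q ≠ 0 → t ≠ 0 → (∀ k : ℤ, t ≠ q * p ^ k) → PoleGeneric p q t v → ∀ k,
      d₂ q t k ≠ 0 := by
    intro q t hq ht hqt hv k
    refine mul_ne_zero (mul_ne_zero (mul_ne_zero (mul_ne_zero two_ne_zero
      (periodSign_ne_zero hp0 k)) hc0) (inv_ne_zero (hper q hq k).1)) (mul_ne_zero
      (hthsq q t hq ht hqt k) (Finset.prod_ne_zero_iff.2 fun w _ => hpm q t hq hv k w))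
  have hperiodic : (p ^ 2 * q ^ 2 * t ^ 2)⁻¹ ≠ 0 := inv_ne_zero (by positivity)
  have key := sum_residues_eq_zero (ι := (V ⊕ V) ⊕ (Fin 4 ⊕ Fin 4)) hp hp0
    (D := poleDenom p q t v) (P := poleNumer p a τ v)
    (C := (p ^ 2 * q ^ 2 * t ^ 2)⁻¹) (N := -(8 + 2 * Fintype.card V : ℤ)) hperiodic
    (differentiableOn_poleDenom hp hq0 ht0 hv0) (differentiableOn_poleNumer hp ha hτ hv0)
    (fun z hz => poleDenom_mul hp hp0 hq0 ht0 hv0 hz)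
    (fun z hz => by rw [← hbal]; exact poleNumer_mul hp hp0 ha hτ hv0 hz)
    (Sum.elim (Sum.elim v fun w => (v w)⁻¹)
      (Sum.elim (fun k => halfPeriod p k * (q ^ (1 / 2 : ℂ))⁻¹)
        fun k => halfPeriod p k * (t ^ (1 / 2 : ℂ))⁻¹))
    (Sum.elim (Sum.elim (d₁ v) (d₁ fun w => (v w)⁻¹)) (Sum.elim (d₂ q t) (d₂ t q)))
    ?_ ?_ ?_ ?_ ?_ ?_
  · simp only [Fintype.sum_sum_type, Sum.elim_inl, Sum.elim_inr] at key
    have e1 : ∀ w, poleNumer p a τ v (v w) / (v w * d₁ v w) =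
        c⁻¹ * poleTerm p q t a τ v w (v w) := fun w => poleNumer_div p q t a w (hv0 w) c
    have e2 : ∀ w, poleNumer p a τ v (v w)⁻¹ / ((v w)⁻¹ * d₁ (fun w => (v w)⁻¹) w) =
        c⁻¹ * poleTerm p q t a τ v w (v w)⁻¹ := fun w => by
      have := poleNumer_div p q t a (τ := τ) (v := fun w => (v w)⁻¹) w (inv_ne_zero (hv0 w)) c
      simpa only [poleNumer, poleTerm, pm_inv, hd₁] using this
    have e3 : ∀ q t : ℂ, q ≠ 0 → ∀ k, poleNumer p a τ v (halfPeriod p k * (q ^ (1 / 2 : ℂ))⁻¹) /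
        (halfPeriod p k * (q ^ (1 / 2 : ℂ))⁻¹ * d₂ q t k) =
        c⁻¹ * periodTerm p t a τ v k (halfPeriod p k * (q ^ (1 / 2 : ℂ))⁻¹) := by
      intro q t hq k
      have := (hper q hq k).1
      simp only [hd₂, poleNumer, periodTerm, Finset.prod_div_distrib]
      generalize halfPeriod p k * (q ^ (1 / 2 : ℂ))⁻¹ = z at *
      generalize ∏ s, theta (a s * z) p = A
      generalize ∏ w, pm (fun z => theta z p) (τ w * z) (v w) = B
      field_simp
    simp only [e1, e2, e3 q t hq0, e3 t q ht0, ← Finset.mul_sum, ← mul_add] at key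
    rw [Finset.sum_add_distrib]
    exact (mul_eq_zero.1 key).resolve_left (inv_ne_zero hc0)
  · rintro ((w | w) | (k | k))
    · exact hv0 w
    · exact inv_ne_zero (hv0 w)
    · exact (hper q hq0 k).1
    · exact (hper t ht0 k).1
  · have h1 : theta 1 p = 0 := hth0 1 one_ne_zero ⟨0, by simp⟩
    rintro ((w | w) | (k | k))
    · simp only [Sum.elim_inl, poleDenom]
      rw [← Finset.mul_prod_erase _ _ (Finset.mem_univ w), pm, mul_inv_cancel₀ (hv0 w), h1]
      simp
    · simp only [Sum.elim_inl, Sum.elim_inr, poleDenom]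
      rw [← Finset.mul_prod_erase _ _ (Finset.mem_univ w), pm, inv_mul_cancel₀ (hv0 w), h1]
      simp
    · simp only [Sum.elim_inl, Sum.elim_inr, poleDenom]
      rw [hth0 _ (mul_ne_zero hq0 (pow_ne_zero 2 (hper q hq0 k).1)) (hpersq q hq0 k)]
      simp
    · simp only [Sum.elim_inr, poleDenom]
      rw [hth0 _ (mul_ne_zero ht0 (pow_ne_zero 2 (hper t ht0 k).1)) (hpersq t ht0 k)]
      simp
  · rintro ((w | w) | (k | k))
    · exact hasDerivAt_poleDenom hp hp0 hq0 ht0 hv0 w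
    · rw [← poleDenom_inv]
      exact hasDerivAt_poleDenom hp hp0 hq0 ht0 hvi.ne_zero w
    · exact hasDerivAt_poleDenom_period hp hp0 hq0 ht0 hv0 k (hper q hq0 k).1 (hper q hq0 k).2
    · rw [← poleDenom_symm]
      exact hasDerivAt_poleDenom_period hp hp0 ht0 hq0 hv0 k (hper t ht0 k).1 (hper t ht0 k).2
  · rintro ((w | w) | (k | k))
    · exact hd₁0 v hv w
    · exact hd₁0 _ hvi w
    · exact hd₂0 q t hq0 ht0 hqt hv k
    · exact hd₂0 t q ht0 hq0 hqt' hv.symm k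
  · intro z hz h
    simp only [poleDenom, mul_eq_zero, Finset.prod_eq_zero_iff, Finset.mem_univ, true_and] at h
    rcases h with (h | h) | ⟨w, h⟩
    · obtain ⟨k, l, hl⟩ := hperex q hq0 z hz h
      exact ⟨Sum.inr (Sum.inl k), l, hl⟩
    · obtain ⟨k, l, hl⟩ := hperex t ht0 z hz h
      exact ⟨Sum.inr (Sum.inr k), l, hl⟩
    · rcases mul_eq_zero.1 h with h | h
      · obtain ⟨l, hl⟩ := (theta_eq_zero_iff hp hp0 (mul_ne_zero hz (hv0 w))).1 h
        exact ⟨Sum.inl (Sum.inr w), l, by simp [← hl, mul_inv_cancel_right₀ (hv0 w)]⟩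
      · obtain ⟨l, hl⟩ := (theta_eq_zero_iff hp hp0 (mul_ne_zero hz (inv_ne_zero (hv0 w)))).1 h
        exact ⟨Sum.inl (Sum.inl w), l, by simp [← hl, inv_mul_cancel_right₀ (hv0 w)]⟩
  · -- the poles are distinct
    have hinv : ∀ w w', ∀ l : ℤ, v w * v w' ≠ p ^ l := by
      intro w w' l h
      by_cases hw : w = w'
      · subst hw
        exact hv.sq w l (by rw [sq, h])
      · exact hv.mul w w' hw l h
    have hpp : ∀ q : ℂ, q ≠ 0 → ∀ k k', k ≠ k' → ∀ l : ℤ, halfPeriod p k' * (q ^ (1 / 2 : ℂ))⁻¹ ≠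
        p ^ l * (halfPeriod p k * (q ^ (1 / 2 : ℂ))⁻¹) := by
      intro q hq k k' hk l h
      refine halfPeriod_ne_zpow_mul hp hp0 hk l ?_
      rw [← mul_assoc] at h
      exact mul_right_cancel₀ (inv_ne_zero (cpow_half_ne_zero hq)) h
    have hpq : ∀ q t : ℂ, q ≠ 0 → t ≠ 0 → (∀ k : ℤ, t ≠ q * p ^ k) → ∀ k k', ∀ l : ℤ,
        halfPeriod p k' * (t ^ (1 / 2 : ℂ))⁻¹ ≠ p ^ l * (halfPeriod p k * (q ^ (1 / 2 : ℂ))⁻¹) := by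
      intro q t hq ht hqt k k' l h
      obtain ⟨j, hj⟩ := hpersq t ht k'
      refine hthsq q t hq ht hqt k ?_
      refine hth0 _ (mul_ne_zero ht (pow_ne_zero 2 (hper q hq k).1)) ⟨-(l * 2) + j, ?_⟩
      rw [zpow_add₀ hp0, ← hj, h, zpow_neg, zpow_mul]
      simp only [zpow_ofNat]
      have := hpk l
      field_simp
    rintro ((w | w) | (k | k)) ((w' | w') | (k' | k')) hne l <;>
      simp only [Sum.elim_inl, Sum.elim_inr, ne_eq]
    · exact hv.ratio w' w (fun h => hne (by rw [h])) l
    · intro h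
      refine hinv w w' (-l) ?_
      have := hpk l
      have := hv0 w'
      rw [zpow_neg]
      field_simp at h ⊢
      linear_combination -h
    · exact (hcross q t hq0 v hv w k' l).2
    · exact (hcross t q ht0 v hv.symm w k' l).2
    · intro h
      refine hinv w w' l ?_
      rw [h]
      have := hv0 w
      field_simp
    · exact hvi.ratio w' w (fun h => hne (by rw [h])) l
    · exact (hcross q t hq0 _ hvi w k' l).2
    · exact (hcross t q ht0 _ hvi.symm w k' l).2
    · exact (hcross q t hq0 v hv w' k l).1
    · exact (hcross q t hq0 _ hvi w' k l).1
    · exact hpp q hq0 k k' (fun h => hne (by rw [h])) l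
    · exact hpq q t hq0 ht0 hqt k k' l
    · exact (hcross t q ht0 v hv.symm w' k l).1
    · exact (hcross t q ht0 _ hvi.symm w' k l).1
    · exact hpq t q ht0 hq0 hqt' k k' l
    · exact hpp t ht0 k k' (fun h => hne (by rw [h])) l


/-! ### The kernel identity at pole-generic points -/

theorem pm_theta_inv {p : ℂ} (hp : ‖p‖ < 1) {z x : ℂ} (hz : z ≠ 0) (hx : x ≠ 0) :
    pm (fun z => theta z p) z⁻¹ x = (z ^ 2)⁻¹ * pm (fun z => theta z p) z x := by
  simp only [pm]
  rw [show z⁻¹ * x = (z * x⁻¹)⁻¹ by simp [mul_comm], show z⁻¹ * x⁻¹ = (z * x)⁻¹ by simp [mul_comm],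
    theta_inv hp (mul_ne_zero hz (inv_ne_zero hx)), theta_inv hp (mul_ne_zero hz hx)]
  field_simp

/-- Each of the mn factors changes sign, because θ(x/y) = −(x/y) θ(y/x). -/
theorem dualKernel_comm {p : ℂ} (hp : ‖p‖ < 1) {m n : ℕ} {x : Fin m → ℂ} {y : Fin n → ℂ}
    (hx : ∀ i, x i ≠ 0) (hy : ∀ k, y k ≠ 0) :
    dualKernel p x y = (-1) ^ (m * n) * dualKernel p y x := by
  have h : ∀ i k, (x i)⁻¹ * pm (fun z => theta z p) (x i) (y k) =
      (-1) * ((y k)⁻¹ * pm (fun z => theta z p) (y k) (x i)) := by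
    intro i k
    have h1 := hx i
    have h2 := hy k
    simp only [pm]
    rw [show x i * (y k)⁻¹ = (y k * (x i)⁻¹)⁻¹ by simp,
      theta_inv hp (mul_ne_zero h2 (inv_ne_zero h1)), mul_comm (x i) (y k)]
    field_simp
  simp only [dualKernel, h, Finset.prod_mul_distrib, Finset.prod_const, Finset.card_univ,
    Fintype.card_fin]
  rw [← pow_mul, Finset.prod_comm (f := fun i k => pm (fun z => theta z p) (y k) (x i)),
    mul_comm n m, Finset.prod_pow]

/-- The prefactors x_i⁻¹ of the kernel compensate the factors from the inversion of theta arguments,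
so that both signs ε yield the same q^{−n} and a ratio in x_i^ε. -/
theorem dualKernel_shift {p q : ℂ} (hp : ‖p‖ < 1) (hq0 : q ≠ 0) {m n : ℕ} {x : Fin m → ℂ}
    {y : Fin n → ℂ} (hx : ∀ i, x i ≠ 0) (hy : ∀ k, y k ≠ 0) (i : Fin m) {ε : ℤ}
    (hε : ε = 1 ∨ ε = -1)
    (hne : ∀ k, pm (fun z => theta z p) (x i ^ ε) (y k) ≠ 0) :
    dualKernel p (shift q ε i x) y = (q ^ n)⁻¹ * (∏ k, pm (fun z => theta z p) (q * x i ^ ε) (y k) /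
      pm (fun z => theta z p) (x i ^ ε) (y k)) * dualKernel p x y := by
  have hxi := hx i
  have h1 : ∀ k, (q ^ ε * x i)⁻¹ * pm (fun z => theta z p) (q ^ ε * x i) (y k) =
      q⁻¹ * (pm (fun z => theta z p) (q * x i ^ ε) (y k) /
      pm (fun z => theta z p) (x i ^ ε) (y k)) *
        ((x i)⁻¹ * pm (fun z => theta z p) (x i) (y k)) := by
    intro k
    have hk := hne k
    rw [mul_div_assoc', div_mul_eq_mul_div, eq_div_iff hk]
    rcases hε with rfl | rfl
    · simp only [zpow_one, mul_inv]
      ring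
    · simp only [zpow_neg_one]
      have e1 := pm_theta_inv hp (z := q * (x i)⁻¹) (mul_ne_zero hq0 (inv_ne_zero hxi)) (hy k)
      rw [mul_inv, inv_inv] at e1
      rw [e1, pm_theta_inv hp hxi (hy k)]
      field_simp
  have h2 : ∀ j ∈ Finset.univ.erase i, (∏ k, (shift q ε i x j)⁻¹ *
      pm (fun z => theta z p) (shift q ε i x j) (y k)) =
      ∏ k, (x j)⁻¹ * pm (fun z => theta z p) (x j) (y k) := fun j hj => by
    rw [shift, Function.update_of_ne (Finset.ne_of_mem_erase hj)]
  rw [dualKernel, dualKernel, ← Finset.mul_prod_erase _ _ (Finset.mem_univ i),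
    Finset.prod_congr rfl h2, ← Finset.mul_prod_erase _ (fun i => ∏ k, (x i)⁻¹ * _)
    (Finset.mem_univ i), shift, Function.update_self, Finset.prod_congr rfl fun k _ => h1 k,
    Finset.prod_mul_distrib, Finset.prod_mul_distrib, Finset.prod_const, Finset.card_univ,
    Fintype.card_fin, inv_pow]
  ring

theorem prod_erase_eq_prod_ite {V : Type*} [Fintype V] [DecidableEq V] (w : V) (f : V → ℂ) :
    ∏ w' ∈ Finset.univ.erase w, f w' = ∏ w', if w' = w then 1 else f w' := by
  rw [← Finset.filter_ne', Finset.prod_filter]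
  exact Finset.prod_congr rfl fun w' _ => by by_cases h : w' = w <;> simp [h]

theorem prod_erase_inl {m n : ℕ} (i : Fin m) (f : Fin m ⊕ Fin n → ℂ) :
    ∏ w ∈ Finset.univ.erase (Sum.inl i), f w =
      (∏ j ∈ Finset.univ.erase i, f (Sum.inl j)) * ∏ k, f (Sum.inr k) := by
  rw [prod_erase_eq_prod_ite, prod_erase_eq_prod_ite, Fintype.prod_sum_type]
  simp

theorem prod_erase_inr {m n : ℕ} (k : Fin n) (f : Fin m ⊕ Fin n → ℂ) :
    ∏ w ∈ Finset.univ.erase (Sum.inr k), f w =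
      (∏ j ∈ Finset.univ.erase k, f (Sum.inr j)) * ∏ i, f (Sum.inl i) := by
  rw [prod_erase_eq_prod_ite, prod_erase_eq_prod_ite, Fintype.prod_sum_type, mul_comm]
  simp

theorem poleTerm_symm {V : Type*} [Fintype V] [DecidableEq V] (p q t : ℂ) (a : Fin 8 → ℂ)
    (τ v : V → ℂ) (w : V) (z : ℂ) : poleTerm p t q a τ v w z = poleTerm p q t a τ v w z := by
  rw [poleTerm, poleTerm, mul_comm (theta (t * z ^ 2) p)]

theorem poleTerm_eq {V : Type*} [Fintype V] [DecidableEq V] (p q t : ℂ) (a : Fin 8 → ℂ)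
    (τ v : V → ℂ) (w : V) (z : ℂ) (hτ : τ w = t) (ht : theta (t * z ^ 2) p ≠ 0) :
    poleTerm p q t a τ v w z = theta t p * ((∏ s, theta (a s * z) p) /
      (theta (z ^ 2) p * theta (q * z ^ 2) p) * ∏ w' ∈ Finset.univ.erase w,
      pm (fun z => theta z p) (τ w' * z) (v w') / pm (fun z => theta z p) z (v w')) := by
  rw [poleTerm, hτ]
  generalize ∏ s, theta (a s * z) p = A
  generalize (∏ w' ∈ Finset.univ.erase w,
      pm (fun z => theta z p) (τ w' * z) (v w') / pm (fun z => theta z p) z (v w')) = B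
  field_simp

/-- With c_k² = p^j the condition reads qz = p^j z⁻¹, so inversion and quasi-periodicity reduce the
argument qz to z. -/
theorem pm_theta_period {p q : ℂ} (hp : ‖p‖ < 1) (hp0 : p ≠ 0) {z y : ℂ}
    (hz : z ≠ 0) (hy : y ≠ 0) (k : Fin 4) (h : q * z ^ 2 = halfPeriod p k ^ 2) :
    pm (fun z => theta z p) (q * z) y =
      (![q, q, 1, q ^ 2] : Fin 4 → ℂ) k * pm (fun z => theta z p) z y := by
  have h1 : q * z = (p ^ (-(![0, 0, 1, -1] : Fin 4 → ℤ) k) * z)⁻¹ := by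
    rw [mul_inv, zpow_neg, inv_inv, ← halfPeriod_sq, ← h]
    field_simp
  have h2 : p ^ (-(![0, 0, 1, -1] : Fin 4 → ℤ) k) * z ≠ 0 := mul_ne_zero (zpow_ne_zero _ hp0) hz
  rw [h1, pm_theta_inv hp h2 hy]
  rw [halfPeriod_sq] at h
  fin_cases k
  · simp at h ⊢
    exact Or.inl ((eq_inv_of_mul_eq_one_left h).symm)
  · simp at h ⊢
    exact Or.inl ((eq_inv_of_mul_eq_one_left h).symm)
  · simp at h ⊢
    have h3 := pm_theta_mul hp hp0 (z := p⁻¹ * z) (mul_ne_zero (inv_ne_zero hp0) hz) hy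
    rw [mul_inv_cancel_left₀ hp0] at h3
    exact h3.symm
  · simp at h ⊢
    rw [pm_theta_mul hp hp0 hz hy, ← mul_assoc]
    congr 1
    have h4 : q = p⁻¹ * (z ^ 2)⁻¹ := by
      rw [← h]
      field_simp
    rw [h4]
    field_simp

theorem periodSign_mul_theta {p : ℂ} (hp : ‖p‖ < 1) (hp0 : p ≠ 0) {w : ℂ} (hw : w ≠ 0) (k : Fin 4) :
    periodSign p k * theta (w * halfPeriod p k ^ 2) p =
      (![1, 1, w⁻¹, (p ^ 2)⁻¹ * w] : Fin 4 → ℂ) k * theta w p := by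
  rw [halfPeriod_sq]
  fin_cases k
  · simp [periodSign]
  · simp [periodSign]
  · simp [periodSign]
    rw [mul_comm w p, theta_mul_left hp hp0 hw]
    ring
  · simp [periodSign]
    have h := theta_mul_left hp hp0 (z := w * p⁻¹) (mul_ne_zero hw (inv_ne_zero hp0))
    rw [mul_comm, inv_mul_cancel_right₀ hp0] at h
    rw [h]
    field_simp

/-- Identifies a residue at a half period with the k-th summand of A^0. The y-dependent ratios are
the constants of `pm_theta_period`; their n-th powers turn into q^n L_k up to the factor coming from
`periodSign_mul_theta`. For k = 2, 3 this needs t^m r = pqt / q^n, hence the prescribed square root.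
-/
theorem periodTerm_eq {p q t r : ℂ} (hp : ‖p‖ < 1) (hp0 : p ≠ 0) (hq0 : q ≠ 0) (ht0 : t ≠ 0)
    {m n : ℕ} (hr : r * q ^ n * t ^ m = p * q * t) (ht : theta t p ≠ 0)
    (hqt : theta (q⁻¹ * t) p ≠ 0)
    (a : Fin 8 → ℂ) {y : Fin n → ℂ} (hy : ∀ k, y k ≠ 0) (k : Fin 4)
    (hne : ∀ j, pm (fun z => theta z p) (halfPeriod p k * (q ^ (1 / 2 : ℂ))⁻¹) (y j) ≠ 0) (c : ℂ) :
    (∏ s, theta (a s * (halfPeriod p k * (q ^ (1 / 2 : ℂ))⁻¹)) p) / (2 * periodSign p k *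
        theta (t * (halfPeriod p k * (q ^ (1 / 2 : ℂ))⁻¹) ^ 2) p) *
      (c * ∏ j, pm (fun z => theta z p) (q * (halfPeriod p k * (q ^ (1 / 2 : ℂ))⁻¹)) (y j) /
        pm (fun z => theta z p) (halfPeriod p k * (q ^ (1 / 2 : ℂ))⁻¹) (y j)) =
    q ^ n * theta t p * ((1 / 2) * (zeroConst m p q t r k *
    ((∏ s, theta (halfPeriod p k * (q ^ (1 / 2 : ℂ))⁻¹ * a s) p) /
      (theta t p * theta (q⁻¹ * t) p)) * c)) := by
  have hz0 : halfPeriod p k * (q ^ (1 / 2 : ℂ))⁻¹ ≠ 0 :=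
    mul_ne_zero (halfPeriod_ne_zero hp0 k) (inv_ne_zero (cpow_half_ne_zero hq0))
  have hzq : (halfPeriod p k * (q ^ (1 / 2 : ℂ))⁻¹) ^ 2 = q⁻¹ * halfPeriod p k ^ 2 := by
    rw [mul_pow, inv_pow, cpow_half_sq, mul_comm]
  have e1 : ∀ j, pm (fun z => theta z p) (q * (halfPeriod p k * (q ^ (1 / 2 : ℂ))⁻¹)) (y j) /
        pm (fun z => theta z p) (halfPeriod p k * (q ^ (1 / 2 : ℂ))⁻¹) (y j) =
      (![q, q, 1, q ^ 2] : Fin 4 → ℂ) k := fun j => by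
    rw [pm_theta_period hp hp0 hz0 (hy j) k (by rw [hzq, mul_inv_cancel_left₀ hq0]),
      mul_div_cancel_right₀ _ (hne j)]
  have e2 := periodSign_mul_theta hp hp0 (w := q⁻¹ * t) (mul_ne_zero (inv_ne_zero hq0) ht0) k
  rw [show q⁻¹ * t * halfPeriod p k ^ 2 = t * (halfPeriod p k * (q ^ (1 / 2 : ℂ))⁻¹) ^ 2 by
    rw [hzq]; ring] at e2
  have e3 : (![q, q, 1, q ^ 2] : Fin 4 → ℂ) k ^ n = q ^ n * zeroConst m p q t r k *
      (![1, 1, (q⁻¹ * t)⁻¹, (p ^ 2)⁻¹ * (q⁻¹ * t)] : Fin 4 → ℂ) k := by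
    have hqn : q ^ n ≠ 0 := pow_ne_zero _ hq0
    have htm : t ^ m ≠ 0 := pow_ne_zero _ ht0
    have hr' : t ^ m * r = p * q * t / q ^ n := by
      rw [eq_div_iff hqn, ← hr]; ring
    fin_cases k
    · simp [zeroConst]
    · simp [zeroConst]
    · simp only [zeroConst, Fin.reduceFinMk, Matrix.cons_val]
      rw [mul_assoc _ (t ^ m), hr']
      field_simp
      simp
    · simp only [zeroConst, Fin.reduceFinMk, Matrix.cons_val]
      rw [mul_assoc _ (t ^ m), hr']
      field_simp
      rw [← pow_mul, ← pow_mul, mul_comm]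
  rw [Finset.prod_congr rfl fun j _ => e1 j, Finset.prod_const, Finset.card_univ, Fintype.card_fin,
    mul_assoc 2, e2, e3]
  simp only [mul_comm _ (a _)]
  have hg : (![1, 1, (q⁻¹ * t)⁻¹, (p ^ 2)⁻¹ * (q⁻¹ * t)] : Fin 4 → ℂ) k ≠ 0 := by
    fin_cases k <;> simp [hp0, hq0, ht0]
  generalize (![1, 1, (q⁻¹ * t)⁻¹, (p ^ 2)⁻¹ * (q⁻¹ * t)] : Fin 4 → ℂ) k = g at *
  generalize theta (q⁻¹ * t) p = θ at *
  generalize (∏ s, theta (a s * (halfPeriod p k * (q ^ (1 / 2 : ℂ))⁻¹)) p) = A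
  field_simp


theorem pm_theta_period_ne_zero {p q : ℂ} (hp : ‖p‖ < 1) (hp0 : p ≠ 0) (hq0 : q ≠ 0) {y : ℂ}
    (hy : y ≠ 0) (h1 : ∀ k : ℤ, q * y ^ 2 ≠ p ^ k) (h2 : ∀ k : ℤ, y ^ 2 ≠ q * p ^ k) (k : Fin 4) :
    pm (fun z => theta z p) (halfPeriod p k * (q ^ (1 / 2 : ℂ))⁻¹) y ≠ 0 := by
  have hz0 : halfPeriod p k * (q ^ (1 / 2 : ℂ))⁻¹ ≠ 0 :=
    mul_ne_zero (halfPeriod_ne_zero hp0 k) (inv_ne_zero (cpow_half_ne_zero hq0))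
  have hzq : (halfPeriod p k * (q ^ (1 / 2 : ℂ))⁻¹) ^ 2 =
      q⁻¹ * p ^ (![0, 0, 1, -1] : Fin 4 → ℤ) k := by
    rw [mul_pow, inv_pow, cpow_half_sq, mul_comm, halfPeriod_sq]
  generalize (![0, 0, 1, -1] : Fin 4 → ℤ) k = j at hzq
  refine pm_theta_ne_zero hp hp0 hz0 hy (fun l h => h2 (l * 2 - j) ?_) fun l h =>
    h1 (j - l * 2) ?_
  · have e := congrArg (· ^ 2) h
    simp only [mul_pow, hzq] at e
    have := zpow_ne_zero j hp0
    rw [zpow_sub₀ hp0, zpow_mul, zpow_ofNat, ← e]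
    field_simp
  · rw [h] at hzq
    rw [zpow_sub₀ hp0, zpow_mul, zpow_ofNat, eq_div_iff (pow_ne_zero 2 (zpow_ne_zero l hp0))]
    have : q * (q⁻¹ * p ^ j) = p ^ j := mul_inv_cancel_left₀ hq0 _
    linear_combination q * hzq + this

theorem shift_ne_zero {m : ℕ} {q : ℂ} (hq0 : q ≠ 0) (ε : ℤ) (i : Fin m) {x : Fin m → ℂ}
    (hx : ∀ j, x j ≠ 0) (j : Fin m) : shift q ε i x j ≠ 0 := by
  by_cases h : j = i
  · subst h
    simp [shift, hx, zpow_ne_zero ε hq0]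
  · simp [shift, Function.update_of_ne h, hx]

theorem zpow_eq_of_eq_or_inv {x : ℂ} {P : ℂ → Prop} (h1 : P x) (h2 : P x⁻¹) {ε : ℤ}
    (hε : ε = 1 ∨ ε = -1) : P (x ^ ε) := by
  rcases hε with rfl | rfl
  · simpa using h1
  · simpa using h2

/-- The action of the van Diejen operator on the kernel function, written as a sum of residues. -/
theorem vanDiejen_dualKernel {p q t r : ℂ} (hp : ‖p‖ < 1) (hp0 : p ≠ 0) (hq0 : q ≠ 0)
    (ht0 : t ≠ 0) {m n : ℕ} (hr : r * q ^ n * t ^ m = p * q * t) (ht : theta t p ≠ 0)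
    (hqt : theta (q⁻¹ * t) p ≠ 0) (a : Fin 8 → ℂ) {x : Fin m → ℂ} {y : Fin n → ℂ}
    (hx : ∀ i, x i ≠ 0) (hy : ∀ k, y k ≠ 0)
    (hxy : ∀ i k, pm (fun z => theta z p) (x i) (y k) ≠ 0)
    (hqy : ∀ k j, pm (fun z => theta z p) (halfPeriod p k * (q ^ (1 / 2 : ℂ))⁻¹) (y j) ≠ 0)
    (T : Fin m → ℂ → ℂ) (hT : ∀ i z, T i z = theta t p * ((∏ s, theta (a s * z) p) /
      (theta (z ^ 2) p * theta (q * z ^ 2) p) * ((∏ j ∈ Finset.univ.erase i,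
      pm (fun z => theta z p) (t * z) (x j) / pm (fun z => theta z p) z (x j)) *
      ∏ k, pm (fun z => theta z p) (q * z) (y k) / pm (fun z => theta z p) z (y k)))) :
    q ^ n * theta t p * vanDiejen p q t a r (fun x => dualKernel p x y) x =
      (∑ i, (T i (x i) + T i (x i)⁻¹) + ∑ k,
        (∏ s, theta (a s * (halfPeriod p k * (q ^ (1 / 2 : ℂ))⁻¹)) p) / (2 * periodSign p k *
        theta (t * (halfPeriod p k * (q ^ (1 / 2 : ℂ))⁻¹) ^ 2) p) *
      ((∏ i, pm (fun z => theta z p) (t * (halfPeriod p k * (q ^ (1 / 2 : ℂ))⁻¹)) (x i) /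
        pm (fun z => theta z p) (halfPeriod p k * (q ^ (1 / 2 : ℂ))⁻¹) (x i)) *
        ∏ j, pm (fun z => theta z p) (q * (halfPeriod p k * (q ^ (1 / 2 : ℂ))⁻¹)) (y j) /
        pm (fun z => theta z p) (halfPeriod p k * (q ^ (1 / 2 : ℂ))⁻¹) (y j))) *
      dualKernel p x y := by
  have hshift : ∀ i, ∀ ε : ℤ, ε = 1 ∨ ε = -1 →
      q ^ n * theta t p * (shiftCoeff p q t a ε i x * dualKernel p (shift q ε i x) y) =
      T i (x i ^ ε) * dualKernel p x y := by
    intro i ε hε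
    have hne : ∀ k, pm (fun z => theta z p) (x i ^ ε) (y k) ≠ 0 := fun k => by
      refine zpow_eq_of_eq_or_inv (P := fun z => pm (fun z => theta z p) z (y k) ≠ 0) (hxy i k) ?_ hε
      rw [pm_theta_inv hp (hx i) (hy k)]
      exact mul_ne_zero (inv_ne_zero (pow_ne_zero 2 (hx i))) (hxy i k)
    rw [dualKernel_shift hp hq0 hx hy i hε hne, hT, shiftCoeff]
    have := pow_ne_zero n hq0
    generalize (∏ s, theta (a s * x i ^ ε) p) / (theta ((x i ^ ε) ^ 2) p *
      theta (q * (x i ^ ε) ^ 2) p) = A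
    generalize (∏ j ∈ Finset.univ.erase i, pm (fun z => theta z p) (t * x i ^ ε) (x j) /
      pm (fun z => theta z p) (x i ^ ε) (x j)) = B
    generalize (∏ k, pm (fun z => theta z p) (q * x i ^ ε) (y k) /
      pm (fun z => theta z p) (x i ^ ε) (y k)) = C
    field_simp
  rw [vanDiejen, mul_add, add_mul, add_comm]
  congr 1
  · rw [Finset.mul_sum, Finset.sum_mul]
    refine Finset.sum_congr rfl fun i _ => ?_
    rw [Finset.sum_pair (by decide), mul_add, hshift i 1 (Or.inl rfl), hshift i (-1) (Or.inr rfl),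
      zpow_one, zpow_neg_one, add_mul]
  · rw [← mul_assoc]
    congr 1
    rw [zeroCoeff, Finset.mul_sum, Finset.mul_sum]
    refine Finset.sum_congr rfl fun k _ => ?_
    rw [periodTerm_eq hp hp0 hq0 ht0 hr ht hqt a hy k (hqy k)]
    simp only [mul_comm t]

theorem theta_inv_mul_symm_ne_zero {p q t : ℂ} (hp : ‖p‖ < 1) (hq0 : q ≠ 0) (ht0 : t ≠ 0)
    (h : theta (q⁻¹ * t) p ≠ 0) : theta (t⁻¹ * q) p ≠ 0 := by
  have h0 : q⁻¹ * t ≠ 0 := mul_ne_zero (inv_ne_zero hq0) ht0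
  rw [show t⁻¹ * q = (q⁻¹ * t)⁻¹ by simp [mul_comm], theta_inv hp h0]
  exact mul_ne_zero (neg_ne_zero.2 (inv_ne_zero h0)) h

/-- The residue sum is used with v = (x, y), τ = t on the x-variables and τ = q on the y-variables.
At z = x_i^{±1} the factor θ(τ z²) cancels θ(t z²), which leaves θ(t) times a shift coefficient of
D_x times the ratio of kernels; the y-variables give D_y by the symmetry of q and t. -/
theorem kernel_identity_of_poleGeneric {p q t r : ℂ} (hp : ‖p‖ < 1) (hp0 : p ≠ 0) (hq0 : q ≠ 0)
    (ht0 : t ≠ 0) {m n : ℕ} (hr : r * q ^ n * t ^ m = p * q * t) (ht : theta t p ≠ 0)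
    (hq : theta q p ≠ 0) (hqt : theta (q⁻¹ * t) p ≠ 0) {a : Fin 8 → ℂ} (ha : ∀ s, a s ≠ 0)
    (hbal : (∏ s, a s) * q ^ (2 * n) * t ^ (2 * m) = p ^ 2 * q ^ 2 * t ^ 2)
    {x : Fin m → ℂ} {y : Fin n → ℂ} (hv : PoleGeneric p q t (Sum.elim x y)) :
    q ^ n * theta t p * vanDiejen p q t a r (fun x => dualKernel p x y) x +
      t ^ m * theta q p * vanDiejen p t q a r (fun y => dualKernel p x y) y = 0 := by
  have hx : ∀ i, x i ≠ 0 := fun i => hv.ne_zero (Sum.inl i)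
  have hy : ∀ k, y k ≠ 0 := fun k => hv.ne_zero (Sum.inr k)
  have hxy : ∀ i k, pm (fun z => theta z p) (x i) (y k) ≠ 0 := fun i k =>
    pm_theta_ne_zero hp hp0 (hx i) (hy k) (hv.mul (Sum.inl i) (Sum.inr k) (by simp))
      (hv.ratio (Sum.inl i) (Sum.inr k) (by simp))
  have hyx : ∀ k i, pm (fun z => theta z p) (y k) (x i) ≠ 0 := fun k i =>
    pm_theta_ne_zero hp hp0 (hy k) (hx i) (hv.mul (Sum.inr k) (Sum.inl i) (by simp))
      (hv.ratio (Sum.inr k) (Sum.inl i) (by simp))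
  have hqt' : ∀ k : ℤ, t ≠ q * p ^ k := fun k h => hqt <|
    (theta_eq_zero_iff hp hp0 (mul_ne_zero (inv_ne_zero hq0) ht0)).2
      ⟨k, by rw [h, inv_mul_cancel_left₀ hq0]⟩
  have hres := sum_poleTerm_eq_zero hp hp0 hq0 ht0 hqt' ha
    (τ := Sum.elim (fun _ : Fin m => t) (fun _ : Fin n => q)) (v := Sum.elim x y)
    (by rintro (i | k) <;> simpa) (by
      rw [Fintype.prod_sum_type, ← hbal]
      simp only [Sum.elim_inl, Sum.elim_inr, Finset.prod_const, Finset.card_univ, Fintype.card_fin]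
      ring) hv
  have h1 := vanDiejen_dualKernel hp hp0 hq0 ht0 hr ht hqt a hx hy hxy
    (fun k j => pm_theta_period_ne_zero hp hp0 hq0 (hy j) (hv.left (Sum.inr j))
      (hv.left' (Sum.inr j)) k) _ fun i z => rfl
  have h2 := vanDiejen_dualKernel hp hp0 ht0 hq0 (m := n) (n := m) (r := r)
    (by rw [mul_right_comm, hr, mul_right_comm]) hq
    (theta_inv_mul_symm_ne_zero hp hq0 ht0 hqt) a hy hx hyx
    (fun k j => pm_theta_period_ne_zero hp hp0 ht0 (hx j) (hv.right (Sum.inl j))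
      (hv.right' (Sum.inl j)) k) _ fun i z => rfl
  have h3 : vanDiejen p t q a r (fun y => dualKernel p x y) y =
      (-1) ^ (m * n) * vanDiejen p t q a r (fun y => dualKernel p y x) y := by
    have hs : ∀ ε : ℤ, ∀ k, dualKernel p x (shift t ε k y) =
        (-1) ^ (m * n) * dualKernel p (shift t ε k y) x := fun ε k =>
      dualKernel_comm hp hx (shift_ne_zero ht0 ε k hy)
    simp only [vanDiejen, hs, dualKernel_comm hp hx hy, mul_add, Finset.mul_sum]
    congr 1
    · ring
    · exact Finset.sum_congr rfl fun k _ => Finset.sum_congr rfl fun ε _ => by ring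
  rw [h3, mul_left_comm, h1, h2, mul_left_comm, ← dualKernel_comm hp hx hy, ← add_mul]
  refine mul_eq_zero_of_left ?_ _
  rw [← hres, Fintype.sum_sum_type]
  have e1 : ∀ i, ∀ z, theta (t * z ^ 2) p ≠ 0 → poleTerm p q t a
      (Sum.elim (fun _ : Fin m => t) (fun _ : Fin n => q)) (Sum.elim x y) (Sum.inl i) z =
      theta t p * ((∏ s, theta (a s * z) p) /
      (theta (z ^ 2) p * theta (q * z ^ 2) p) * ((∏ j ∈ Finset.univ.erase i,
      pm (fun z => theta z p) (t * z) (x j) / pm (fun z => theta z p) z (x j)) *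
      ∏ k, pm (fun z => theta z p) (q * z) (y k) / pm (fun z => theta z p) z (y k))) := by
    intro i z hz
    rw [poleTerm_eq p q t a _ _ _ z rfl hz, prod_erase_inl]
    rfl
  have e2 : ∀ k, ∀ z, theta (q * z ^ 2) p ≠ 0 → poleTerm p q t a
      (Sum.elim (fun _ : Fin m => t) (fun _ : Fin n => q)) (Sum.elim x y) (Sum.inr k) z =
      theta q p * ((∏ s, theta (a s * z) p) /
      (theta (z ^ 2) p * theta (t * z ^ 2) p) * ((∏ j ∈ Finset.univ.erase k,
      pm (fun z => theta z p) (q * z) (y j) / pm (fun z => theta z p) z (y j)) *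
      ∏ i, pm (fun z => theta z p) (t * z) (x i) / pm (fun z => theta z p) z (x i))) := by
    intro k z hz
    rw [← poleTerm_symm, poleTerm_eq p t q a _ _ _ z rfl hz, prod_erase_inr]
    rfl
  have hth : ∀ t z : ℂ, t ≠ 0 → z ≠ 0 → (∀ k : ℤ, t * z ^ 2 ≠ p ^ k) → theta (t * z ^ 2) p ≠ 0 :=
    fun t z ht hz h => theta_ne_zero hp hp0 (mul_ne_zero ht (pow_ne_zero 2 hz)) h
  have hvi := hv.inv hp0
  rw [add_add_add_comm]
  congr 2
  · refine Finset.sum_congr rfl fun i _ => ?_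
    rw [Sum.elim_inl, e1 i _ (hth t _ ht0 (hx i) (hv.right (Sum.inl i))),
      e1 i _ (hth t _ ht0 (inv_ne_zero (hx i)) (hvi.right (Sum.inl i)))]
  · refine Finset.sum_congr rfl fun k _ => ?_
    rw [Sum.elim_inr, e2 k _ (hth q _ hq0 (hy k) (hv.left (Sum.inr k))),
      e2 k _ (hth q _ hq0 (inv_ne_zero (hy k)) (hvi.left (Sum.inr k)))]
  · refine Finset.sum_congr rfl fun k _ => ?_
    rw [periodTerm, Fintype.prod_sum_type]
    rfl
  · refine Finset.sum_congr rfl fun k _ => ?_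
    rw [periodTerm, Fintype.prod_sum_type, mul_comm (∏ i, _) (∏ i, _)]
    rfl


/-! ### Extension of the kernel identity to all generic x by continuity -/

theorem continuousAt_theta_comp {X : Type*} [TopologicalSpace X] {p : ℂ} (hp : ‖p‖ < 1)
    {f : X → ℂ} {x : X} (hf : ContinuousAt f x) (h0 : f x ≠ 0) :
    ContinuousAt (fun x => theta (f x) p) x :=
  ContinuousAt.comp (g := fun z => theta z p) (differentiableAt_theta hp h0).continuousAt hf

theorem continuousAt_pm_theta {X : Type*} [TopologicalSpace X] {p : ℂ} (hp : ‖p‖ < 1)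
    {f g : X → ℂ} {x : X} (hf : ContinuousAt f x) (hg : ContinuousAt g x) (h0 : f x ≠ 0)
    (h1 : g x ≠ 0) : ContinuousAt (fun x => pm (fun z => theta z p) (f x) (g x)) x :=
  (continuousAt_theta_comp hp (hf.mul hg) (mul_ne_zero h0 h1)).mul
    (continuousAt_theta_comp hp (hf.mul (hg.inv₀ h1)) (mul_ne_zero h0 (inv_ne_zero h1)))

theorem continuousAt_coord {m : ℕ} (i : Fin m) (x : Fin m → ℂ) :
    ContinuousAt (fun x : Fin m → ℂ => x i) x := (continuous_apply i).continuousAt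

theorem continuousAt_dualKernel {p : ℂ} (hp : ‖p‖ < 1) {X : Type*} [TopologicalSpace X] {m n : ℕ}
    {x : X → Fin m → ℂ} {y : X → Fin n → ℂ} {z : X} (hx : ContinuousAt x z)
    (hy : ContinuousAt y z) (hx0 : ∀ i, x z i ≠ 0) (hy0 : ∀ k, y z k ≠ 0) :
    ContinuousAt (fun z => dualKernel p (x z) (y z)) z := by
  have hxi : ∀ i, ContinuousAt (fun z => x z i) z := fun i =>
    (continuous_apply i).continuousAt.comp hx
  have hyk : ∀ k, ContinuousAt (fun z => y z k) z := fun k =>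
    (continuous_apply k).continuousAt.comp hy
  exact tendsto_finsetProd _ fun i _ => tendsto_finsetProd _ fun k _ =>
    ((hxi i).inv₀ (hx0 i)).mul (continuousAt_pm_theta hp (hxi i) (hyk k) (hx0 i) (hy0 k))

theorem continuousAt_zeroCoeff {p q : ℂ} (hp : ‖p‖ < 1) (hp0 : p ≠ 0) (hq0 : q ≠ 0) {t : ℂ}
    (ht0 : t ≠ 0) {m : ℕ} (a : Fin 8 → ℂ) (r : ℂ) {x : Fin m → ℂ} (hx : ∀ i, x i ≠ 0)
    (h1 : ∀ i, ∀ k : ℤ, q * x i ^ 2 ≠ p ^ k) (h2 : ∀ i, ∀ k : ℤ, x i ^ 2 ≠ q * p ^ k) :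
    ContinuousAt (zeroCoeff p q t a r) x := by
  have hz0 : ∀ k, halfPeriod p k * (q ^ (1 / 2 : ℂ))⁻¹ ≠ 0 := fun k =>
    mul_ne_zero (halfPeriod_ne_zero hp0 k) (inv_ne_zero (cpow_half_ne_zero hq0))
  refine continuousAt_const.mul (tendsto_finsetSum _ fun k _ => continuousAt_const.mul
    (tendsto_finsetProd _ fun j _ => ?_))
  exact (continuousAt_pm_theta hp continuousAt_const (continuousAt_coord j x)
    (mul_ne_zero (hz0 k) ht0) (hx j)).div (continuousAt_pm_theta hp continuousAt_const
    (continuousAt_coord j x) (hz0 k) (hx j))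
    (pm_theta_period_ne_zero hp hp0 hq0 (hx j) (h1 j) (h2 j) k)

theorem Generic.coeff_ne_zero {p q : ℂ} (hp : ‖p‖ < 1) (hp0 : p ≠ 0) (hq0 : q ≠ 0) {m : ℕ}
    {x : Fin m → ℂ} (h : Generic p q x) (i : Fin m) {ε : ℤ} (hε : ε = 1 ∨ ε = -1) :
    theta ((x i ^ ε) ^ 2) p ≠ 0 ∧ theta (q * (x i ^ ε) ^ 2) p ≠ 0 ∧
      ∀ j, j ≠ i → pm (fun z => theta z p) (x i ^ ε) (x j) ≠ 0 := by
  obtain ⟨h0, h1, h2⟩ := h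
  have hi := h0 i
  refine zpow_eq_of_eq_or_inv (P := fun z => theta (z ^ 2) p ≠ 0 ∧ theta (q * z ^ 2) p ≠ 0 ∧
      ∀ j, j ≠ i → pm (fun z => theta z p) z (x j) ≠ 0) ⟨?_, ?_, fun j hj => ?_⟩
      ⟨?_, ?_, fun j hj => ?_⟩ hε
  · exact theta_ne_zero hp hp0 (pow_ne_zero 2 hi) fun k => (h1 i k).1
  · exact theta_ne_zero hp hp0 (mul_ne_zero hq0 (pow_ne_zero 2 hi)) fun k => (h1 i k).2.1
  · exact pm_theta_ne_zero hp hp0 hi (h0 j) (fun k => (h2 i j hj.symm k).1)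
      fun k => (h2 i j hj.symm k).2
  · refine theta_ne_zero hp hp0 (pow_ne_zero 2 (inv_ne_zero hi)) fun k e => (h1 i (-k)).1 ?_
    rw [zpow_neg, ← e, inv_pow, inv_inv]
  · refine theta_ne_zero hp hp0 (mul_ne_zero hq0 (pow_ne_zero 2 (inv_ne_zero hi)))
      fun k e => (h1 i (-k)).2.2 ?_
    rw [zpow_neg, ← e]
    field_simp
  · rw [pm_theta_inv hp hi (h0 j)]
    exact mul_ne_zero (inv_ne_zero (pow_ne_zero 2 hi)) (pm_theta_ne_zero hp hp0 hi (h0 j)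
      (fun k => (h2 i j hj.symm k).1) fun k => (h2 i j hj.symm k).2)

theorem continuousAt_shiftCoeff {p q : ℂ} (hp : ‖p‖ < 1) (hp0 : p ≠ 0) (hq0 : q ≠ 0) {t : ℂ}
    (ht0 : t ≠ 0) {m : ℕ} {a : Fin 8 → ℂ} (ha : ∀ s, a s ≠ 0) {x : Fin m → ℂ}
    (h : Generic p q x) (i : Fin m) {ε : ℤ} (hε : ε = 1 ∨ ε = -1) :
    ContinuousAt (shiftCoeff p q t a ε i) x := by
  obtain ⟨h1, h2, h3⟩ := h.coeff_ne_zero hp hp0 hq0 i hε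
  have hx := h.1
  have hi : ContinuousAt (fun x : Fin m → ℂ => x i ^ ε) x :=
    (continuousAt_coord i x).zpow₀ ε (Or.inl (hx i))
  have hi0 : x i ^ ε ≠ 0 := zpow_ne_zero ε (hx i)
  refine ContinuousAt.mul (ContinuousAt.div (tendsto_finsetProd _ fun s _ =>
    continuousAt_theta_comp hp (continuousAt_const.mul hi) (mul_ne_zero (ha s) hi0))
    ((continuousAt_theta_comp hp (hi.pow 2) (pow_ne_zero 2 hi0)).mul
      (continuousAt_theta_comp hp (continuousAt_const.mul (hi.pow 2))
        (mul_ne_zero hq0 (pow_ne_zero 2 hi0)))) (mul_ne_zero h1 h2))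
    (tendsto_finsetProd _ fun j hj => ?_)
  exact (continuousAt_pm_theta hp (continuousAt_const.mul hi) (continuousAt_coord j x)
    (mul_ne_zero ht0 hi0) (hx j)).div (continuousAt_pm_theta hp hi (continuousAt_coord j x)
    hi0 (hx j)) (h3 j (Finset.ne_of_mem_erase hj))

theorem continuous_shift {m : ℕ} (q : ℂ) (ε : ℤ) (i : Fin m) : Continuous (shift q ε i) :=
  continuous_id.update i (continuous_const.mul (continuous_apply i))

theorem ae_mul_exp_ne {c d : ℂ} (hc : c ≠ 0) {l : ℕ} (hl : l ≠ 0) :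
    ∀ᵐ s : ℝ, c * (Real.exp s : ℂ) ^ l ≠ d := by
  rw [ae_iff]
  simp only [not_not]
  refine Set.Subsingleton.measure_zero (fun s hs s' hs' => ?_) _
  have h := mul_left_cancel₀ hc ((show _ = _ from hs).trans hs'.symm)
  have h' : Real.exp s ^ l = Real.exp s' ^ l := by exact_mod_cast h
  exact Real.exp_injective ((pow_left_inj₀ (Real.exp_pos s).le (Real.exp_pos s').le hl).1 h')

/-- Coincidences such as x_i y_k ∈ p^ℤ or t x_i² ∈ p^ℤ are poles of the residue terms only, not of
the operators. Replacing x by e^s x with s real avoids them for almost every s, hence on a dense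
set, and the left side is continuous at s = 0. -/
theorem kernel_identity {p q t r : ℂ} (hp : ‖p‖ < 1) (hp0 : p ≠ 0) (hq0 : q ≠ 0)
    (ht0 : t ≠ 0) {m n : ℕ} (hr : r * q ^ n * t ^ m = p * q * t) (ht : theta t p ≠ 0)
    (hq : theta q p ≠ 0) (hqt : theta (q⁻¹ * t) p ≠ 0) {a : Fin 8 → ℂ} (ha : ∀ s, a s ≠ 0)
    (hbal : (∏ s, a s) * q ^ (2 * n) * t ^ (2 * m) = p ^ 2 * q ^ 2 * t ^ 2)
    {x : Fin m → ℂ} {y : Fin n → ℂ} (hx : Generic p q x) (hy : PoleGeneric p q t y) :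
    q ^ n * theta t p * vanDiejen p q t a r (fun x => dualKernel p x y) x +
      t ^ m * theta q p * vanDiejen p t q a r (fun y => dualKernel p x y) y = 0 := by
  set X : ℝ → Fin m → ℂ := fun s i => x i * (Real.exp s : ℂ) with hX
  have hX0 : X 0 = x := by funext i; simp [hX]
  have hXc : Continuous X := by fun_prop
  obtain ⟨hx0, hx1, hx2⟩ := id hx
  have hpk : ∀ k : ℤ, p ^ k ≠ 0 := fun k => zpow_ne_zero k hp0
  have hgen : ∀ᵐ s : ℝ, PoleGeneric p q t (Sum.elim (X s) y) := by
    have e1 : ∀ᵐ s : ℝ, ∀ i, ∀ k : ℤ, (x i ^ 2 * (Real.exp s : ℂ) ^ 2 ≠ p ^ k ∧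
        (q * x i ^ 2) * (Real.exp s : ℂ) ^ 2 ≠ p ^ k ∧
        x i ^ 2 * (Real.exp s : ℂ) ^ 2 ≠ q * p ^ k) ∧
        (t * x i ^ 2) * (Real.exp s : ℂ) ^ 2 ≠ p ^ k ∧
        x i ^ 2 * (Real.exp s : ℂ) ^ 2 ≠ t * p ^ k := by
      refine ae_all_iff.2 fun i => ae_all_iff.2 fun k => ?_
      have h2 := pow_ne_zero 2 (hx0 i)
      filter_upwards [ae_mul_exp_ne (d := p ^ k) h2 two_ne_zero,
        ae_mul_exp_ne (d := p ^ k) (mul_ne_zero hq0 h2) two_ne_zero,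
        ae_mul_exp_ne (d := q * p ^ k) h2 two_ne_zero,
        ae_mul_exp_ne (d := p ^ k) (mul_ne_zero ht0 h2) two_ne_zero,
        ae_mul_exp_ne (d := t * p ^ k) h2 two_ne_zero] with s h1 h2 h3 h4 h5
      exact ⟨⟨h1, h2, h3⟩, h4, h5⟩
    have e2 : ∀ᵐ s : ℝ, ∀ i j, ∀ k : ℤ, (x i * x j) * (Real.exp s : ℂ) ^ 2 ≠ p ^ k :=
      ae_all_iff.2 fun i => ae_all_iff.2 fun j => ae_all_iff.2 fun k =>
        ae_mul_exp_ne (mul_ne_zero (hx0 i) (hx0 j)) two_ne_zero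
    have e3 : ∀ᵐ s : ℝ, ∀ i j, ∀ k : ℤ, (x i * y j) * (Real.exp s : ℂ) ^ 1 ≠ p ^ k ∧
        x i * (Real.exp s : ℂ) ^ 1 ≠ p ^ k * y j ∧
        (p ^ k * x i) * (Real.exp s : ℂ) ^ 1 ≠ y j := by
      refine ae_all_iff.2 fun i => ae_all_iff.2 fun j => ae_all_iff.2 fun k => ?_
      filter_upwards [ae_mul_exp_ne (d := p ^ k) (mul_ne_zero (hx0 i) (hy.ne_zero j)) one_ne_zero,
        ae_mul_exp_ne (d := p ^ k * y j) (hx0 i) one_ne_zero,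
        ae_mul_exp_ne (d := y j) (mul_ne_zero (hpk k) (hx0 i)) one_ne_zero] with s h1 h2 h3
      exact ⟨h1, h2, h3⟩
    filter_upwards [e1, e2, e3] with s h1 h2 h3
    have hs : (Real.exp s : ℂ) ≠ 0 := by exact_mod_cast (Real.exp_pos s).ne'
    simp only [pow_one] at h3
    refine ⟨?_, ?_, ?_, ?_, ?_, ?_, ?_, ?_⟩
    · rintro (i | j)
      · exact mul_ne_zero (hx0 i) hs
      · exact hy.ne_zero j
    · rintro (i | j) k
      · simpa [hX, mul_pow] using (h1 i k).1.1
      · exact hy.sq j k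
    · rintro (i | j) k
      · simpa [hX, mul_pow, mul_assoc] using (h1 i k).1.2.1
      · exact hy.left j k
    · rintro (i | j) k
      · simpa [hX, mul_pow] using (h1 i k).1.2.2
      · exact hy.left' j k
    · rintro (i | j) k
      · simpa [hX, mul_pow, mul_assoc] using (h1 i k).2.1
      · exact hy.right j k
    · rintro (i | j) k
      · simpa [hX, mul_pow] using (h1 i k).2.2
      · exact hy.right' j k
    · rintro (i | j) (i' | j') hne k h
      · exact h2 i i' k (by rw [← h]; simp only [hX, Sum.elim_inl]; ring)
      · exact (h3 i j' k).1 (by rw [← h]; simp only [hX, Sum.elim_inl, Sum.elim_inr]; ring)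
      · exact (h3 i' j k).1 (by rw [← h]; simp only [hX, Sum.elim_inl, Sum.elim_inr]; ring)
      · exact hy.mul j j' (fun e => hne (by rw [e])) k h
    · rintro (i | j) (i' | j') hne k h
      · refine (hx2 i i' (fun e => hne (by rw [e])) k).2 (mul_right_cancel₀ hs ?_)
        rw [mul_assoc]
        exact h
      · exact (h3 i j' k).2.1 h
      · refine (h3 i' j k).2.2 ?_
        rw [mul_assoc]
        exact h.symm
      · exact hy.ratio j j' (fun e => hne (by rw [e])) k h
  set G : ℝ → ℂ := fun s =>
    q ^ n * theta t p * vanDiejen p q t a r (fun x => dualKernel p x y) (X s) +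
      t ^ m * theta q p * vanDiejen p t q a r (fun y => dualKernel p (X s) y) y with hG
  have hGc : ContinuousAt G 0 := by
    have hc : ∀ f : (Fin m → ℂ) → ℂ, ContinuousAt f x → ContinuousAt (fun s => f (X s)) 0 :=
      fun f hf => ContinuousAt.comp (by rw [hX0]; exact hf) hXc.continuousAt
    have hx0' : ∀ i, X 0 i ≠ 0 := by rw [hX0]; exact hx0
    refine (continuousAt_const.mul ?_).add (continuousAt_const.mul ?_)
    · refine ContinuousAt.add (ContinuousAt.mul (hc _ (continuousAt_zeroCoeff hp hp0 hq0 ht0 a r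
        hx0 (fun i k => (hx1 i k).2.1) fun i k => (hx1 i k).2.2))
        (continuousAt_dualKernel hp hXc.continuousAt continuousAt_const hx0' hy.ne_zero))
        (tendsto_finsetSum _ fun i _ => tendsto_finsetSum _ fun ε hε => ?_)
      refine ContinuousAt.mul (hc _ (continuousAt_shiftCoeff hp hp0 hq0 ht0 ha hx i
        (by simpa using hε))) (continuousAt_dualKernel hp
        ((continuous_shift q ε i).comp hXc).continuousAt continuousAt_const
        (shift_ne_zero hq0 ε i hx0') hy.ne_zero)
    · refine ContinuousAt.add (continuousAt_const.mul (continuousAt_dualKernel hp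
        hXc.continuousAt continuousAt_const hx0' hy.ne_zero))
        (tendsto_finsetSum _ fun k _ => tendsto_finsetSum _ fun ε hε => ?_)
      exact continuousAt_const.mul (continuousAt_dualKernel hp hXc.continuousAt
        continuousAt_const hx0' (shift_ne_zero ht0 ε k hy.ne_zero))
  have hfreq : ∃ᶠ s in 𝓝 (0 : ℝ), G s = 0 := by
    have hd := Measure.dense_of_ae hgen
    refine (mem_closure_iff_frequently.1 (hd 0)).mono fun s hs => ?_
    exact kernel_identity_of_poleGeneric hp hp0 hq0 ht0 hr ht hq hqt ha hbal hs
  have h0 : G 0 = 0 := by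
    by_contra hne
    exact hfreq ((hGc.eventually_ne hne).mono fun s hs h => hs h)
  simpa only [hG, hX0] using h0


/-! ### Invariance of the zeroth order coefficient under reflection of the parameters -/

/-- The factor by which `θ(z; p)` changes under a reflection at a half period. -/
noncomputable def reflectFactor (p w : ℂ) : Fin 4 → ℂ := ![1, 1, -(w / p), -w⁻¹]

/-- With t z² = c_k² = p^j the argument on the left is p · p^j / (zb), which the symmetries of θ
bring back to zb. -/
theorem theta_reflect {p t : ℂ} (hp : ‖p‖ < 1) (hp0 : p ≠ 0) {z b : ℂ} (hz : z ≠ 0) (hb : b ≠ 0)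
    (k : Fin 4) (h : t * z ^ 2 = halfPeriod p k ^ 2) :
    theta (z * (p * t / b)) p = reflectFactor p (z * b) k * theta (z * b) p := by
  have hw : z * b ≠ 0 := mul_ne_zero hz hb
  have e : z * (p * t / b) = p * (p ^ (![0, 0, 1, -1] : Fin 4 → ℤ) k * (z * b)⁻¹) := by
    rw [← halfPeriod_sq, ← h]
    field_simp
  rw [e]
  fin_cases k
  · simp only [reflectFactor, Fin.reduceFinMk, Matrix.cons_val, zpow_zero, one_mul]
    rw [← div_eq_mul_inv, theta_div p _ hp0]
  · simp only [reflectFactor, Fin.reduceFinMk, Matrix.cons_val, zpow_zero, one_mul]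
    rw [← div_eq_mul_inv, theta_div p _ hp0]
  · simp only [reflectFactor, Fin.reduceFinMk, Matrix.cons_val, zpow_one]
    rw [theta_mul_left hp hp0 (mul_ne_zero hp0 (inv_ne_zero hw)), ← div_eq_mul_inv p,
      theta_div p _ hp0, inv_div]
  · simp only [reflectFactor, Fin.reduceFinMk, Matrix.cons_val, zpow_neg_one]
    rw [mul_inv_cancel_left₀ hp0, theta_inv hp hw]

theorem pm_theta_reflect {p q t : ℂ} (hp : ‖p‖ < 1) (hp0 : p ≠ 0) (hq0 : q ≠ 0) {z y : ℂ}
    (hz : z ≠ 0) (hy : y ≠ 0) (k : Fin 4) (h : t * z ^ 2 = halfPeriod p k ^ 2) :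
    pm (fun z => theta z p) (z * (p * q⁻¹ * t)) y =
      (![1, 1, (z * q) ^ 2 / p ^ 2, ((z * q) ^ 2)⁻¹] : Fin 4 → ℂ) k *
        pm (fun z => theta z p) (z * q) y := by
  have h1 := theta_reflect hp hp0 hz (mul_ne_zero hq0 (inv_ne_zero hy)) k h
  have h2 := theta_reflect hp hp0 hz (mul_ne_zero hq0 hy) k h
  simp only [pm]
  rw [show z * (p * q⁻¹ * t) * y = z * (p * t / (q * y⁻¹)) by field_simp,
    show z * (p * q⁻¹ * t) * y⁻¹ = z * (p * t / (q * y)) by field_simp, h1, h2,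
    ← mul_assoc z q, ← mul_assoc z q]
  have hzq : z * q ≠ 0 := mul_ne_zero hz hq0
  fin_cases k
  · simp [reflectFactor, mul_comm]
  · simp [reflectFactor, mul_comm]
  · simp only [reflectFactor, Fin.reduceFinMk, Matrix.cons_val]
    field_simp
  · simp only [reflectFactor, Fin.reduceFinMk, Matrix.cons_val]
    field_simp

/-- As |K| is even, the signs cancel and only powers of z² remain, which is p/t for k = 2 and 1/(pt)
for k = 3. -/
theorem prod_reflectFactor {p t : ℂ} (hp0 : p ≠ 0) (ht0 : t ≠ 0) {z : ℂ} (hz : z ≠ 0)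
    {a : Fin 8 → ℂ} (ha : ∀ s, a s ≠ 0) {K : Finset (Fin 8)} (hK : Even K.card) (k : Fin 4)
    (h : t * z ^ 2 = halfPeriod p k ^ 2) :
    ∏ s ∈ K, reflectFactor p (z * a s) k =
      (![1, 1, (∏ s ∈ K, a s) / (p * t) ^ (K.card / 2),
        (p * t) ^ (K.card / 2) / ∏ s ∈ K, a s] : Fin 4 → ℂ) k := by
  obtain ⟨c, hc⟩ := hK
  rw [halfPeriod_sq] at h
  have hc2 : K.card = 2 * c := by omega
  have hc3 : K.card / 2 = c := by omega
  have hprod : ∏ s ∈ K, a s ≠ 0 := Finset.prod_ne_zero_iff.2 fun s _ => ha s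
  rw [hc3]
  fin_cases k
  · simp [reflectFactor]
  · simp [reflectFactor]
  · simp only [reflectFactor, Fin.reduceFinMk, Matrix.cons_val, zpow_one] at h ⊢
    have e : ∀ s, -(z * a s / p) = (-(z / p)) * a s := fun s => by ring
    have e2 : (-(z / p)) ^ 2 = (p * t)⁻¹ := by
      field_simp
      linear_combination h
    simp only [e]
    rw [Finset.prod_mul_distrib, Finset.prod_const, hc2, pow_mul, e2, inv_pow]
    ring
  · simp only [reflectFactor, Fin.reduceFinMk, Matrix.cons_val, zpow_neg_one] at h ⊢
    have e : ∀ s, -(z * a s)⁻¹ = (-z⁻¹) * (a s)⁻¹ := fun s => by rw [mul_inv]; ring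
    have e2 : (-z⁻¹) ^ 2 = p * t := by
      field_simp at h ⊢
      linear_combination -h
    simp only [e]
    rw [Finset.prod_mul_distrib, Finset.prod_const, hc2, pow_mul, e2, Finset.prod_inv_distrib]
    ring

theorem prod_theta_reflect {p t : ℂ} (hp : ‖p‖ < 1) (hp0 : p ≠ 0) {z : ℂ} (hz : z ≠ 0)
    {a : Fin 8 → ℂ} (ha : ∀ s, a s ≠ 0) (K : Finset (Fin 8)) (k : Fin 4)
    (h : t * z ^ 2 = halfPeriod p k ^ 2) :
    ∏ s, theta (z * reflect (p * t) K a s) p =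
      (∏ s ∈ K, reflectFactor p (z * a s) k) * ∏ s, theta (z * a s) p := by
  have e : ∀ s, theta (z * reflect (p * t) K a s) p =
      (if s ∈ K then reflectFactor p (z * a s) k else 1) * theta (z * a s) p := by
    intro s
    by_cases hs : s ∈ K
    · rw [reflect, if_pos hs, if_pos hs, theta_reflect hp hp0 hz (ha s) k h]
    · rw [reflect, if_neg hs, if_neg hs, one_mul]
  simp only [e, Finset.prod_mul_distrib]
  simp

/-- The factors produced by reflecting the parameters and the coupling constant are absorbed by L_2
and L_3, in which t, q and r change as well; `reflectRoot` is the square root for which this works.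
The denominators θ(q;p) and θ(q/t;p) trade places. -/
theorem zeroCoeff_reflect {p q t : ℂ} (hp : ‖p‖ < 1) (hp0 : p ≠ 0) (hq0 : q ≠ 0) (ht0 : t ≠ 0)
    {a : Fin 8 → ℂ} (ha : ∀ s, a s ≠ 0) {K : Finset (Fin 8)} (hK : Even K.card) {r : ℂ}
    (hr0 : r ≠ 0) {n : ℕ} {y : Fin n → ℂ} (hy : ∀ k, y k ≠ 0) :
    zeroCoeff p t (p * q⁻¹ * t) (reflect (p * t) K a) (reflectRoot (p * t) K a r) y =
      zeroCoeff p t q a r y := by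
  rw [zeroCoeff, zeroCoeff]
  congr 1
  refine Finset.sum_congr rfl fun k _ => ?_
  have hz0 : halfPeriod p k * (t ^ (1 / 2 : ℂ))⁻¹ ≠ 0 :=
    mul_ne_zero (halfPeriod_ne_zero hp0 k) (inv_ne_zero (cpow_half_ne_zero ht0))
  have hz : t * (halfPeriod p k * (t ^ (1 / 2 : ℂ))⁻¹) ^ 2 = halfPeriod p k ^ 2 := by
    rw [mul_pow, inv_pow, cpow_half_sq]
    field_simp
  have e1 := fun j => pm_theta_reflect hp hp0 hq0 hz0 (hy j) k hz
  simp only [e1, mul_div_assoc, Finset.prod_mul_distrib, Finset.prod_const, Finset.card_univ,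
    Fintype.card_fin]
  rw [prod_theta_reflect hp hp0 hz0 ha K k hz, prod_reflectFactor hp0 ht0 hz0 ha hK k hz,
    show theta (p * q⁻¹ * t) p = theta (t⁻¹ * q) p by
      rw [← theta_div p (t⁻¹ * q) hp0]; congr 1; field_simp,
    show theta (t⁻¹ * (p * q⁻¹ * t)) p = theta q p by
      rw [← theta_div p q hp0]; congr 1; field_simp, mul_comm (theta (t⁻¹ * q) p)]
  have hA : ∏ s ∈ K, a s ≠ 0 := Finset.prod_ne_zero_iff.2 fun s _ => ha s
  have key : zeroConst n p t (p * q⁻¹ * t) (reflectRoot (p * t) K a r) k *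
      (![1, 1, (∏ s ∈ K, a s) / (p * t) ^ (K.card / 2),
        (p * t) ^ (K.card / 2) / ∏ s ∈ K, a s] : Fin 4 → ℂ) k *
      (![1, 1, (halfPeriod p k * (t ^ (1 / 2 : ℂ))⁻¹ * q) ^ 2 / p ^ 2,
        ((halfPeriod p k * (t ^ (1 / 2 : ℂ))⁻¹ * q) ^ 2)⁻¹] : Fin 4 → ℂ) k ^ n =
      zeroConst n p t q r k := by
    rw [halfPeriod_sq] at hz
    generalize halfPeriod p k * (t ^ (1 / 2 : ℂ))⁻¹ = z at *
    rw [reflectRoot]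
    generalize ∏ s ∈ K, a s = A at *
    have hpt : (p * t) ^ (K.card / 2) ≠ 0 := pow_ne_zero _ (mul_ne_zero hp0 ht0)
    fin_cases k
    · simp [zeroConst]
    · simp [zeroConst]
    · simp only [zeroConst, Fin.reduceFinMk, Matrix.cons_val, zpow_one] at hz ⊢
      have e : (p * q⁻¹ * t) ^ n * ((z * q) ^ 2 / p ^ 2) ^ n = q ^ n := by
        rw [← mul_pow]
        congr 1
        field_simp
        linear_combination hz
      rw [← e]
      generalize (p * q⁻¹ * t) ^ n = B
      generalize ((z * q) ^ 2 / p ^ 2) ^ n = C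
      field_simp
    · simp only [zeroConst, Fin.reduceFinMk, Matrix.cons_val, zpow_neg_one] at hz ⊢
      have e : q ^ n * (((z * q) ^ 2)⁻¹) ^ n = (p * q⁻¹ * t) ^ n := by
        rw [← mul_pow]
        congr 1
        field_simp at hz ⊢
        linear_combination -hz
      rw [← e]
      have hC : (((z * q) ^ 2)⁻¹) ^ n ≠ 0 :=
        pow_ne_zero _ (inv_ne_zero (pow_ne_zero 2 (mul_ne_zero hz0 hq0)))
      have hqn := pow_ne_zero n hq0
      generalize (((z * q) ^ 2)⁻¹) ^ n = C at *
      generalize q ^ n = B at *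
      field_simp
  rw [← key]
  ring


/-! ### Integrals over the torus -/

/-- The point of the unit torus with angles `θ`. -/
noncomputable def torusPoint {n : ℕ} (θ : Fin n → ℝ) : Fin n → ℂ := torusMap 0 (fun _ => 1) θ

theorem torusPoint_apply {n : ℕ} (θ : Fin n → ℝ) (k : Fin n) :
    torusPoint θ k = Complex.exp (θ k * Complex.I) := by
  simp [torusPoint, torusMap]

theorem norm_torusPoint {n : ℕ} (θ : Fin n → ℝ) (k : Fin n) : ‖torusPoint θ k‖ = 1 := by
  rw [torusPoint_apply, Complex.norm_exp_ofReal_mul_I]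

theorem torusPoint_ne_zero {n : ℕ} (θ : Fin n → ℝ) (k : Fin n) : torusPoint θ k ≠ 0 := by
  rw [torusPoint_apply]; exact Complex.exp_ne_zero _

theorem continuous_torusPoint {n : ℕ} : Continuous (torusPoint (n := n)) := by
  refine continuous_pi fun k => ?_
  simp only [torusPoint_apply]
  fun_prop

theorem update_torusPoint {n : ℕ} (k : Fin (n + 1)) (s : ℝ) (θ : Fin n → ℝ) (c : ℂ) :
    Function.update (torusPoint (k.insertNth s θ)) k (c * torusPoint (k.insertNth s θ) k) =
      k.insertNth (c * circleMap 0 1 s) (torusPoint θ) := by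
  refine funext fun j => ?_
  rcases eq_or_ne j k with rfl | hj
  · simp [torusPoint_apply, circleMap]
  · obtain ⟨l, rfl⟩ := Fin.exists_succAbove_eq hj
    simp [torusPoint_apply]

/-- The integral of `f` over the unit torus with respect to `dθ_1 ⋯ dθ_n`. -/
noncomputable def torusAngleIntegral {n : ℕ} (f : (Fin n → ℂ) → ℂ) : ℂ :=
  ∫ θ in Set.Icc (0 : Fin n → ℝ) (fun _ => 2 * Real.pi), f (torusPoint θ)

theorem integrableOn_torus {n : ℕ} {g : (Fin n → ℝ) → ℂ} (hg : Continuous g) :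
    IntegrableOn g (Set.Icc (0 : Fin n → ℝ) (fun _ => 2 * Real.pi)) :=
  hg.continuousOn.integrableOn_compact isCompact_Icc

theorem setIntegral_torus_insertNth {n : ℕ} (k : Fin (n + 1)) {g : (Fin (n + 1) → ℝ) → ℂ}
    (hg : Continuous g) :
    ∫ θ in Set.Icc (0 : Fin (n + 1) → ℝ) (fun _ => 2 * Real.pi), g θ =
      ∫ θ in Set.Icc (0 : Fin n → ℝ) (fun _ => 2 * Real.pi),
        ∫ s in (0)..2 * Real.pi, g (k.insertNth s θ) := by
  set e : ℝ × (Fin n → ℝ) ≃ᵐ (Fin (n + 1) → ℝ) :=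
    (MeasurableEquiv.piFinSuccAbove (fun _ => ℝ) k).symm with he
  have hem : MeasurePreserving e :=
    (volume_preserving_piFinSuccAbove (fun _ : Fin (n + 1) => ℝ) k).symm _
  have heπ : (e ⁻¹' Set.Icc 0 fun _ => 2 * Real.pi) =
      Set.Icc 0 (2 * Real.pi) ×ˢ Set.Icc (0 : Fin n → ℝ) fun _ => 2 * Real.pi :=
    ((Fin.insertNthOrderIso (fun _ => ℝ) k).preimage_Icc _ _).trans (Set.Icc_prod_eq _ _)
  have hint := integrableOn_torus hg
  rw [← hem.integrableOn_comp_preimage e.measurableEmbedding, heπ] at hint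
  rw [← hem.map_eq, setIntegral_map_equiv, heπ, Measure.volume_eq_prod, ← Measure.prod_restrict,
    integral_prod_symm _ (by
      rw [IntegrableOn, Measure.volume_eq_prod, ← Measure.prod_restrict] at hint; exact hint)]
  refine integral_congr_ae (Filter.Eventually.of_forall fun θ => ?_)
  simp only
  rw [intervalIntegral.integral_of_le Real.two_pi_pos.le, ← integral_Icc_eq_integral_Ioc]
  rfl

/-- Fubini's theorem isolates the k-th angle, and the inner circle is moved by Cauchy's theorem. -/
theorem torusAngleIntegral_shift {n : ℕ} (k : Fin n) {c : ℂ} (hc : c ≠ 0)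
    {f : (Fin n → ℂ) → ℂ} (h1 : Continuous fun θ => f (torusPoint θ))
    (h2 : Continuous fun θ =>
      f (Function.update (torusPoint θ) k (c * torusPoint θ k)))
    (hf : ∀ y : Fin n → ℂ, (∀ i, ‖y i‖ = 1) →
      DifferentiableOn ℂ (fun z => f (Function.update y k z))
        {z | min 1 ‖c‖ ≤ ‖z‖ ∧ ‖z‖ ≤ max 1 ‖c‖}) :
    torusAngleIntegral (fun y => f (Function.update y k (c * y k))) = torusAngleIntegral f := by
  obtain _ | n := n
  · exact k.elim0
  rw [torusAngleIntegral, torusAngleIntegral, setIntegral_torus_insertNth k h1,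
    setIntegral_torus_insertNth k h2]
  refine integral_congr_ae (Filter.Eventually.of_forall fun θ => ?_)
  simp only [update_torusPoint]
  have h3 : ∀ s, torusPoint (k.insertNth s θ) =
      k.insertNth (circleMap 0 1 s) (torusPoint θ) := fun s => by
    simpa using update_torusPoint k s θ 1
  simp only [h3]
  refine integral_mul_circleMap_eq (g := fun z => f (k.insertNth z (torusPoint θ))) hc ?_
  have h4 := hf (k.insertNth 1 (torusPoint θ)) fun i => by
    rcases eq_or_ne i k with rfl | hi
    · simp
    · obtain ⟨l, rfl⟩ := Fin.exists_succAbove_eq hi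
      simpa using norm_torusPoint θ l
  simpa using h4

/-- On the unit circle dy / y = i dθ, which cancels the powers of i. -/
theorem omegaIntegral_eq {n : ℕ} (f : (Fin n → ℂ) → ℂ) :
    omegaIntegral f = ((2 * (Real.pi : ℂ)) ^ n)⁻¹ * torusAngleIntegral f := by
  rw [omegaIntegral, torusIntegral, torusAngleIntegral, ← integral_const_mul]
  refine integral_congr_ae (Filter.Eventually.of_forall fun θ => ?_)
  have h : ∀ k, torusMap 0 (fun _ => 1) θ k = Complex.exp (θ k * Complex.I) := fun k => by
    simp [torusMap]
  have h0 : ∏ k, Complex.exp (θ k * Complex.I) ≠ 0 :=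
    Finset.prod_ne_zero_iff.2 fun k _ => Complex.exp_ne_zero _
  have hI := pow_ne_zero n Complex.I_ne_zero
  simp only [omegaDensity, h, smul_eq_mul, Finset.prod_mul_distrib, Finset.prod_const,
    Finset.card_univ, Fintype.card_fin, Complex.ofReal_one, one_mul, mul_pow, torusPoint]
  generalize ∏ k, Complex.exp (θ k * Complex.I) = P at h0 ⊢
  field_simp

theorem torusIntegrable_omegaDensity {n : ℕ} {f : (Fin n → ℂ) → ℂ}
    (hf : IntegrableOn (fun θ => f (torusPoint θ)) (Set.Icc 0 (fun _ => 2 * Real.pi))) :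
    TorusIntegrable (omegaDensity f) 0 (fun _ => 1) := by
  refine hf.continuousOn_mul ?_ isCompact_Icc
  refine continuousOn_const.mul (ContinuousOn.inv₀ ?_ fun θ _ =>
    Finset.prod_ne_zero_iff.2 fun k _ => torusPoint_ne_zero θ k)
  exact (continuous_finsetProd _ fun k _ =>
    (continuous_apply k).comp continuous_torusPoint).continuousOn


/-! ### Exceptional points of the torus form a null set -/

/-- A nonzero linear functional maps Lebesgue measure to a multiple of Lebesgue measure, and only
countably many angles are sent into a countable set. -/
theorem ae_exp_notMem {n : ℕ} {l : (Fin n → ℝ) →ₗ[ℝ] ℝ} (hl : l ≠ 0) {Z : Set ℂ}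
    (hZ : Z.Countable) : ∀ᵐ θ : Fin n → ℝ, Complex.exp (l θ * Complex.I) ∉ Z := by
  have hsurj : Function.Surjective l := LinearMap.surjective hl
  obtain ⟨c, -, h⟩ := LinearMap.exists_map_addHaar_eq_smul_addHaar
    (μ := (volume : Measure (Fin n → ℝ))) (ν := (volume : Measure ℝ)) l hsurj
  have hS : {s : ℝ | Complex.exp (s * Complex.I) ∈ Z}.Countable :=
    hZ.preimage_cexp.preimage_of_injOn (f := fun s : ℝ => (s : ℂ) * Complex.I)
      (fun a _ b _ e => by simpa using e)
  have h0 : (Measure.map l volume) {s : ℝ | Complex.exp (s * Complex.I) ∈ Z} = 0 := by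
    rw [h]; simp [hS.measure_zero]
  have hm : Measurable l := l.continuous_of_finiteDimensional.measurable
  rw [Measure.map_apply hm hS.measurableSet] at h0
  exact measure_eq_zero_iff_ae_notMem.1 h0

/-- Neither the coordinates of `y`, nor their squares, products and quotients lie in `Z`. -/
def Avoids {n : ℕ} (Z : Set ℂ) (y : Fin n → ℂ) : Prop :=
  (∀ k, y k ∉ Z ∧ y k ^ 2 ∉ Z) ∧ ∀ k l, k ≠ l → y k * y l ∉ Z ∧ y k * (y l)⁻¹ ∉ Z

theorem ae_avoids {n : ℕ} {Z : Set ℂ} (hZ : Z.Countable) :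
    ∀ᵐ θ : Fin n → ℝ, Avoids Z (torusPoint θ) := by
  have h1 : ∀ k : Fin n, ∀ᵐ θ : Fin n → ℝ, torusPoint θ k ∉ Z ∧ torusPoint θ k ^ 2 ∉ Z := by
    intro k
    have e1 : (LinearMap.proj k : (Fin n → ℝ) →ₗ[ℝ] ℝ) ≠ 0 := fun e => by
      simpa using DFunLike.congr_fun e (Pi.single k 1)
    have e2 : (2 : ℝ) • (LinearMap.proj k : (Fin n → ℝ) →ₗ[ℝ] ℝ) ≠ 0 := fun e => by
      simpa using DFunLike.congr_fun e (Pi.single k 1)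
    filter_upwards [ae_exp_notMem e1 hZ, ae_exp_notMem e2 hZ] with θ h1 h2
    refine ⟨by simpa [torusPoint_apply] using h1, ?_⟩
    rw [torusPoint_apply, ← Complex.exp_nat_mul]
    simpa [mul_assoc] using h2
  have h2 : ∀ k l : Fin n, ∀ᵐ θ : Fin n → ℝ, k ≠ l →
      torusPoint θ k * torusPoint θ l ∉ Z ∧ torusPoint θ k * (torusPoint θ l)⁻¹ ∉ Z := by
    intro k l
    rcases eq_or_ne k l with h | h
    · exact Filter.Eventually.of_forall fun θ h' => absurd h h'
    have e1 : (LinearMap.proj k : (Fin n → ℝ) →ₗ[ℝ] ℝ) + LinearMap.proj l ≠ 0 := fun e => by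
      have e' := DFunLike.congr_fun e (Pi.single k 1)
      rw [LinearMap.add_apply] at e'
      simp [h.symm] at e'
    have e2 : (LinearMap.proj k : (Fin n → ℝ) →ₗ[ℝ] ℝ) - LinearMap.proj l ≠ 0 := fun e => by
      have e' := DFunLike.congr_fun e (Pi.single k 1)
      rw [LinearMap.sub_apply] at e'
      simp [h.symm] at e'
    filter_upwards [ae_exp_notMem e1 hZ, ae_exp_notMem e2 hZ] with θ h1 h2 _
    rw [torusPoint_apply, torusPoint_apply, ← Complex.exp_neg, ← Complex.exp_add,
      ← Complex.exp_add]
    refine ⟨by simpa [add_mul] using h1, by simpa [add_mul, sub_eq_add_neg] using h2⟩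
  filter_upwards [ae_all_iff.2 h1, ae_all_iff.2 fun k => ae_all_iff.2 (h2 k)] with θ h1 h2
  exact ⟨h1, h2⟩

theorem countable_setOf_qPoch₂_eq_zero {p q : ℂ} (hp : ‖p‖ < 1) (hq : ‖q‖ < 1) :
    {z | qPoch₂ z p q = 0}.Countable := by
  have h : {z | qPoch₂ z p q = 0} ⊆ Set.range fun i : ℕ × ℕ => (p ^ i.1)⁻¹ * (q ^ i.2)⁻¹ := by
    intro z hz
    by_contra h
    refine qPoch₂_ne_zero hp hq (fun l j e => h ⟨(l, j), ?_⟩) hz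
    have hl : p ^ l ≠ 0 := fun e' => by simp [e'] at e
    have hj : q ^ j ≠ 0 := fun e' => by simp [e'] at e
    simp only
    field_simp
    linear_combination -e
  exact (Set.countable_range _).mono h

/-- The set contains the poles besides the zeros, since the value at a pole is 0; so both numerator
and denominator have to be considered. -/
theorem countable_setOf_ellGamma_eq_zero {p q : ℂ} (hp : ‖p‖ < 1) (hq : ‖q‖ < 1) (hp0 : p ≠ 0)
    (hq0 : q ≠ 0) : {z | ellGamma z p q = 0}.Countable := by
  have h1 := countable_setOf_qPoch₂_eq_zero hp hq
  have h2 : ((fun z => p * q / z) ⁻¹' {z | qPoch₂ z p q = 0}).Countable := by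
    refine h1.preimage fun a b e => ?_
    simpa [div_eq_mul_inv, hp0, hq0] using e
  refine (h2.union h1).mono fun z hz => ?_
  rcases div_eq_zero_iff.1 hz with h | h
  · exact Or.inl h
  · exact Or.inr h


/-! ### Holomorphic dependence on x -/

theorem contDiffAt_theta_comp {X : Type*} [NormedAddCommGroup X] [NormedSpace ℂ X] {p : ℂ}
    (hp : ‖p‖ < 1) {f : X → ℂ} {x : X} (hf : ContDiffAt ℂ 1 f x) (h0 : f x ≠ 0) :
    ContDiffAt ℂ 1 (fun x => theta (f x) p) x :=
  ContDiffAt.comp (g := fun z => theta z p) x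
    (((differentiableOn_theta hp).analyticAt (isOpen_compl_singleton.mem_nhds h0)).contDiffAt) hf

theorem contDiffAt_dualKernel {p : ℂ} (hp : ‖p‖ < 1) {X : Type*} [NormedAddCommGroup X]
    [NormedSpace ℂ X] {m n : ℕ} {x : X → Fin m → ℂ} {y : X → Fin n → ℂ} {z : X}
    (hx : ContDiffAt ℂ 1 x z) (hy : ContDiffAt ℂ 1 y z) (hx0 : ∀ i, x z i ≠ 0)
    (hy0 : ∀ k, y z k ≠ 0) : ContDiffAt ℂ 1 (fun z => dualKernel p (x z) (y z)) z := by
  have hxi : ∀ i, ContDiffAt ℂ 1 (fun z => x z i) z := contDiffAt_pi.1 hx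
  have hyk : ∀ k, ContDiffAt ℂ 1 (fun z => y z k) z := contDiffAt_pi.1 hy
  refine contDiffAt_prod fun i _ => contDiffAt_prod fun k _ => ((hxi i).inv (hx0 i)).mul ?_
  exact (contDiffAt_theta_comp hp ((hxi i).mul (hyk k)) (mul_ne_zero (hx0 i) (hy0 k))).mul
    (contDiffAt_theta_comp hp ((hxi i).mul ((hyk k).inv (hy0 k)))
      (mul_ne_zero (hx0 i) (inv_ne_zero (hy0 k))))

theorem isOpen_setOf_ne_zero (m : ℕ) : IsOpen {x : Fin m → ℂ | ∀ i, x i ≠ 0} := by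
  simp only [Set.ofPred_forall]
  exact isOpen_iInter_of_finite fun i => isOpen_ne_fun (continuous_apply i) continuous_const

theorem continuous_dualKernel_torusPoint {p : ℂ} (hp : ‖p‖ < 1) {m n : ℕ} {x : Fin m → ℂ}
    (hx : ∀ i, x i ≠ 0) : Continuous fun θ : Fin n → ℝ => dualKernel p x (torusPoint θ) :=
  continuous_iff_continuousAt.2 fun θ => continuousAt_dualKernel hp continuousAt_const
    continuous_torusPoint.continuousAt hx (torusPoint_ne_zero θ)

/-- Differentiation under the integral sign: the x-derivative of the integrand is jointly
continuous, hence bounded on a closed ball times the cube of angles. -/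
theorem differentiableOn_torusAngleIntegral_dualKernel {p : ℂ} (hp : ‖p‖ < 1) {m n : ℕ}
    {W : (Fin n → ℂ) → ℂ} (hW : Continuous fun θ => W (torusPoint θ)) :
    DifferentiableOn ℂ (fun x : Fin m → ℂ => torusAngleIntegral fun y => W y * dualKernel p x y)
      {x | ∀ i, x i ≠ 0} := by
  intro x₀ hx₀
  have hopen := isOpen_setOf_ne_zero m
  obtain ⟨ε, hε, hball⟩ := Metric.nhds_basis_closedBall.mem_iff.1 (hopen.mem_nhds hx₀)
  set D : (Fin m → ℂ) × (Fin n → ℝ) → (Fin m → ℂ) →L[ℂ] ℂ := fun z =>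
    W (torusPoint z.2) • fderiv ℂ (fun x => dualKernel p x (torusPoint z.2)) z.1 with hD
  have hD1 : ∀ x : Fin m → ℂ, (∀ i, x i ≠ 0) → ∀ y : Fin n → ℂ, (∀ k, y k ≠ 0) →
      ContinuousAt (fun z : (Fin m → ℂ) × (Fin n → ℂ) =>
        fderiv ℂ (fun x => dualKernel p x z.2) z.1) (x, y) := fun x hx y hy => by
    have h : ContDiffAt ℂ 1 (Function.uncurry fun (z : (Fin m → ℂ) × (Fin n → ℂ)) x =>
        dualKernel p x z.2) ((x, y), (x, y).1) :=
      contDiffAt_dualKernel hp (x := fun z : ((Fin m → ℂ) × (Fin n → ℂ)) × (Fin m → ℂ) => z.2)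
        (y := fun z => z.1.2) contDiffAt_snd (contDiffAt_snd.comp _ contDiffAt_fst) hx hy
    exact (ContDiffAt.fderiv (m := 0) h contDiffAt_fst (by simp)).continuousAt
  have hDc : ∀ x : Fin m → ℂ, (∀ i, x i ≠ 0) → ∀ θ, ContinuousAt D (x, θ) := fun x hx θ => by
    have h1 : ContinuousAt (fun z : (Fin m → ℂ) × (Fin n → ℝ) => (z.1, torusPoint z.2)) (x, θ) :=
      (continuous_fst.prodMk (continuous_torusPoint.comp continuous_snd)).continuousAt
    have h2 := ContinuousAt.comp (x := (x, θ)) (hD1 x hx _ (torusPoint_ne_zero θ)) h1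
    exact (hW.comp continuous_snd).continuousAt.smul h2
  have hcomp : IsCompact (Metric.closedBall x₀ ε ×ˢ
      Set.Icc (0 : Fin n → ℝ) (fun _ => 2 * Real.pi)) :=
    (isCompact_closedBall x₀ ε).prod isCompact_Icc
  obtain ⟨C, hC⟩ := hcomp.exists_bound_of_continuousOn (f := D) fun z hz =>
    (hDc z.1 (hball hz.1) z.2).continuousWithinAt
  have hcont : ∀ x : Fin m → ℂ, (∀ i, x i ≠ 0) →
      Continuous fun θ => W (torusPoint θ) * dualKernel p x (torusPoint θ) := fun x hx =>
    hW.mul (continuous_dualKernel_torusPoint hp hx)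
  refine (hasFDerivAt_integral_of_dominated_of_fderiv_le (𝕜 := ℂ)
    (μ := volume.restrict (Set.Icc (0 : Fin n → ℝ) (fun _ => 2 * Real.pi)))
    (F := fun x θ => W (torusPoint θ) * dualKernel p x (torusPoint θ))
    (F' := fun x θ => D (x, θ)) (bound := fun _ => C)
    (Metric.closedBall_mem_nhds x₀ hε) ?_ ?_ ?_ ?_ ?_ ?_).differentiableAt.differentiableWithinAt
  · exact Filter.eventually_of_mem (hopen.mem_nhds hx₀) fun x hx =>
      (hcont x hx).aestronglyMeasurable
  · exact integrableOn_torus (hcont x₀ hx₀)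
  · refine Continuous.aestronglyMeasurable (continuous_iff_continuousAt.2 fun θ => ?_)
    exact ContinuousAt.comp (f := fun θ : Fin n → ℝ => (x₀, θ)) (hDc x₀ hx₀ θ)
      (Continuous.prodMk_right x₀).continuousAt
  · exact (ae_restrict_mem measurableSet_Icc).mono fun θ hθ x hx => hC (x, θ) ⟨hx, hθ⟩
  · exact integrableOn_const (measure_Icc_lt_top.ne)
  · refine Filter.Eventually.of_forall fun θ x hx => ?_
    have h : ContDiffAt ℂ 1 (fun x => dualKernel p x (torusPoint θ)) x :=
      contDiffAt_dualKernel hp contDiffAt_id contDiffAt_const (hball hx) (torusPoint_ne_zero θ)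
    exact (h.differentiableAt one_ne_zero).hasFDerivAt.const_mul (W (torusPoint θ))


/-! ### The gauged weight function -/

/-- From (x;p,t)_∞ = (x;p)_∞ (tx;t)_∞ (ptx;p,t)_∞ the double products cancel. At z = 1 both sides
are 0, the left one through the value of Γ at poles. -/
theorem inv_ellGamma_mul_ellGamma_inv {p t : ℂ} (hp : ‖p‖ < 1) (ht : ‖t‖ < 1) {z : ℂ}
    (hz : ‖z‖ = 1) :
    (ellGamma z p t * ellGamma z⁻¹ p t)⁻¹ = theta z⁻¹ p * theta z t := by
  have hz0 : z ≠ 0 := fun h => by simp [h] at hz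
  have hfac : ∀ x, qPoch₂ x p t = qPoch x p * (qPoch (t * x) t * qPoch₂ (p * (t * x)) p t) :=
    fun x => by rw [qPoch₂_eq_mul_right hp ht, qPoch₂_eq_mul_left hp ht]
  have hne : ∀ x, ‖x‖ = 1 → qPoch₂ (p * t * x) p t ≠ 0 := fun x hx => by
    refine qPoch₂_ne_zero_of_norm_lt hp ht ?_
    rw [norm_mul, norm_mul, hx]
    nlinarith [norm_nonneg p, norm_nonneg t]
  have h1 := hne z hz
  have h2 := hne z⁻¹ (by rw [norm_inv, hz, inv_one])
  have e1 : p * t / z = p * t * z⁻¹ := by rw [div_eq_mul_inv]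
  have e2 : p * t / z⁻¹ = p * t * z := by rw [div_eq_mul_inv, inv_inv]
  have h3 := hfac z
  have h4 := hfac z⁻¹
  rw [← mul_assoc p t] at h3 h4
  rw [ellGamma, ellGamma, e1, e2, h3, h4, theta, theta, qPoch_eq_mul hp z⁻¹,
    qPoch_eq_mul ht z, qPoch_eq_mul hp z]
  simp only [div_eq_mul_inv, inv_inv, mul_inv]
  generalize qPoch₂ (p * t * z) p t = A at h1 ⊢
  generalize qPoch₂ (p * t * z⁻¹) p t = B at h2 ⊢
  rw [mul_mul_mul_comm, mul_comm B⁻¹, mul_assoc, mul_comm (A⁻¹)]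
  generalize z⁻¹ = w
  field_simp

/-- The dependence of the gauged weight function on a single variable. -/
noncomputable def singleFactor (p t : ℂ) (a : Fin 8 → ℂ) (K : Finset (Fin 8)) (w : ℂ) : ℂ :=
  (∏ s ∈ Kᶜ, pm (fun z => ellGamma z p t) (a s) w) * (theta (w ^ 2)⁻¹ p * theta (w ^ 2) t)

/-- The dependence of the gauged weight function on a pair of variables. -/
noncomputable def pairFactor (p t w v : ℂ) : ℂ :=
  pm (fun z => theta z p) w⁻¹ v * pm (fun z => theta z t) w v

/-- The gauged weight function `w_n U_K V`, without removable singularities. -/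
noncomputable def gaugedWeight {n : ℕ} (p t : ℂ) (a : Fin 8 → ℂ) (K : Finset (Fin 8))
    (y : Fin n → ℂ) : ℂ :=
  (∏ k, singleFactor p t a K (y k)) * ∏ k, ∏ l ∈ Finset.Ioi k, pairFactor p t (y k) (y l)

/-- The part of the gauged weight function that does not depend on the variable `y_k`. -/
noncomputable def restWeight {n : ℕ} (p t : ℂ) (a : Fin 8 → ℂ) (K : Finset (Fin 8)) (k : Fin n)
    (y : Fin n → ℂ) : ℂ :=
  (∏ j ∈ Finset.univ.erase k, singleFactor p t a K (y j)) *
    ∏ j ∈ Finset.univ.erase k, ∏ l ∈ (Finset.Ioi j).erase k, pairFactor p t (y j) (y l)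

theorem singleFactor_inv {p t : ℂ} (hp : ‖p‖ < 1) (ht : ‖t‖ < 1) (a : Fin 8 → ℂ)
    (K : Finset (Fin 8)) {w : ℂ} (hw : w ≠ 0) :
    singleFactor p t a K w⁻¹ = singleFactor p t a K w := by
  have hw2 : w ^ 2 ≠ 0 := pow_ne_zero 2 hw
  simp only [singleFactor, pm_inv, inv_pow, inv_inv]
  rw [theta_inv ht hw2, theta_inv hp hw2]
  ring

theorem pairFactor_inv {p t : ℂ} (hp : ‖p‖ < 1) (ht : ‖t‖ < 1) {w v : ℂ} (hw : w ≠ 0)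
    (hv : v ≠ 0) : pairFactor p t w⁻¹ v = pairFactor p t w v := by
  rw [pairFactor, pairFactor, inv_inv, pm_theta_inv hp hw hv, pm_theta_inv ht hw hv]
  ring

theorem pairFactor_comm {p t : ℂ} (hp : ‖p‖ < 1) (ht : ‖t‖ < 1) {w v : ℂ} (hw : w ≠ 0)
    (hv : v ≠ 0) : pairFactor p t w v = pairFactor p t v w := by
  have h : w * v⁻¹ ≠ 0 := mul_ne_zero hw (inv_ne_zero hv)
  have e : v * w⁻¹ = (w * v⁻¹)⁻¹ := by rw [mul_inv, inv_inv, mul_comm]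
  have e2 : w⁻¹ * v = (w * v⁻¹)⁻¹ := by rw [mul_inv, inv_inv]
  simp only [pairFactor, pm]
  rw [e2, mul_comm v⁻¹ w, e, mul_comm v⁻¹ w⁻¹, theta_inv hp h, theta_inv ht h, mul_comm v w]
  ring

/-- Splits off the pairs that contain k; symmetry of f handles those in which k is the larger index.
-/
theorem prod_pairs_eq {n : ℕ} (k : Fin n) {f : Fin n → Fin n → ℂ} (hf : ∀ i j, f i j = f j i) :
    ∏ j, ∏ l ∈ Finset.Ioi j, f j l = (∏ l ∈ Finset.univ.erase k, f k l) *
      ∏ j ∈ Finset.univ.erase k, ∏ l ∈ (Finset.Ioi j).erase k, f j l := by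
  have h1 : ∀ j ∈ Finset.univ.erase k, ∏ l ∈ Finset.Ioi j, f j l =
      (if j < k then f k j else 1) * ∏ l ∈ (Finset.Ioi j).erase k, f j l := by
    intro j _
    split_ifs with h
    · rw [hf k j, Finset.mul_prod_erase _ _ (Finset.mem_Ioi.2 h)]
    · rw [Finset.erase_eq_of_notMem (by simpa using h), one_mul]
  have h2 : ∏ l ∈ Finset.univ.erase k, f k l = (∏ l ∈ Finset.Ioi k, f k l) *
      ∏ j ∈ Finset.univ.erase k, if j < k then f k j else 1 := by
    rw [← Finset.prod_filter, ← Finset.prod_union]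
    · congr 1
      ext j
      simp only [Finset.mem_erase, Finset.mem_univ, and_true, Finset.mem_union, Finset.mem_Ioi,
        Finset.mem_filter]
      constructor
      · intro h
        rcases lt_or_gt_of_ne h with h' | h'
        · exact Or.inr ⟨h, h'⟩
        · exact Or.inl h'
      · rintro (h | h)
        · exact h.ne'
        · exact h.1
    · rw [Finset.disjoint_left]
      intro j h h'
      exact lt_asymm (Finset.mem_Ioi.1 h) (Finset.mem_filter.1 h').2
  rw [← Finset.mul_prod_erase _ _ (Finset.mem_univ k), Finset.prod_congr rfl h1,
    Finset.prod_mul_distrib, h2]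
  ring

theorem gaugedWeight_eq {n : ℕ} {p t : ℂ} (hp : ‖p‖ < 1) (ht : ‖t‖ < 1) (a : Fin 8 → ℂ)
    (K : Finset (Fin 8)) (k : Fin n) {y : Fin n → ℂ} (hy : ∀ j, y j ≠ 0) :
    gaugedWeight p t a K y = singleFactor p t a K (y k) *
      (∏ l ∈ Finset.univ.erase k, pairFactor p t (y k) (y l)) * restWeight p t a K k y := by
  rw [gaugedWeight, restWeight, prod_pairs_eq k fun i j => pairFactor_comm hp ht (hy i) (hy j),
    ← Finset.mul_prod_erase _ _ (Finset.mem_univ k)]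
  ring

theorem restWeight_update {n : ℕ} (p t : ℂ) (a : Fin 8 → ℂ) (K : Finset (Fin 8)) (k : Fin n)
    (y : Fin n → ℂ) (z : ℂ) :
    restWeight p t a K k (Function.update y k z) = restWeight p t a K k y := by
  have h : ∀ j ∈ Finset.univ.erase k, Function.update y k z j = y j := fun j hj =>
    Function.update_of_ne (Finset.ne_of_mem_erase hj) _ _
  rw [restWeight, restWeight, Finset.prod_congr rfl fun j hj => by rw [h j hj]]
  congr 1
  refine Finset.prod_congr rfl fun j hj => Finset.prod_congr rfl fun l hl => ?_
  rw [h j hj, h l (Finset.mem_erase.2 ⟨Finset.ne_of_mem_erase hl, Finset.mem_univ l⟩)]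

theorem inv_pmpm_ellGamma {p t : ℂ} (hp : ‖p‖ < 1) (ht : ‖t‖ < 1) {w v : ℂ} (hw : ‖w‖ = 1)
    (hv : ‖v‖ = 1) : (pmpm (fun z => ellGamma z p t) 1 w v)⁻¹ = pairFactor p t w v := by
  have h1 := inv_ellGamma_mul_ellGamma_inv hp ht (z := w * v) (by rw [norm_mul, hw, hv, one_mul])
  have h2 := inv_ellGamma_mul_ellGamma_inv hp ht (z := w * v⁻¹)
    (by rw [norm_mul, norm_inv, hw, hv, inv_one, one_mul])
  simp only [mul_inv, inv_inv] at h1 h2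
  simp only [pmpm, pm, pairFactor, one_mul, mul_inv]
  linear_combination (ellGamma (w * v⁻¹) p t)⁻¹ * (ellGamma (w⁻¹ * v) p t)⁻¹ * h1 +
    theta (w⁻¹ * v⁻¹) p * theta (w * v) t * h2

/-- U_K removes the Gamma factors with s ∈ K and V those with q. The hypotheses `h1` and `h2`
exclude the zeros and poles of these factors, where the cancellation fails for the assigned values.
-/
theorem weight_mul_gauge_eq {n : ℕ} {p q t : ℂ} (hp : ‖p‖ < 1) (ht : ‖t‖ < 1) (a : Fin 8 → ℂ)
    (K : Finset (Fin 8)) {y : Fin n → ℂ} (hy : ∀ k, ‖y k‖ = 1)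
    (h1 : ∀ k, ∀ s ∈ K, pm (fun z => ellGamma z p t) (a s) (y k) ≠ 0)
    (h2 : ∀ k l, k ≠ l → pmpm (fun z => ellGamma z p t) q (y k) (y l) ≠ 0) :
    weight p t q a y * gaugeU p t a K y * gaugeV p t q y = gaugedWeight p t a K y := by
  rw [weight, gaugeU, gaugeV, gaugedWeight]
  have e1 : ∀ k, singleFactor p t a K (y k) =
      (∏ s, pm (fun z => ellGamma z p t) (a s) (y k)) /
        pm (fun z => ellGamma z p t) 1 (y k ^ 2) *
        ∏ s ∈ K, 1 / pm (fun z => ellGamma z p t) (a s) (y k) := fun k => by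
    have h := inv_ellGamma_mul_ellGamma_inv hp ht (z := y k ^ 2) (by simp [hy k])
    have hK : ∏ s ∈ K, pm (fun z => ellGamma z p t) (a s) (y k) ≠ 0 :=
      Finset.prod_ne_zero_iff.2 (h1 k)
    rw [singleFactor, ← h, ← Finset.prod_mul_prod_compl K, Finset.prod_div_distrib,
      Finset.prod_const_one]
    simp only [show pm (fun z => ellGamma z p t) 1 (y k ^ 2) =
      ellGamma (y k ^ 2) p t * ellGamma (y k ^ 2)⁻¹ p t by simp only [pm, one_mul]]
    generalize ∏ s ∈ K, pm (fun z => ellGamma z p t) (a s) (y k) = A at hK ⊢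
    field_simp
  have e2 : ∀ k, ∀ l ∈ Finset.Ioi k, pairFactor p t (y k) (y l) =
      pmpm (fun z => ellGamma z p t) q (y k) (y l) /
        pmpm (fun z => ellGamma z p t) 1 (y k) (y l) *
        (1 / pmpm (fun z => ellGamma z p t) q (y k) (y l)) := fun k l hl => by
    have h := h2 k l (Finset.mem_Ioi.1 hl).ne
    rw [← inv_pmpm_ellGamma hp ht (hy k) (hy l)]
    field_simp
  rw [Finset.prod_congr rfl fun k _ => e1 k,
    Finset.prod_congr rfl fun k _ => Finset.prod_congr rfl (e2 k)]
  simp only [Finset.prod_mul_distrib]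
  ring


/-! ### Products of the gauged weight with shift coefficients -/

/-- The product of `singleFactor` and the one-variable factors of a shift coefficient with
parameters `b`, without removable singularities. -/
noncomputable def singleShift (p t : ℂ) (a : Fin 8 → ℂ) (K : Finset (Fin 8)) (b : Fin 8 → ℂ)
    (w : ℂ) : ℂ :=
  (∏ s ∈ Kᶜ, ellGamma (a s * (t * w)) p t * ellGamma (a s * w⁻¹) p t) *
    (∏ s ∈ K, theta (b s * w) p) *
    (qPoch (w ^ 2)⁻¹ t * qPoch (t * (t * w ^ 2)) t /
      (qPoch (p * (t * w ^ 2)) p * qPoch (p / (t * w ^ 2)) p))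

/-- The product of `pairFactor` and the two-variable factors of a shift coefficient with coupling
parameter `c`, without removable singularities. -/
noncomputable def pairShift (p t c w v : ℂ) : ℂ :=
  pm (fun z => theta z t) w⁻¹ v * pm (fun z => theta z p) (c * w) v

/-- The product of `gaugedWeight` and the shift coefficient in the variable `y_k` with parameters
`b` and coupling parameter `c`, where `w` stands for `y_k` or its inverse. -/
noncomputable def shiftWeight {n : ℕ} (p t : ℂ) (a : Fin 8 → ℂ) (K : Finset (Fin 8))
    (b : Fin 8 → ℂ) (c : ℂ) (k : Fin n) (w : ℂ) (y : Fin n → ℂ) : ℂ :=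
  singleShift p t a K b w * (∏ l ∈ Finset.univ.erase k, pairShift p t c w (y l)) *
    restWeight p t a K k y

/-- For s ∉ K the theta factors are absorbed by θ(z;p) Γ(z) = Γ(tz), and θ(w⁻²;p) cancels θ(w²;p).
The common factor 1 − t w² of θ(w²;t) and θ(t w²;p) is removed too: its zeros lie in the annulus 1 ≤
|w| ≤ |t|⁻¹ that the contour crosses. -/
theorem singleFactor_mul {p t : ℂ} (hp : ‖p‖ < 1) (ht : ‖t‖ < 1) (ht0 : t ≠ 0) {a : Fin 8 → ℂ}
    {K : Finset (Fin 8)} (haK : ∀ s, s ∉ K → ‖a s‖ < 1) {b : Fin 8 → ℂ}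
    (hb : ∀ s, s ∉ K → b s = a s) {w : ℂ} (hw : ‖w‖ = 1) (h1 : theta (w ^ 2) p ≠ 0)
    (h2 : theta (t * w ^ 2) p ≠ 0) :
    singleFactor p t a K w *
      ((∏ s, theta (b s * w) p) / (theta (w ^ 2) p * theta (t * w ^ 2) p)) =
      singleShift p t a K b w := by
  have hw0 : w ≠ 0 := fun h => by simp [h] at hw
  have hw2 : w ^ 2 ≠ 0 := pow_ne_zero 2 hw0
  have e1 : ∏ s ∈ Kᶜ, ellGamma (a s * (t * w)) p t * ellGamma (a s * w⁻¹) p t =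
      (∏ s ∈ Kᶜ, pm (fun z => ellGamma z p t) (a s) w) * ∏ s ∈ Kᶜ, theta (b s * w) p := by
    rw [← Finset.prod_mul_distrib]
    refine Finset.prod_congr rfl fun s hs => ?_
    have hs' := Finset.mem_compl.1 hs
    rw [hb s hs', mul_left_comm (a s) t w, ellGamma_mul hp ht ht0
      (by rw [norm_mul, hw, mul_one]; exact haK s hs'), pm]
    ring
  have e2 : theta (t * w ^ 2) p = (1 - t * w ^ 2) * (qPoch (p * (t * w ^ 2)) p *
      qPoch (p / (t * w ^ 2)) p) := by rw [theta, qPoch_eq_mul hp]; ring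
  have e3 : theta (w ^ 2) t = -w ^ 2 * ((1 - t * w ^ 2) *
      (qPoch (w ^ 2)⁻¹ t * qPoch (t * (t * w ^ 2)) t)) := by
    have h := theta_inv ht (inv_ne_zero hw2)
    rw [inv_inv] at h
    rw [h, theta, div_inv_eq_mul, qPoch_eq_mul ht (t * w ^ 2)]
    ring
  rw [singleFactor, singleShift, e1, ← Finset.prod_mul_prod_compl K, theta_inv hp hw2, e3]
  rw [e2] at h2 ⊢
  have h3 := left_ne_zero_of_mul h2
  have h4 := right_ne_zero_of_mul h2
  generalize 1 - t * w ^ 2 = A at *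
  generalize qPoch (p * (t * w ^ 2)) p * qPoch (p / (t * w ^ 2)) p = B at *
  field_simp

theorem pairFactor_mul {p t : ℂ} (hp : ‖p‖ < 1) (ht : ‖t‖ < 1) (c : ℂ) {w v : ℂ} (hw : w ≠ 0)
    (hv : v ≠ 0) (h : pm (fun z => theta z p) w v ≠ 0) :
    pairFactor p t w v * (pm (fun z => theta z p) (c * w) v / pm (fun z => theta z p) w v) =
      pairShift p t c w v := by
  rw [pairFactor, pairShift, pm_theta_inv hp hw hv, pm_theta_inv ht hw hv]
  field_simp

/-- Invariance of the weight under y_k ↦ y_k⁻¹ allows w = y_k^ε for both signs. The parameters b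
need only agree with a off K, which covers a itself and its reflection. -/
theorem gaugedWeight_mul_shiftCoeff {n : ℕ} {p t : ℂ} (hp : ‖p‖ < 1) (hp0 : p ≠ 0)
    (ht : ‖t‖ < 1) (ht0 : t ≠ 0) {a : Fin 8 → ℂ} {K : Finset (Fin 8)}
    (haK : ∀ s, s ∉ K → ‖a s‖ < 1) {b : Fin 8 → ℂ} (hb : ∀ s, s ∉ K → b s = a s) (c : ℂ)
    (k : Fin n) {ε : ℤ} (hε : ε = 1 ∨ ε = -1) {y : Fin n → ℂ} (hy : ∀ j, ‖y j‖ = 1)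
    (hgen : Generic p t y) :
    gaugedWeight p t a K y * shiftCoeff p t c b ε k y =
      shiftWeight p t a K b c k (y k ^ ε) y := by
  have hy0 := hgen.1
  obtain ⟨h1, h2, h3⟩ := hgen.coeff_ne_zero hp hp0 ht0 k hε
  have hw : ‖y k ^ ε‖ = 1 := by rw [norm_zpow, hy k, one_zpow]
  have hw0 : y k ^ ε ≠ 0 := zpow_ne_zero _ (hy0 k)
  have e1 : singleFactor p t a K (y k) = singleFactor p t a K (y k ^ ε) :=
    zpow_eq_of_eq_or_inv (P := fun z => singleFactor p t a K (y k) = singleFactor p t a K z) rfl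
      (singleFactor_inv hp ht a K (hy0 k)).symm hε
  have e2 : ∀ l, pairFactor p t (y k) (y l) = pairFactor p t (y k ^ ε) (y l) := fun l =>
    zpow_eq_of_eq_or_inv (P := fun z => pairFactor p t (y k) (y l) = pairFactor p t z (y l)) rfl
      (pairFactor_inv hp ht (hy0 k) (hy0 l)).symm hε
  rw [gaugedWeight_eq hp ht a K k hy0, shiftCoeff, shiftWeight,
    ← singleFactor_mul hp ht ht0 haK hb hw h1 h2, e1,
    Finset.prod_congr rfl fun l _ => e2 l,
    ← Finset.prod_congr rfl fun l hl => pairFactor_mul hp ht c hw0 (hy0 l)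
      (h3 l (Finset.ne_of_mem_erase hl)), Finset.prod_mul_distrib]
  ring

/-- The map w ↦ (tw)⁻¹ exchanges the two Gamma factors for each s ∉ K; for s ∈ K, θ(p/z;p) = θ(z;p)
turns a_s/(tw) into (pt/a_s) w. Hence the reflected parameters. -/
theorem singleShift_inv {p t : ℂ} (hp : p ≠ 0) (ht0 : t ≠ 0) {a : Fin 8 → ℂ}
    (ha : ∀ s, a s ≠ 0) (K : Finset (Fin 8)) {w : ℂ} (hw : w ≠ 0) :
    singleShift p t a K a (t * w)⁻¹ = singleShift p t a K (reflect (p * t) K a) w := by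
  have e1 : ∏ s ∈ Kᶜ, ellGamma (a s * (t * (t * w)⁻¹)) p t * ellGamma (a s * (t * w)⁻¹⁻¹) p t =
      ∏ s ∈ Kᶜ, ellGamma (a s * (t * w)) p t * ellGamma (a s * w⁻¹) p t :=
    Finset.prod_congr rfl fun s _ => by
      rw [inv_inv, mul_inv, mul_inv_cancel_left₀ ht0, mul_comm]
  have e2 : ∏ s ∈ K, theta (a s * (t * w)⁻¹) p = ∏ s ∈ K, theta (reflect (p * t) K a s * w) p :=
    Finset.prod_congr rfl fun s hs => by
      have := ha s
      rw [← theta_div p _ hp, reflect, if_pos hs]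
      congr 1
      field_simp
  have e3 : t * (t * w)⁻¹ ^ 2 = (t * w ^ 2)⁻¹ := by field_simp
  have e4 : (t * w)⁻¹ ^ 2 = (t * (t * w ^ 2))⁻¹ := by field_simp
  have e5 : t * (t * w ^ 2)⁻¹ = (w ^ 2)⁻¹ := by field_simp
  rw [singleShift, singleShift, e1, e2, e3, e4, e5, inv_inv, div_inv_eq_mul, ← div_eq_mul_inv p]
  ring

/-- In nome p, θ(p/z;p) = θ(z;p) turns q/(tw) into pq⁻¹t · w, the source of the coupling pq⁻¹t; in
nome t, quasi-periodicity and inversion suffice. -/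
theorem pairShift_inv {p t : ℂ} (hp0 : p ≠ 0) (ht : ‖t‖ < 1) (ht0 : t ≠ 0)
    {q : ℂ} (hq : q ≠ 0) {w v : ℂ} (hw : w ≠ 0) (hv : v ≠ 0) :
    pairShift p t q (t * w)⁻¹ v = pairShift p t (p * q⁻¹ * t) w v := by
  have e1 : pm (fun z => theta z t) (t * w) v = pm (fun z => theta z t) w⁻¹ v := by
    rw [pm_theta_inv ht hw hv]
    simp only [pm, mul_assoc]
    rw [theta_mul_left ht ht0 (mul_ne_zero hw hv),
      theta_mul_left ht ht0 (mul_ne_zero hw (inv_ne_zero hv))]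
    field_simp
  have e2 : pm (fun z => theta z p) (q * (t * w)⁻¹) v =
      pm (fun z => theta z p) (p * q⁻¹ * t * w) v := by
    simp only [pm]
    rw [← theta_div p _ hp0, ← theta_div p (q * (t * w)⁻¹ * v⁻¹) hp0, mul_comm]
    congr 2 <;> field_simp
  rw [pairShift, pairShift, inv_inv, e1, e2]

theorem shiftWeight_inv {n : ℕ} {p t : ℂ} (hp0 : p ≠ 0) (ht : ‖t‖ < 1) (ht0 : t ≠ 0)
    {a : Fin 8 → ℂ} (ha : ∀ s, a s ≠ 0) (K : Finset (Fin 8)) {q : ℂ} (hq : q ≠ 0) (k : Fin n)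
    {w : ℂ} (hw : w ≠ 0) {y : Fin n → ℂ} (hy : ∀ j, y j ≠ 0) :
    shiftWeight p t a K a q k (t * w)⁻¹ y =
      shiftWeight p t a K (reflect (p * t) K a) (p * q⁻¹ * t) k w y := by
  rw [shiftWeight, shiftWeight, singleShift_inv hp0 ht0 ha K hw,
    Finset.prod_congr rfl fun l _ => pairShift_inv hp0 ht ht0 hq hw (hy l)]

theorem shiftWeight_update {n : ℕ} (p t : ℂ) (a : Fin 8 → ℂ) (K : Finset (Fin 8))
    (b : Fin 8 → ℂ) (c : ℂ) (k : Fin n) (w : ℂ) (y : Fin n → ℂ) (z : ℂ) :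
    shiftWeight p t a K b c k w (Function.update y k z) = shiftWeight p t a K b c k w y := by
  rw [shiftWeight, shiftWeight, restWeight_update]
  congr 2
  exact Finset.prod_congr rfl fun l hl => by
    rw [Function.update_of_ne (Finset.ne_of_mem_erase hl)]


/-! ### Holomorphy of the weights on the torus and on the annulus -/

section Differentiability

variable {X : Type*} [NormedAddCommGroup X] [NormedSpace ℂ X]

theorem differentiableAt_finsetProd {ι : Type*} {S : Finset ι} {f : ι → X → ℂ} {x : X}
    (hf : ∀ i ∈ S, DifferentiableAt ℂ (f i) x) :
    DifferentiableAt ℂ (fun x => ∏ i ∈ S, f i x) x := by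
  classical
  induction S using Finset.induction_on with
  | empty => simp
  | insert i S hi ih =>
    simp only [Finset.prod_insert hi]
    exact (hf i (Finset.mem_insert_self i S)).fun_mul
      (ih fun j hj => hf j (Finset.mem_insert_of_mem hj))

theorem differentiableAt_theta_apply {p : ℂ} (hp : ‖p‖ < 1) {f : X → ℂ} {x : X}
    (hf : DifferentiableAt ℂ f x) (h0 : f x ≠ 0) :
    DifferentiableAt ℂ (fun x => theta (f x) p) x :=
  DifferentiableAt.comp (g := fun z => theta z p) x (differentiableAt_theta hp h0) hf

theorem differentiableAt_pm_theta_apply {p : ℂ} (hp : ‖p‖ < 1) {f g : X → ℂ} {x : X}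
    (hf : DifferentiableAt ℂ f x) (hg : DifferentiableAt ℂ g x) (h0 : f x ≠ 0) (h1 : g x ≠ 0) :
    DifferentiableAt ℂ (fun x => pm (fun z => theta z p) (f x) (g x)) x :=
  (differentiableAt_theta_apply hp (hf.fun_mul hg) (mul_ne_zero h0 h1)).fun_mul
    (differentiableAt_theta_apply hp (hf.fun_mul (hg.fun_inv h1))
      (mul_ne_zero h0 (inv_ne_zero h1)))

theorem differentiableAt_qPoch_apply {p : ℂ} (hp : ‖p‖ < 1) {f : X → ℂ} {x : X}
    (hf : DifferentiableAt ℂ f x) : DifferentiableAt ℂ (fun x => qPoch (f x) p) x :=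
  DifferentiableAt.comp (g := fun z => qPoch z p) x (differentiable_qPoch hp _) hf

theorem differentiableAt_ellGamma_apply {p t : ℂ} (hp : ‖p‖ < 1) (ht : ‖t‖ < 1) {f : X → ℂ}
    {x : X} (hf : DifferentiableAt ℂ f x) (h0 : f x ≠ 0) (h1 : ‖f x‖ < 1) :
    DifferentiableAt ℂ (fun x => ellGamma (f x) p t) x := by
  have h : Differentiable ℂ fun z => qPoch₂ z p t := differentiable_qPoch₂ hp ht
  have hn : DifferentiableAt ℂ (fun x => qPoch₂ (p * t * (f x)⁻¹) p t) x :=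
    DifferentiableAt.comp (g := fun z => qPoch₂ z p t) x (h _)
      ((hf.fun_inv h0).const_mul (p * t))
  have hd : DifferentiableAt ℂ (fun x => (qPoch₂ (f x) p t)⁻¹) x :=
    DifferentiableAt.fun_inv (DifferentiableAt.comp (g := fun z => qPoch₂ z p t) x (h _) hf)
      (qPoch₂_ne_zero_of_norm_lt hp ht h1)
  simpa only [ellGamma, div_eq_mul_inv] using hn.fun_mul hd

theorem differentiableAt_singleFactor {p t : ℂ} (hp : ‖p‖ < 1) (ht : ‖t‖ < 1) {a : Fin 8 → ℂ}
    (ha : ∀ s, a s ≠ 0) {K : Finset (Fin 8)} (haK : ∀ s, s ∉ K → ‖a s‖ < 1) {f : X → ℂ} {x : X}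
    (hf : DifferentiableAt ℂ f x) (h1 : ‖f x‖ = 1) :
    DifferentiableAt ℂ (fun x => singleFactor p t a K (f x)) x := by
  have h0 : f x ≠ 0 := fun h => by simp [h] at h1
  have h2 : f x ^ 2 ≠ 0 := pow_ne_zero 2 h0
  refine (differentiableAt_finsetProd fun s hs => ?_).fun_mul
    ((differentiableAt_theta_apply hp ((hf.fun_pow 2).fun_inv h2) (inv_ne_zero h2)).fun_mul
      (differentiableAt_theta_apply ht (hf.fun_pow 2) h2))
  have hs' := haK s (Finset.mem_compl.1 hs)
  exact (differentiableAt_ellGamma_apply hp ht (hf.const_mul (a s)) (mul_ne_zero (ha s) h0)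
    (by rw [norm_mul, h1, mul_one]; exact hs')).fun_mul
    (differentiableAt_ellGamma_apply hp ht ((hf.fun_inv h0).const_mul (a s))
      (mul_ne_zero (ha s) (inv_ne_zero h0))
      (by rw [norm_mul, norm_inv, h1, inv_one, mul_one]; exact hs'))

theorem differentiableAt_pairFactor {p t : ℂ} (hp : ‖p‖ < 1) (ht : ‖t‖ < 1) {f g : X → ℂ} {x : X}
    (hf : DifferentiableAt ℂ f x) (hg : DifferentiableAt ℂ g x) (h0 : f x ≠ 0) (h1 : g x ≠ 0) :
    DifferentiableAt ℂ (fun x => pairFactor p t (f x) (g x)) x :=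
  (differentiableAt_pm_theta_apply hp (hf.fun_inv h0) hg (inv_ne_zero h0) h1).fun_mul
    (differentiableAt_pm_theta_apply ht hf hg h0 h1)

theorem differentiableAt_pairShift {p t c : ℂ} (hp : ‖p‖ < 1) (ht : ‖t‖ < 1) (hc : c ≠ 0)
    {f g : X → ℂ} {x : X} (hf : DifferentiableAt ℂ f x) (hg : DifferentiableAt ℂ g x)
    (h0 : f x ≠ 0) (h1 : g x ≠ 0) :
    DifferentiableAt ℂ (fun x => pairShift p t c (f x) (g x)) x :=
  (differentiableAt_pm_theta_apply ht (hf.fun_inv h0) hg (inv_ne_zero h0) h1).fun_mul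
    (differentiableAt_pm_theta_apply hp (hf.const_mul c) hg (mul_ne_zero hc h0) h1)

/-- For 1 ≤ |w| ≤ |t|⁻¹ the arguments a_s t w and a_s / w of the Gamma factors with s ∉ K have
modulus below 1, and p t w² and p/(t w²) have modulus at most |p|/|t| < 1, so no denominator
vanishes. -/
theorem differentiableAt_singleShift {p t : ℂ} (ht : ‖t‖ < 1) (ht0 : t ≠ 0) (hpt : ‖p‖ < ‖t‖)
    {a : Fin 8 → ℂ} (ha : ∀ s, a s ≠ 0) {K : Finset (Fin 8)} (haK : ∀ s, s ∉ K → ‖a s‖ < 1)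
    {b : Fin 8 → ℂ} (hb : ∀ s ∈ K, b s ≠ 0) {f : X → ℂ} {x : X} (hf : DifferentiableAt ℂ f x)
    (h1 : 1 ≤ ‖f x‖) (h2 : ‖f x‖ ≤ ‖t‖⁻¹) :
    DifferentiableAt ℂ (fun x => singleShift p t a K b (f x)) x := by
  have hp : ‖p‖ < 1 := hpt.trans ht
  have ht' : 0 < ‖t‖ := norm_pos_iff.2 ht0
  have h0 : f x ≠ 0 := fun h => by simp [h] at h1; linarith
  have hf2 : f x ^ 2 ≠ 0 := pow_ne_zero 2 h0
  have htf : ‖t‖ * ‖f x‖ ≤ 1 := by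
    have := mul_le_mul_of_nonneg_left h2 ht'.le
    rwa [mul_inv_cancel₀ ht'.ne'] at this
  have hd2 : DifferentiableAt ℂ (fun x => t * f x ^ 2) x := (hf.fun_pow 2).const_mul t
  have htf2 : t * f x ^ 2 ≠ 0 := mul_ne_zero ht0 hf2
  have hn1 : ‖t‖ * ‖t * f x ^ 2‖ ≤ 1 := by
    rw [norm_mul, norm_pow]
    nlinarith [mul_nonneg ht'.le (norm_nonneg (f x))]
  have hn2 : ‖t‖ ≤ ‖t * f x ^ 2‖ := by
    rw [norm_mul, norm_pow]
    exact le_mul_of_one_le_right ht'.le (one_le_pow₀ h1)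
  have hn3 : 0 < ‖t * f x ^ 2‖ := norm_pos_iff.2 htf2
  have hne1 : qPoch (p * (t * f x ^ 2)) p ≠ 0 := qPoch_ne_zero_of_norm_lt hp (by
    rw [norm_mul]
    exact (mul_lt_mul_of_pos_right hpt hn3).trans_le hn1)
  have hne2 : qPoch (p * (t * f x ^ 2)⁻¹) p ≠ 0 := qPoch_ne_zero_of_norm_lt hp (by
    rw [norm_mul, norm_inv, ← div_eq_mul_inv, div_lt_one hn3]
    exact hpt.trans_le hn2)
  have hΓ : DifferentiableAt ℂ (fun x => ∏ s ∈ Kᶜ, ellGamma (a s * (t * f x)) p t *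
      ellGamma (a s * (f x)⁻¹) p t) x := by
    refine differentiableAt_finsetProd fun s hs => ?_
    have hs' := haK s (Finset.mem_compl.1 hs)
    have e1 : ‖a s * (t * f x)‖ < 1 := by
      rw [norm_mul, norm_mul]
      exact (mul_le_of_le_one_right (norm_nonneg _) htf).trans_lt hs'
    have e2 : ‖a s * (f x)⁻¹‖ < 1 := by
      rw [norm_mul, norm_inv]
      exact (mul_le_of_le_one_right (norm_nonneg _) (inv_le_one_of_one_le₀ h1)).trans_lt hs'
    exact (differentiableAt_ellGamma_apply hp ht ((hf.const_mul t).const_mul (a s))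
      (mul_ne_zero (ha s) (mul_ne_zero ht0 h0)) e1).fun_mul
      (differentiableAt_ellGamma_apply hp ht ((hf.fun_inv h0).const_mul (a s))
        (mul_ne_zero (ha s) (inv_ne_zero h0)) e2)
  have hθ : DifferentiableAt ℂ (fun x => ∏ s ∈ K, theta (b s * f x) p) x :=
    differentiableAt_finsetProd fun s hs =>
      differentiableAt_theta_apply hp (hf.const_mul (b s)) (mul_ne_zero (hb s hs) h0)
  have hnum : DifferentiableAt ℂ (fun x => qPoch (f x ^ 2)⁻¹ t * qPoch (t * (t * f x ^ 2)) t) x :=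
    (differentiableAt_qPoch_apply ht ((hf.fun_pow 2).fun_inv hf2)).fun_mul
      (differentiableAt_qPoch_apply ht (hd2.const_mul t))
  have hden : DifferentiableAt ℂ (fun x => qPoch (p * (t * f x ^ 2)) p *
      qPoch (p * (t * f x ^ 2)⁻¹) p) x :=
    (differentiableAt_qPoch_apply hp (hd2.const_mul p)).fun_mul
      (differentiableAt_qPoch_apply hp ((hd2.fun_inv htf2).const_mul p))
  have := (hΓ.fun_mul hθ).fun_mul (hnum.fun_mul (hden.fun_inv (mul_ne_zero hne1 hne2)))
  simpa only [singleShift, div_eq_mul_inv] using this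

end Differentiability

theorem differentiableAt_gaugedWeight {n : ℕ} {p t : ℂ} (hp : ‖p‖ < 1) (ht : ‖t‖ < 1)
    {a : Fin 8 → ℂ} (ha : ∀ s, a s ≠ 0) {K : Finset (Fin 8)} (haK : ∀ s, s ∉ K → ‖a s‖ < 1)
    {y : Fin n → ℂ} (hy : ∀ k, ‖y k‖ = 1) : DifferentiableAt ℂ (gaugedWeight p t a K) y := by
  have h0 : ∀ k, y k ≠ 0 := fun k h => by simpa [h] using hy k
  exact (differentiableAt_finsetProd fun k _ => differentiableAt_singleFactor hp ht ha haK
    (differentiableAt_apply k y) (hy k)).fun_mul (differentiableAt_finsetProd fun k _ =>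
    differentiableAt_finsetProd fun l _ => differentiableAt_pairFactor hp ht
    (differentiableAt_apply k y) (differentiableAt_apply l y) (h0 k) (h0 l))

theorem differentiableAt_restWeight {n : ℕ} {p t : ℂ} (hp : ‖p‖ < 1) (ht : ‖t‖ < 1)
    {a : Fin 8 → ℂ} (ha : ∀ s, a s ≠ 0) {K : Finset (Fin 8)} (haK : ∀ s, s ∉ K → ‖a s‖ < 1)
    {k : Fin n} {y : Fin n → ℂ} (hy : ∀ j, j ≠ k → ‖y j‖ = 1) :
    DifferentiableAt ℂ (restWeight p t a K k) y := by
  have h0 : ∀ j, j ≠ k → y j ≠ 0 := fun j hj h => by simpa [h] using hy j hj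
  exact (differentiableAt_finsetProd fun j hj => differentiableAt_singleFactor hp ht ha haK
    (differentiableAt_apply j y) (hy j (Finset.ne_of_mem_erase hj))).fun_mul
    (differentiableAt_finsetProd fun j hj => differentiableAt_finsetProd fun l hl =>
    differentiableAt_pairFactor hp ht (differentiableAt_apply j y) (differentiableAt_apply l y)
    (h0 j (Finset.ne_of_mem_erase hj)) (h0 l (Finset.ne_of_mem_erase hl)))

theorem differentiableAt_shiftWeight {n : ℕ} {p t : ℂ} (ht : ‖t‖ < 1) (ht0 : t ≠ 0)
    (hpt : ‖p‖ < ‖t‖) {a : Fin 8 → ℂ} (ha : ∀ s, a s ≠ 0) {K : Finset (Fin 8)}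
    (haK : ∀ s, s ∉ K → ‖a s‖ < 1) {b : Fin 8 → ℂ} (hb : ∀ s ∈ K, b s ≠ 0) {c : ℂ} (hc : c ≠ 0)
    {k : Fin n} {ε : ℤ} {y : Fin n → ℂ} (hy : ∀ j, j ≠ k → ‖y j‖ = 1) (h1 : 1 ≤ ‖y k ^ ε‖)
    (h2 : ‖y k ^ ε‖ ≤ ‖t‖⁻¹) (hk : y k ≠ 0) :
    DifferentiableAt ℂ (fun y => shiftWeight p t a K b c k (y k ^ ε) y) y := by
  have hp : ‖p‖ < 1 := hpt.trans ht
  have h0 : ∀ j, j ≠ k → y j ≠ 0 := fun j hj h => by simpa [h] using hy j hj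
  have hw : DifferentiableAt ℂ (fun y : Fin n → ℂ => y k ^ ε) y :=
    (differentiableAt_apply k y).zpow (Or.inl hk)
  exact ((differentiableAt_singleShift ht ht0 hpt ha haK hb hw h1 h2).fun_mul
    (differentiableAt_finsetProd fun l hl => differentiableAt_pairShift hp ht hc hw
      (differentiableAt_apply l y) (zpow_ne_zero _ hk) (h0 l (Finset.ne_of_mem_erase hl)))).fun_mul
    (differentiableAt_restWeight hp ht ha haK hy)


/-! ### Generic points and continuity on the torus -/

theorem PoleGeneric.generic {n : ℕ} {p q t : ℂ} {y : Fin n → ℂ} (h : PoleGeneric p q t y) :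
    Generic p t y :=
  ⟨h.ne_zero, fun k i => ⟨h.sq k i, h.right k i, h.right' k i⟩,
    fun k l hkl i => ⟨h.mul k l hkl i, h.ratio k l hkl i⟩⟩

theorem ae_poleGeneric {n : ℕ} {p q t : ℂ} (hq : q ≠ 0) (ht : t ≠ 0) :
    ∀ᵐ θ : Fin n → ℝ, PoleGeneric p q t (torusPoint θ) := by
  have hZ : ((Set.range fun k : ℤ => p ^ k) ∪ (Set.range fun k : ℤ => q * p ^ k) ∪
      (Set.range fun k : ℤ => q⁻¹ * p ^ k) ∪ (Set.range fun k : ℤ => t * p ^ k) ∪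
      (Set.range fun k : ℤ => t⁻¹ * p ^ k)).Countable :=
    ((((Set.countable_range _).union (Set.countable_range _)).union
      (Set.countable_range _)).union (Set.countable_range _)).union (Set.countable_range _)
  filter_upwards [ae_avoids hZ] with θ h
  simp only [Avoids, Set.mem_union, Set.mem_range, not_or, not_exists] at h
  obtain ⟨h1, h2⟩ := h
  refine ⟨torusPoint_ne_zero θ, fun w k e => (h1 w).2.1.1.1.1 k e.symm, fun w k e => ?_,
    fun w k e => (h1 w).2.1.1.1.2 k e.symm, fun w k e => ?_,
    fun w k e => (h1 w).2.1.2 k e.symm, fun w w' hw k e => (h2 w w' hw).1.1.1.1.1 k e.symm,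
    fun w w' hw k e => (h2 w w' hw).2.1.1.1.1 k ?_⟩
  · exact (h1 w).2.1.1.2 k (by rw [← e, inv_mul_cancel_left₀ hq])
  · exact (h1 w).2.2 k (by rw [← e, inv_mul_cancel_left₀ ht])
  · rw [e, mul_assoc, mul_inv_cancel₀ (torusPoint_ne_zero θ w'), mul_one]

theorem ae_weight_mul_gauge_eq {n : ℕ} {p q t : ℂ} (hp : ‖p‖ < 1) (hp0 : p ≠ 0) (ht : ‖t‖ < 1)
    (ht0 : t ≠ 0) (hq : q ≠ 0) {a : Fin 8 → ℂ} (ha : ∀ s, a s ≠ 0) (K : Finset (Fin 8)) :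
    ∀ᵐ θ : Fin n → ℝ, weight p t q a (torusPoint θ) * gaugeU p t a K (torusPoint θ) *
      gaugeV p t q (torusPoint θ) = gaugedWeight p t a K (torusPoint θ) := by
  have hΓ := countable_setOf_ellGamma_eq_zero hp ht hp0 ht0
  have hmul : ∀ b : ℂ, b ≠ 0 → ({z | ellGamma (b * z) p t = 0} ∪
      {z | ellGamma (b * z⁻¹) p t = 0}).Countable := fun b hb =>
    (hΓ.preimage fun x y e => mul_left_cancel₀ hb e).union
      (hΓ.preimage fun x y e => inv_injective (mul_left_cancel₀ hb e))
  have h1 := ae_all_iff.2 fun s => ae_avoids (n := n) (hmul (a s) (ha s))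
  filter_upwards [h1, ae_avoids (hmul q hq)] with θ h1 h2
  simp only [Avoids, Set.mem_union, Set.mem_ofPred_eq, not_or] at h1 h2
  refine weight_mul_gauge_eq hp ht a K (norm_torusPoint θ)
    (fun k s _ => mul_ne_zero ((h1 s).1 k).1.1 ((h1 s).1 k).1.2) fun k l hkl => ?_
  have h3 := h2.2 k l hkl
  simp only [mul_inv, inv_inv, ← mul_assoc] at h3
  exact mul_ne_zero (mul_ne_zero h3.1.1 h3.2.1) (mul_ne_zero h3.2.2 h3.1.2)

theorem torusAngleIntegral_congr_ae {n : ℕ} {f g : (Fin n → ℂ) → ℂ}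
    (h : ∀ᵐ θ : Fin n → ℝ, f (torusPoint θ) = g (torusPoint θ)) :
    torusAngleIntegral f = torusAngleIntegral g :=
  integral_congr_ae (ae_restrict_of_ae h)

theorem continuous_gaugedWeight_torusPoint {n : ℕ} {p t : ℂ} (hp : ‖p‖ < 1) (ht : ‖t‖ < 1)
    {a : Fin 8 → ℂ} (ha : ∀ s, a s ≠ 0) {K : Finset (Fin 8)} (haK : ∀ s, s ∉ K → ‖a s‖ < 1) :
    Continuous fun θ : Fin n → ℝ => gaugedWeight p t a K (torusPoint θ) :=
  continuous_iff_continuousAt.2 fun θ => ContinuousAt.comp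
    (differentiableAt_gaugedWeight hp ht ha haK (norm_torusPoint θ)).continuousAt
    continuous_torusPoint.continuousAt

/-- For |y_k| = 1 a denominator of A^0 can vanish only if |t| is an integral power of |p|, which |p|
< |t| < 1 rules out. -/
theorem continuous_zeroCoeff_torusPoint {n : ℕ} {p q t : ℂ} (hp0 : p ≠ 0) (ht : ‖t‖ < 1)
    (ht0 : t ≠ 0) (hpt : ‖p‖ < ‖t‖) (hq : q ≠ 0) (a : Fin 8 → ℂ) (r : ℂ) :
    Continuous fun θ : Fin n → ℝ => zeroCoeff p t q a r (torusPoint θ) := by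
  have hp1 : 0 < ‖p‖ := norm_pos_iff.2 hp0
  have hpz : ∀ k : ℤ, ‖t‖ ≠ ‖p‖ ^ k := fun k e => by
    rcases lt_or_ge k 1 with hk | hk
    · have h1 : (1 : ℝ) ≤ ‖p‖ ^ k := by
        rw [← zpow_zero ‖p‖]
        exact zpow_le_zpow_right_of_le_one₀ hp1 (hpt.trans ht).le (by omega)
      linarith
    · have h1 : ‖p‖ ^ k ≤ ‖p‖ := by
        simpa using zpow_le_zpow_right_of_le_one₀ hp1 (hpt.trans ht).le hk
      linarith
  refine continuous_iff_continuousAt.2 fun θ => ContinuousAt.comp (g := zeroCoeff p t q a r)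
    (continuousAt_zeroCoeff (hpt.trans ht) hp0 ht0 hq a r (torusPoint_ne_zero θ) (fun i k e => ?_)
      fun i k e => ?_) continuous_torusPoint.continuousAt
  · have := congrArg norm e
    rw [norm_mul, norm_pow, norm_torusPoint, one_pow, mul_one, norm_zpow] at this
    exact hpz k this
  · have := congrArg norm e
    rw [norm_mul, norm_pow, norm_torusPoint, one_pow, norm_zpow] at this
    refine hpz (-k) ?_
    rw [zpow_neg, eq_inv_of_mul_eq_one_left this.symm]

theorem torusPoint_mem_annulus {n : ℕ} {t : ℂ} (ht : ‖t‖ < 1) (ht0 : t ≠ 0) (θ : Fin n → ℝ) :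
    torusPoint θ ∈ annulus n ‖t‖ := fun k => by
  rw [norm_torusPoint]
  exact ⟨ht.le, (one_le_inv₀ (norm_pos_iff.2 ht0)).2 ht.le⟩

theorem shift_mem_annulus {n : ℕ} {t : ℂ} (ht : ‖t‖ < 1) (ht0 : t ≠ 0) {ε : ℤ}
    (hε : ε = 1 ∨ ε = -1) (k : Fin n) (θ : Fin n → ℝ) :
    shift t ε k (torusPoint θ) ∈ annulus n ‖t‖ := fun j => by
  have ht' := norm_pos_iff.2 ht0
  have h1 := (one_le_inv₀ ht').2 ht.le
  rcases eq_or_ne j k with rfl | hj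
  · rw [shift, Function.update_self, norm_mul, norm_torusPoint, mul_one]
    rcases hε with rfl | rfl
    · rw [zpow_one]; exact ⟨le_rfl, ht.le.trans h1⟩
    · rw [zpow_neg_one, norm_inv]; exact ⟨ht.le.trans h1, le_rfl⟩
  · rw [shift, Function.update_of_ne hj]
    exact torusPoint_mem_annulus ht ht0 θ j

theorem shift_shift {n : ℕ} {t : ℂ} (ht0 : t ≠ 0) (ε : ℤ) (k : Fin n) (y : Fin n → ℂ) :
    shift t ε k (shift t (-ε) k y) = y := by
  rw [shift, shift, Function.update_idem, Function.update_self, zpow_neg,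
    mul_inv_cancel_left₀ (zpow_ne_zero ε ht0), Function.update_eq_self]


/-! ### Moving the contour -/

/-- Substituting t^{−ε} y_k for y_k undoes the shift in the kernel and puts it on φ. The coefficient
is then taken at (t y_k^{−ε})⁻¹, where `shiftWeight_inv` yields the reflected one. In between, 1 ≤
|y_k^ε| ≤ |t|⁻¹, and there the integrand is holomorphic by `differentiableAt_shiftWeight` and
because φ is holomorphic on the closed annulus. -/
theorem contour_shift {m n : ℕ} {p q t : ℂ} (hp0 : p ≠ 0) (hq : q ≠ 0) (ht : ‖t‖ < 1)
    (ht0 : t ≠ 0) (hpt : ‖p‖ < ‖t‖) {a : Fin 8 → ℂ} (ha : ∀ s, a s ≠ 0) {K : Finset (Fin 8)}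
    (haK : ∀ s, s ∉ K → ‖a s‖ < 1) {Ω : Set (Fin n → ℂ)} (hΩ : IsOpen Ω)
    (hann : annulus n ‖t‖ ⊆ Ω) {φ : (Fin n → ℂ) → ℂ} (hφ : DifferentiableOn ℂ φ Ω)
    {x : Fin m → ℂ} (hx : ∀ i, x i ≠ 0) (k : Fin n) {ε : ℤ} (hε : ε = 1 ∨ ε = -1) :
    (Continuous fun θ => shiftWeight p t a K a q k (torusPoint θ k ^ ε) (torusPoint θ) *
      dualKernel p x (shift t ε k (torusPoint θ)) * φ (torusPoint θ)) ∧
    (Continuous fun θ => shiftWeight p t a K (reflect (p * t) K a) (p * q⁻¹ * t) k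
      (torusPoint θ k ^ (-ε)) (torusPoint θ) * dualKernel p x (torusPoint θ) *
        φ (shift t (-ε) k (torusPoint θ))) ∧
    torusAngleIntegral (fun y => shiftWeight p t a K a q k (y k ^ ε) y *
      dualKernel p x (shift t ε k y) * φ y) =
    torusAngleIntegral (fun y => shiftWeight p t a K (reflect (p * t) K a) (p * q⁻¹ * t) k
      (y k ^ (-ε)) y * dualKernel p x y * φ (shift t (-ε) k y)) := by
  have hp : ‖p‖ < 1 := hpt.trans ht
  have ht' : 0 < ‖t‖ := norm_pos_iff.2 ht0
  have hti : 1 ≤ ‖t‖⁻¹ := (one_le_inv₀ ht').2 ht.le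
  set H : (Fin n → ℂ) → ℂ := fun y => shiftWeight p t a K a q k (y k ^ ε) y *
    dualKernel p x (shift t ε k y) * φ y with hH
  have hdiff : ∀ y : Fin n → ℂ, (∀ j, j ≠ k → ‖y j‖ = 1) → 1 ≤ ‖y k ^ ε‖ →
      ‖y k ^ ε‖ ≤ ‖t‖⁻¹ → DifferentiableAt ℂ H y := by
    intro y hy h1 h2
    have hk : y k ≠ 0 := fun h => by
      rw [h, zero_zpow _ (by omega), norm_zero] at h1
      linarith
    have hy0 : ∀ j, y j ≠ 0 := fun j => by
      rcases eq_or_ne j k with rfl | hj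
      · exact hk
      · exact fun h => by simpa [h] using hy j hj
    have hmem : y ∈ annulus n ‖t‖ := fun j => by
      rcases eq_or_ne j k with rfl | hj
      · have hj' : 0 < ‖y j‖ := norm_pos_iff.2 hk
        rcases hε with rfl | rfl
        · rw [zpow_one] at h1 h2
          exact ⟨ht.le.trans h1, h2⟩
        · rw [zpow_neg_one, norm_inv] at h1 h2
          exact ⟨(inv_le_inv₀ hj' ht').1 h2, ((one_le_inv₀ hj').1 h1).trans hti⟩
      · rw [hy j hj]
        exact ⟨ht.le, hti⟩
    have hs : ContDiffAt ℂ 1 (shift t ε k) y := by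
      refine contDiffAt_pi.2 fun j => ?_
      rcases eq_or_ne j k with rfl | hj
      · simp only [shift, Function.update_self]
        exact contDiffAt_const.mul ((contDiff_apply ℂ ℂ j).contDiffAt)
      · simp only [shift, Function.update_of_ne hj]
        exact (contDiff_apply ℂ ℂ j).contDiffAt
    exact ((differentiableAt_shiftWeight ht ht0 hpt ha haK (fun s _ => ha s) hq hy h1 h2 hk).fun_mul
      ((contDiffAt_dualKernel hp contDiffAt_const hs hx
        (shift_ne_zero ht0 ε k hy0)).differentiableAt one_ne_zero)).fun_mul
      (hφ.differentiableAt (hΩ.mem_nhds (hann hmem)))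
  have hHs : ∀ y : Fin n → ℂ, (∀ j, y j ≠ 0) → H (Function.update y k (t ^ (-ε) * y k)) =
      shiftWeight p t a K (reflect (p * t) K a) (p * q⁻¹ * t) k (y k ^ (-ε)) y *
        dualKernel p x y * φ (shift t (-ε) k y) := by
    intro y hy
    have e : (t ^ (-ε) * y k) ^ ε = (t * y k ^ (-ε))⁻¹ := by
      rcases hε with rfl | rfl
      · simp [mul_comm]
      · simp [mul_comm]
    have e2 : dualKernel p x (shift t ε k (Function.update y k (t ^ (-ε) * y k))) =
        dualKernel p x y := congrArg _ (shift_shift ht0 ε k y)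
    simp only [hH]
    rw [shiftWeight_update, Function.update_self, e, e2,
      shiftWeight_inv hp0 ht ht0 ha K hq k (zpow_ne_zero _ (hy k)) hy]
    rfl
  have hc : t ^ (-ε) ≠ 0 := zpow_ne_zero _ ht0
  have h1 : Continuous fun θ => H (torusPoint θ) := continuous_iff_continuousAt.2 fun θ =>
    ContinuousAt.comp (hdiff _ (fun j _ => norm_torusPoint θ j)
      (by rw [norm_zpow, norm_torusPoint, one_zpow])
      (by rw [norm_zpow, norm_torusPoint, one_zpow]; exact hti)).continuousAt
      continuous_torusPoint.continuousAt
  have hεε : ε * ε = 1 := by rcases hε with rfl | rfl <;> rfl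
  have h2 : Continuous fun θ => H (Function.update (torusPoint θ) k (t ^ (-ε) * torusPoint θ k)) := by
    refine continuous_iff_continuousAt.2 fun θ => ContinuousAt.comp (g := H)
      (f := fun θ => shift t (-ε) k (torusPoint θ))
      (hdiff _ (fun j hj => ?_) ?_ ?_).continuousAt
      ((continuous_shift t (-ε) k).comp continuous_torusPoint).continuousAt
    · rw [shift, Function.update_of_ne hj, norm_torusPoint]
    all_goals
      rw [shift, Function.update_self, mul_zpow, ← zpow_mul, neg_mul, hεε, norm_mul, norm_zpow,
        norm_zpow, norm_torusPoint, one_zpow, mul_one, zpow_neg_one]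
    exact hti
  have h3 : (fun θ => H (Function.update (torusPoint θ) k (t ^ (-ε) * torusPoint θ k))) =
      fun θ => shiftWeight p t a K (reflect (p * t) K a) (p * q⁻¹ * t) k
      (torusPoint θ k ^ (-ε)) (torusPoint θ) * dualKernel p x (torusPoint θ) *
        φ (shift t (-ε) k (torusPoint θ)) := funext fun θ => hHs _ (torusPoint_ne_zero θ)
  refine ⟨h1, h3 ▸ h2, ?_⟩
  rw [← torusAngleIntegral_shift k hc h1 h2 fun y hy z hz => ?_]
  · exact integral_congr_ae (Filter.Eventually.of_forall fun θ => hHs _ (torusPoint_ne_zero θ))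
  · have hd : DifferentiableAt ℂ H (Function.update y k z) := by
      refine hdiff _ (fun j hj => by rw [Function.update_of_ne hj, hy j]) ?_ ?_
      all_goals
        rw [Function.update_self]
        obtain ⟨hz1, hz2⟩ := hz
        rcases hε with rfl | rfl
      · simpa [hti] using hz1
      · rw [neg_neg, zpow_one, max_eq_left ht.le] at hz2
        rw [neg_neg, zpow_one, min_eq_right ht.le] at hz1
        rw [zpow_neg_one, norm_inv]
        exact (one_le_inv₀ (ht'.trans_le hz1)).2 hz2
      · simpa [hti] using hz2
      · rw [neg_neg, zpow_one, min_eq_right ht.le] at hz1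
        rw [zpow_neg_one, norm_inv]
        exact inv_anti₀ ht' hz1
    exact (DifferentiableAt.comp z hd
      (hasFDerivAt_update y z).differentiableAt).differentiableWithinAt

theorem dualTransform_eq {m n : ℕ} {p q t : ℂ} (hp : ‖p‖ < 1) (hp0 : p ≠ 0) (hq : q ≠ 0)
    (ht : ‖t‖ < 1) (ht0 : t ≠ 0) {a : Fin 8 → ℂ} (ha : ∀ s, a s ≠ 0) (K : Finset (Fin 8))
    (φ : (Fin n → ℂ) → ℂ) (x : Fin m → ℂ) :
    dualTransform p q t a K φ x = ((2 * (Real.pi : ℂ)) ^ n)⁻¹ *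
      torusAngleIntegral fun y => gaugedWeight p t a K y * φ y * dualKernel p x y := by
  rw [dualTransform, omegaIntegral_eq]
  congr 1
  refine torusAngleIntegral_congr_ae ?_
  filter_upwards [ae_weight_mul_gauge_eq hp hp0 ht ht0 hq ha K] with θ h
  rw [dualIntegrand, ← h]
  ring

theorem continuous_phi_torusPoint {n : ℕ} {t : ℂ} (ht : ‖t‖ < 1) (ht0 : t ≠ 0)
    {Ω : Set (Fin n → ℂ)} (hΩ : IsOpen Ω) (hann : annulus n ‖t‖ ⊆ Ω) {φ : (Fin n → ℂ) → ℂ}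
    (hφ : DifferentiableOn ℂ φ Ω) : Continuous fun θ => φ (torusPoint θ) :=
  continuous_iff_continuousAt.2 fun θ => ContinuousAt.comp
    (hφ.differentiableAt (hΩ.mem_nhds (hann (torusPoint_mem_annulus ht ht0 θ)))).continuousAt
    continuous_torusPoint.continuousAt


/-! ### Transposition of the operator in y and the eigenvalue equation -/

theorem torusAngleIntegral_add_sum {n : ℕ} {ι κ : Type*} {S : Finset ι} {T : Finset κ}
    {g : (Fin n → ℂ) → ℂ} {f : ι → κ → (Fin n → ℂ) → ℂ}
    (hg : Continuous fun θ => g (torusPoint θ))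
    (hf : ∀ i ∈ S, ∀ j ∈ T, Continuous fun θ => f i j (torusPoint θ)) :
    torusAngleIntegral (fun y => g y + ∑ i ∈ S, ∑ j ∈ T, f i j y) =
      torusAngleIntegral g + ∑ i ∈ S, ∑ j ∈ T, torusAngleIntegral (f i j) := by
  have h1 : ∀ i ∈ S, Continuous fun θ => ∑ j ∈ T, f i j (torusPoint θ) := fun i hi =>
    continuous_finsetSum T (hf i hi)
  simp only [torusAngleIntegral]
  rw [integral_add (integrableOn_torus hg) (integrableOn_torus (continuous_finsetSum S h1)),
    integral_finsetSum S fun i hi => integrableOn_torus (h1 i hi)]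
  exact congrArg _ (Finset.sum_congr rfl fun i hi =>
    integral_finsetSum T fun j hj => integrableOn_torus (hf i hi j hj))

theorem torusAngleIntegral_const_mul {n : ℕ} (c : ℂ) (f : (Fin n → ℂ) → ℂ) :
    torusAngleIntegral (fun y => c * f y) = c * torusAngleIntegral f :=
  integral_const_mul _ _

theorem vanDiejen_torusAngleIntegral {m n : ℕ} {p q t : ℂ} (hp : ‖p‖ < 1) (hq : q ≠ 0)
    (a : Fin 8 → ℂ) (r : ℂ) {W : (Fin n → ℂ) → ℂ} (hW : Continuous fun θ => W (torusPoint θ))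
    {x : Fin m → ℂ} (hx : ∀ i, x i ≠ 0) :
    vanDiejen p q t a r (fun x => torusAngleIntegral fun y => W y * dualKernel p x y) x =
      torusAngleIntegral fun y => W y * vanDiejen p q t a r (fun x => dualKernel p x y) x := by
  have hc : ∀ x : Fin m → ℂ, (∀ i, x i ≠ 0) →
      Continuous fun θ => W (torusPoint θ) * dualKernel p x (torusPoint θ) := fun x hx =>
    hW.mul (continuous_dualKernel_torusPoint hp hx)
  have hs : ∀ (i : Fin m) (ε : ℤ), Continuous fun θ => shiftCoeff p q t a ε i x *
      (W (torusPoint θ) * dualKernel p (shift q ε i x) (torusPoint θ)) := fun i ε =>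
    continuous_const.mul (hc _ (shift_ne_zero hq ε i hx))
  have e : ∀ y, W y * vanDiejen p q t a r (fun x => dualKernel p x y) x =
      zeroCoeff p q t a r x * (W y * dualKernel p x y) + ∑ i, ∑ ε ∈ ({1, -1} : Finset ℤ),
        shiftCoeff p q t a ε i x * (W y * dualKernel p (shift q ε i x) y) := fun y => by
    rw [vanDiejen, mul_add, Finset.mul_sum]
    simp only [Finset.mul_sum]
    refine congrArg₂ _ (mul_left_comm _ _ _) (Finset.sum_congr rfl fun i _ =>
      Finset.sum_congr rfl fun ε _ => mul_left_comm _ _ _)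
  simp only [e]
  rw [torusAngleIntegral_add_sum (continuous_const.mul (hc x hx)) fun i _ ε _ => hs i ε,
    torusAngleIntegral_const_mul, vanDiejen]
  exact congrArg _ (Finset.sum_congr rfl fun i _ => Finset.sum_congr rfl fun ε _ =>
    (torusAngleIntegral_const_mul _ _).symm)

/-- The zeroth order parts agree pointwise by `zeroCoeff_reflect`, and `contour_shift` takes the
shift term of sign ε on the left to the one of sign −ε on the right. The pairing is bilinear,
without complex conjugation. -/
theorem torusAngleIntegral_adjoint {m n : ℕ} {p q t : ℂ} (hp0 : p ≠ 0) (hq : q ≠ 0)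
    (ht : ‖t‖ < 1) (ht0 : t ≠ 0) (hpt : ‖p‖ < ‖t‖) {a : Fin 8 → ℂ} (ha : ∀ s, a s ≠ 0)
    {K : Finset (Fin 8)} (hK : Even K.card) (haK : ∀ s, s ∉ K → ‖a s‖ < 1) {r : ℂ} (hr : r ≠ 0)
    {Ω : Set (Fin n → ℂ)} (hΩ : IsOpen Ω) (hann : annulus n ‖t‖ ⊆ Ω)
    {φ : (Fin n → ℂ) → ℂ} (hφ : DifferentiableOn ℂ φ Ω) {x : Fin m → ℂ} (hx : ∀ i, x i ≠ 0) :
    torusAngleIntegral (fun y => gaugedWeight p t a K y * φ y *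
      vanDiejen p t q a r (fun y => dualKernel p x y) y) =
    torusAngleIntegral (fun y => gaugedWeight p t a K y * dualKernel p x y *
      vanDiejen p t (p * q⁻¹ * t) (reflect (p * t) K a) (reflectRoot (p * t) K a r) φ y) := by
  have hp : ‖p‖ < 1 := hpt.trans ht
  have hgen := ae_poleGeneric (n := n) (p := p) hq ht0
  set H : ℤ → Fin n → (Fin n → ℂ) → ℂ := fun ε k y => shiftWeight p t a K a q k (y k ^ ε) y *
    dualKernel p x (shift t ε k y) * φ y with hH
  set H' : ℤ → Fin n → (Fin n → ℂ) → ℂ := fun ε k y =>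
    shiftWeight p t a K (reflect (p * t) K a) (p * q⁻¹ * t) k (y k ^ ε) y *
      dualKernel p x y * φ (shift t ε k y) with hH'
  set Z : (Fin n → ℂ) → ℂ := fun y =>
    gaugedWeight p t a K y * φ y * (zeroCoeff p t q a r y * dualKernel p x y) with hZ
  have hcs := fun (k : Fin n) {ε : ℤ} (hε : ε = 1 ∨ ε = -1) =>
    contour_shift (m := m) hp0 hq ht ht0 hpt ha haK hΩ hann hφ hx k hε
  have hmem : ∀ ε ∈ ({1, -1} : Finset ℤ), ε = 1 ∨ ε = -1 := fun ε h => by simpa using h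
  have hHc : ∀ k, ∀ ε ∈ ({1, -1} : Finset ℤ), Continuous fun θ => H ε k (torusPoint θ) :=
    fun k ε hε => (hcs k (hmem ε hε)).1
  have hHc' : ∀ k, ∀ ε ∈ ({1, -1} : Finset ℤ), Continuous fun θ => H' ε k (torusPoint θ) :=
    fun k ε hε => by
      have := (hcs k (ε := -ε) (by rcases hmem ε hε with rfl | rfl <;> simp)).2.1
      simpa only [neg_neg] using this
  have hZc : Continuous fun θ => Z (torusPoint θ) :=
    ((continuous_gaugedWeight_torusPoint hp ht ha haK).mul
      (continuous_phi_torusPoint ht ht0 hΩ hann hφ)).mul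
      ((continuous_zeroCoeff_torusPoint hp0 ht ht0 hpt hq a r).mul
        (continuous_dualKernel_torusPoint hp hx))
  have h1 : torusAngleIntegral (fun y => gaugedWeight p t a K y * φ y *
      vanDiejen p t q a r (fun y => dualKernel p x y) y) =
      torusAngleIntegral fun y => Z y + ∑ k, ∑ ε ∈ ({1, -1} : Finset ℤ), H ε k y := by
    refine torusAngleIntegral_congr_ae ?_
    filter_upwards [hgen] with θ hθ
    rw [vanDiejen, mul_add, Finset.mul_sum]
    refine congrArg _ (Finset.sum_congr rfl fun k _ => ?_)
    rw [Finset.mul_sum]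
    refine Finset.sum_congr rfl fun ε hε => ?_
    simp only [hH]
    rw [← gaugedWeight_mul_shiftCoeff hp hp0 ht ht0 haK (fun _ _ => rfl) q k (hmem ε hε)
      (norm_torusPoint θ) hθ.generic]
    ring
  have h2 : torusAngleIntegral (fun y => gaugedWeight p t a K y * dualKernel p x y *
      vanDiejen p t (p * q⁻¹ * t) (reflect (p * t) K a) (reflectRoot (p * t) K a r) φ y) =
      torusAngleIntegral fun y => Z y + ∑ k, ∑ ε ∈ ({1, -1} : Finset ℤ), H' ε k y := by
    refine torusAngleIntegral_congr_ae ?_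
    filter_upwards [hgen] with θ hθ
    rw [vanDiejen, zeroCoeff_reflect hp hp0 hq ht0 ha hK hr (torusPoint_ne_zero θ), mul_add,
      Finset.mul_sum]
    refine congrArg₂ _ (by simp only [hZ]; ring) (Finset.sum_congr rfl fun k _ => ?_)
    rw [Finset.mul_sum]
    refine Finset.sum_congr rfl fun ε hε => ?_
    simp only [hH']
    rw [← gaugedWeight_mul_shiftCoeff hp hp0 ht ht0 haK
      (b := reflect (p * t) K a) (fun s hs => if_neg hs) (p * q⁻¹ * t) k
      (hmem ε hε) (norm_torusPoint θ) hθ.generic]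
    ring
  rw [h1, h2, torusAngleIntegral_add_sum (f := fun k ε => H ε k) hZc fun k _ => hHc k,
    torusAngleIntegral_add_sum (f := fun k ε => H' ε k) hZc fun k _ => hHc' k]
  have h3 : ∀ k, torusAngleIntegral (H 1 k) = torusAngleIntegral (H' (-1) k) := fun k =>
    (hcs k (ε := 1) (Or.inl rfl)).2.2
  have h4 : ∀ k, torusAngleIntegral (H (-1) k) = torusAngleIntegral (H' 1 k) := fun k => by
    have h := (hcs k (ε := -1) (Or.inr rfl)).2.2
    rwa [neg_neg] at h
  clear_value H H' Z
  congr 1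
  refine Finset.sum_congr rfl fun k _ => ?_
  rw [Finset.sum_pair (by decide), Finset.sum_pair (by decide), h3, h4, add_comm]

theorem vanDiejen_const_mul {m : ℕ} (p q t : ℂ) (a : Fin 8 → ℂ) (r c : ℂ) (f : (Fin m → ℂ) → ℂ)
    (x : Fin m → ℂ) :
    vanDiejen p q t a r (fun x => c * f x) x = c * vanDiejen p q t a r f x := by
  simp only [vanDiejen, mul_add, Finset.mul_sum, mul_left_comm c]

end VanDiejen

theorem theorem2p10 (m n : ℕ) (hm : 1 ≤ m) (hn : 1 ≤ n)
    (p q t : ℂ) (hp : p ≠ 0) (hq : q ≠ 0) (ht : t ≠ 0)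
    (a : Fin 8 → ℂ) (ha : ∀ s, a s ≠ 0)
    (K : Finset (Fin 8)) (hK : Even K.card)
    (ht1 : ‖t‖ < 1) (hpt : ‖p‖ < ‖t‖)
    (hpK : K = ∅ → ‖p‖ < ‖q ^ (n - 1) * t ^ (m - 1)‖)
    (haK : ∀ s, s ∉ K → ‖a s‖ < 1)
    -- the operators are defined: the denominators that only contain parameters do not vanish
    (hθq : VanDiejen.theta q p ≠ 0) (hθqt : VanDiejen.theta (q⁻¹ * t) p ≠ 0)
    -- the balancing condition, and the square root of the product of the parameters
    (hbal : (∏ s, a s) * q ^ (2 * n) * t ^ (2 * m) = p ^ 2 * q ^ 2 * t ^ 2)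
    (r : ℂ) (hr : r ^ 2 = ∏ s, a s) (hbranch : r * q ^ n * t ^ m = p * q * t)
    -- the given eigenfunction
    (Ω : Set (Fin n → ℂ)) (hΩ : IsOpen Ω) (hann : VanDiejen.annulus n ‖t‖ ⊆ Ω)
    (φ : (Fin n → ℂ) → ℂ) (hφ : DifferentiableOn ℂ φ Ω) (Λ : ℂ)
    (heig : ∀ y ∈ Ω, VanDiejen.Generic p t y →
      (∀ k, VanDiejen.shift t 1 k y ∈ Ω ∧ VanDiejen.shift t (-1) k y ∈ Ω) →
      VanDiejen.vanDiejen p t (p * q⁻¹ * t) (VanDiejen.reflect (p * t) K a)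
        (VanDiejen.reflectRoot (p * t) K a r) φ y = Λ * φ y) :
    (∀ x : Fin m → ℂ, (∀ i, x i ≠ 0) →
      TorusIntegrable (VanDiejen.omegaDensity (VanDiejen.dualIntegrand p q t a K φ x))
        0 (fun _ => 1)) ∧
    DifferentiableOn ℂ (VanDiejen.dualTransform (m := m) p q t a K φ) {x | ∀ i, x i ≠ 0} ∧
    ∀ x : Fin m → ℂ, VanDiejen.Generic p q x →
      VanDiejen.vanDiejen p q t a r (VanDiejen.dualTransform p q t a K φ) x =
        -((q ^ n)⁻¹ * t ^ m * VanDiejen.theta q p / VanDiejen.theta t p * Λ) *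
          VanDiejen.dualTransform p q t a K φ x := by
  open VanDiejen MeasureTheory in
  have hp1 : ‖p‖ < 1 := hpt.trans ht1
  have hθt : theta t p ≠ 0 := theta_ne_zero_of_norm hp1 ht1 hpt
  have hr0 : r ≠ 0 := fun h => Finset.prod_ne_zero_iff.2 (fun s _ => ha s) (by
    rw [← hr, h, zero_pow two_ne_zero] : ∏ s, a s = 0)
  have hW : Continuous fun θ : Fin n → ℝ =>
      gaugedWeight p t a K (torusPoint θ) * φ (torusPoint θ) :=
    (continuous_gaugedWeight_torusPoint hp1 ht1 ha haK).mul
      (continuous_phi_torusPoint ht1 ht hΩ hann hφ)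
  have hdual := dualTransform_eq (m := m) (n := n) hp1 hp hq ht1 ht ha K φ
  refine ⟨fun x hx => torusIntegrable_omegaDensity ?_, ?_, fun x hx => ?_⟩
  · refine (integrableOn_torus (hW.mul (continuous_dualKernel_torusPoint hp1 hx))).congr
      (ae_restrict_of_ae ?_)
    filter_upwards [ae_weight_mul_gauge_eq hp1 hp ht1 ht hq ha K] with θ h
    rw [Pi.mul_apply, dualIntegrand, ← h]
    ring
  · rw [funext hdual]
    exact (differentiableOn_torusAngleIntegral_dualKernel hp1 hW).const_mul _
  · rw [funext hdual, vanDiejen_const_mul, vanDiejen_torusAngleIntegral hp1 hq a r hW hx.1,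
      mul_left_comm]
    congr 1
    set c := -((q ^ n)⁻¹ * t ^ m * theta q p / theta t p) with hc
    -- `kernel_identity` solved for D_x Φ, valid as almost every y on the torus is pole-generic.
    have e1 : torusAngleIntegral (fun y => gaugedWeight p t a K y * φ y *
        vanDiejen p q t a r (fun x => dualKernel p x y) x) =
        torusAngleIntegral (fun y => c * (gaugedWeight p t a K y * φ y *
          vanDiejen p t q a r (fun y => dualKernel p x y) y)) := by
      refine torusAngleIntegral_congr_ae ?_
      filter_upwards [ae_poleGeneric (n := n) (p := p) hq ht] with θ hθ
      have h := kernel_identity hp1 hp hq ht hbranch hθt hθq hθqt ha hbal hx hθ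
      have hqn : q ^ n ≠ 0 := pow_ne_zero n hq
      rw [hc]
      field_simp
      linear_combination gaugedWeight p t a K (torusPoint θ) * φ (torusPoint θ) * h
    -- For y on the torus the shifted points have a coordinate of modulus |t| or |t|⁻¹. They still
    -- lie in the closed annulus, hence in Ω, so the eigenvalue equation is available at almost
    -- every y.
    have e2 : torusAngleIntegral (fun y => gaugedWeight p t a K y * dualKernel p x y *
        vanDiejen p t (p * q⁻¹ * t) (reflect (p * t) K a) (reflectRoot (p * t) K a r) φ y) =
        torusAngleIntegral (fun y => Λ * (gaugedWeight p t a K y * φ y * dualKernel p x y)) := by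
      refine torusAngleIntegral_congr_ae ?_
      filter_upwards [ae_poleGeneric (n := n) (p := p) hq ht] with θ hθ
      rw [heig _ (hann (torusPoint_mem_annulus ht1 ht θ)) hθ.generic fun k =>
        ⟨hann (shift_mem_annulus ht1 ht (Or.inl rfl) k θ),
          hann (shift_mem_annulus ht1 ht (Or.inr rfl) k θ)⟩]
      ring
    rw [e1, torusAngleIntegral_const_mul,
      torusAngleIntegral_adjoint hp hq ht1 ht hpt ha hK haK hr0 hΩ hann hφ hx.1, e2,
      torusAngleIntegral_const_mul]
    ring
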